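/- **Setting.** Let $n=2k\ge 4$ be even and $\rho=e^{2\pi i/n}$. On $[0,1]$ let $\mathbb L_0$ be the operator $(-i)^nD^n$, $D=d/dx$, with boundary conditions $(P_j(D)y)(0)+(Q_j(D)y)(1)=0$, $j=0,\dots,n-1$, where $P_j,Q_j$ are complex polynomials of degree less than $n$. Let $d_j=\max(\deg P_j,\deg Q_j)$, let $a_j,b_j$ be the $d_j$-th coefficients of $P_j,Q_j$, and let $\varkappa=\sum_j d_j$. The conditions are assumed normalized ($\varkappa$ is minimal among all systems obtained from the given one by an invertible linear transformation) and Birkhoff regular, as follows. For $0\le m<n$ let $A_m=(\rho^{md_j}a_j)_j$ and $B_m=(\rho^{md_j}b_j)_j$ (column vectors). The Birkhoff polynomial is $$\mathfrak m+\mathfrak m_1\xi+\mathfrak m_2\xi^2=\det\big[A_0+\xi B_0,\,A_1,\dots,A_{k-1}\,\big|\,\xi A_k+B_k,\,B_{k+1},\dots,B_{n-1}\big];$$ regularity means $\mathfrak m\ne0$ and $\mathfrak m_2\neq 0$. Let $\xi_1,\xi_2$ be its roots (with multiplicity); the conditions are strongly regular if $\xi_1\ne\xi_2$. Put $$\mathfrak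 m_{1,k+1}=\det[A_0,\dots,A_{k-1}\,|\,B_0,B_{k+1},\dots,B_{n-1}],\qquad \mathfrak m_{k+1,1}=\det[B_k,A_1,\dots,A_{k-1}\,|\,A_k,B_{k+1},\dots,B_{n-1}],$$ $$\mathfrak c_0=\frac{\mathfrak m_{1,k+1}-\mathfrak m_{k+1,1}}{i\rho^{\varkappa}\mathfrak m}.$$ **Contours.** Let $r_\ell:\mathbb R\to(0,\infty)$, $\ell\in\mathbb N$, be $C^1$ functions of period $2\pi/n$, let $\Gamma_\ell=\{r_\ell(\phi)e^{i\phi}:0\le\phi\le 2\pi/n\}$, and let $\gamma_\ell=\{z^n:z\in\Gamma_\ell\}$, a closed curve. Assume that the sequence is acceptable: $r_\ell(0)\to\infty$; there are constants $c_1,c_2,\delta>0$ such that for all $\ell$ and $\phi$ one has $|r_\ell(\phi)-r_\ell(0)|\le c_1$, $|r_\ell'(\phi)|\le c_2r_\ell(\phi)$, and $\Gamma_\ell$ has distance at least $\delta$ from $\lambda^{1/n}$ ($\operatorname{Arg}\lambda^{1/n}\in[0,2\pi/n)$) for every eigenvalue $\lambda$ of $\mathbb L_0$. The contours are chosen as follows.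 * If $\xi_1\neq\xi_2$: for all large $\ell$, $r_\ell\le r_{\ell+1}$ and exactly one eigenvalue of $\mathbb L_0$ (counted with algebraic multiplicity) lies between $\gamma_\ell$ and $\gamma_{\ell+1}$; and the eigenvalues are enclosed in ascending order of absolute values, where only asymptotically close ones may be taken in any order: for every $\varepsilon>0$ and all large $\ell$, if $\lambda,\lambda'$ are eigenvalues with $|\lambda|^{1/n}+\varepsilon\le|\lambda'|^{1/n}$ and $\gamma_\ell$ encloses $\lambda'$, then it encloses $\lambda$. * If $\xi_1=\xi_2$: for all large $\ell$, $r_\ell\le r_{\ell+1}$ and exactly two eigenvalues (counted with algebraic multiplicity) lie between $\gamma_\ell$ and $\gamma_{\ell+1}$. **The coefficient.** Let $p_m(z)$, $q_m(z)$ be the columns with entries $P_j(iz\rho^m)/(iz)^{d_j}$ and $Q_j(iz\rho^m)/(iz)^{d_j}$. Let $W(z)$ be the matrix with columns $p_0,\dots,p_{k-1},q_k,\dots,q_{n-1}$ changed as follows: if $0<\operatorname{Arg}z<\pi/n$, then column $0$ is $p_0+e^{iz}q_0$ and column $k$ is $e^{iz}p_k+q_k$; if $\pi/n<\operatorname{Arg}z<2\pi/n$,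 then, with $s=e^{iz\rho^{k-1}}$, column $k-1$ is $p_{k-1}+s\,q_{k-1}$ and column $n-1$ is $s\,p_{n-1}+q_{n-1}$. Let $\hat\Delta=\det W$, and let $\hat\Delta_{1,k+1},\hat\Delta_{k+1,1},\hat\Delta_{k,n},\hat\Delta_{n,k}$ be the determinants obtained from $W$ by replacing, respectively, columns $(0,k)$ by $(p_0,q_0)$; columns $(0,k)$ by $(q_k,p_k)$; columns $(k-1,n-1)$ by $(p_{k-1},q_{k-1})$; columns $(k-1,n-1)$ by $(q_{n-1},p_{n-1})$. The coefficient $\mathfrak C$ is the limit of the arithmetic means (Cesàro limit of order one) of the sequence $$I_\ell=\int_{\Gamma_\ell}\frac{e^{iz}\hat\Delta_{1,k+1}+\rho^ke^{iz}\hat\Delta_{k+1,1}+\rho^{k-1}e^{iz\rho^{k-1}}\hat\Delta_{k,n}+\rho^{n-1}e^{iz\rho^{k-1}}\hat\Delta_{n,k}}{\hat\Delta}\,dz .$$ **Theorem.** The limit $\mathfrak C$ exists and has the following value. 1. If $\xi_1\ne\xi_2$ and $\xi_2/\xi_1\notin(0,\infty)$, then $\displaystyle\mathfrak C=\mathfrak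 c_0\,\frac{\operatorname{Log}(-\xi_2/\xi_1)}{\xi_1-\xi_2}$, where $\operatorname{Im}\operatorname{Log}\in(-\pi,\pi)$. If $\xi_2=t\xi_1$ with $t>1$, the same holds with $\operatorname{Log}(-\xi_2/\xi_1)$ replaced by $\ln t-i\pi$ when, for all large $\ell$ and all eigenvalues $\lambda,\lambda'$ with $\operatorname{Im}\lambda>0>\operatorname{Im}\lambda'$ and $\big||\lambda|^{1/n}-|\lambda'|^{1/n}\big|<\pi$, the contour $\gamma_\ell$ encloses $\lambda$ whenever it encloses $\lambda'$; and by $\ln t+i\pi$ when, under the same conditions, it encloses $\lambda'$ whenever it encloses $\lambda$. 2. If $\xi_1=\xi_2$, then $\displaystyle\mathfrak C=-\frac{\mathfrak c_0}{\xi_1}=-\frac{\mathfrak c_0}{\xi_2}$. -/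

import Mathlib

open Filter Topology Polynomial

noncomputable section

namespace BirkhoffTrace

/-- A system of `n` two-point boundary conditions on `[0, 1]`,
`(P_j(D) y)(0) + (Q_j(D) y)(1) = 0`, with complex polynomials `P_j`, `Q_j` of degree less than `n`;
here `D = d/dx`. -/
structure BoundaryConditions (n : ℕ) where
  P : Fin n → ℂ[X]
  Q : Fin n → ℂ[X]
  degree_P_lt : ∀ j, (P j).degree < n
  degree_Q_lt : ∀ j, (Q j).degree < n

/-- The determinant of the `n × n` matrix whose columns are `c 0, …, c (n - 1)`. -/
def detCols {R : Type*} [CommRing R] {n : ℕ} (c : ℕ → Fin n → R) : R :=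
  (Matrix.of fun (j m : Fin n) => c m j).det

/-- `ρ = exp (2 π i / n)`. -/
def rho (n : ℕ) : ℂ := Complex.exp (2 * Real.pi * Complex.I / n)

/-- The columns of the truncated characteristic matrix. With `n = 2 k`, the columns numbered
`0, …, k - 1` are `p m`, the columns numbered `k, …, n - 1` are `q m`, except that column `i₁` is
`p i₁ + s q i₁` and column `i₂` is `s p i₂ + q i₂`. -/
def truncCols {R : Type*} [CommRing R] {n : ℕ} (p q : ℕ → Fin n → R) (s : R) (i₁ i₂ : ℕ) :
    ℕ → Fin n → R := fun m =>
  if m = i₁ then p m + s • q m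
  else if m = i₂ then s • p m + q m
  else if m < n / 2 then p m
  else q m

section LeadingCoefficients

/-! Quantities that depend only on the orders `d_j` and the leading coefficients `a_j`, `b_j` of
the boundary conditions; `k = n / 2`. -/

variable {n : ℕ} (d : Fin n → ℕ) (a b : Fin n → ℂ)

/-- The column with entries `ρ ^ (m d_j) c_j`. -/
def leadCol (c : Fin n → ℂ) (m : ℕ) : Fin n → ℂ := fun j => rho n ^ (m * d j) * c j

/-- The Birkhoff polynomial `𝔪 + 𝔪₁ X + 𝔪₂ X²`: the determinant `[𝒜₁ | ℬ₁]` with every entry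
replaced by its leading term and `e^{iz}` replaced by the variable `X`. -/
def birkhoffPoly : ℂ[X] :=
  detCols (truncCols (fun m j => C (leadCol d a m j)) (fun m j => C (leadCol d b m j))
    X 0 (n / 2))

/-- The determinant `𝔪`, the constant coefficient of the Birkhoff polynomial. -/
def frakM : ℂ := (birkhoffPoly d a b).coeff 0

/-- The columns `ρ^{m d} a` for `m < k`, and `ρ^{m d} b` for `m ≥ k`. -/
def leadCols : ℕ → Fin n → ℂ := fun m =>
  if m < n / 2 then leadCol d a m else leadCol d b m

/-- The determinant `𝔪_{1,k+1}`. -/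
def frakM1k : ℂ :=
  detCols (Function.update (leadCols d a b) (n / 2) (leadCol d b 0))

/-- The determinant `𝔪_{k+1,1}`. -/
def frakMk1 : ℂ :=
  detCols (Function.update (Function.update (leadCols d a b) 0 (leadCol d b (n / 2)))
    (n / 2) (leadCol d a (n / 2)))

/-- The constant `𝔠₀ = (𝔪_{1,k+1} - 𝔪_{k+1,1}) / (i ρ^ϰ 𝔪)` with `ϰ = ∑ d_j`. -/
def frakC₀ : ℂ :=
  (frakM1k d a b - frakMk1 d a b) / (Complex.I * rho n ^ (∑ j, d j) * frakM d a b)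

end LeadingCoefficients

namespace BoundaryConditions

variable {n : ℕ} (B : BoundaryConditions n)

/-- `d_j`, the maximum of the degrees of `P_j` and `Q_j`. -/
def d (j : Fin n) : ℕ := max (B.P j).natDegree (B.Q j).natDegree

/-- The `d_j`-th coefficient of `P_j`. -/
def a (j : Fin n) : ℂ := (B.P j).coeff (B.d j)

/-- The `d_j`-th coefficient of `Q_j`. -/
def b (j : Fin n) : ℂ := (B.Q j).coeff (B.d j)

/-- The boundary conditions are normalized: `ϰ = ∑ d_j` is minimal among all the systems that are
obtained from the given one by an invertible linear transformation. -/
def Normalized : Prop :=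
  ∀ M : Matrix (Fin n) (Fin n) ℂ, IsUnit M.det →
    ∑ j, B.d j ≤ ∑ j, max (∑ i, M j i • B.P i).natDegree (∑ i, M j i • B.Q i).natDegree

/-- The Birkhoff polynomial of the boundary conditions. -/
def birkhoff : ℂ[X] := birkhoffPoly B.d B.a B.b

/-- Birkhoff regularity for even `n`: the extreme coefficients of the Birkhoff polynomial do not
vanish. -/
def Regular : Prop := B.birkhoff.coeff 0 ≠ 0 ∧ B.birkhoff.coeff 2 ≠ 0

/-! ### The operator `𝕃₀` and its eigenvalues -/

/-- `B.Maps u v`: the function `u` on `[0, 1]` is `n` times continuously differentiable up to the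
endpoints, it satisfies the boundary conditions, and `𝕃₀ u = (-i)ⁿ Dⁿ u = v`. (Eigenfunctions and
associated functions in the maximal domain of `𝕃₀` are automatically of class `Cⁿ`.) -/
def Maps (u v : Set.Icc (0 : ℝ) 1 → ℂ) : Prop :=
  ∃ y : ℝ → ℂ, ContDiff ℝ n y ∧ (∀ x : Set.Icc (0 : ℝ) 1, y x = u x) ∧
    (∀ j, ((B.P j).sum fun i c => c * iteratedDeriv i y 0) +
      ((B.Q j).sum fun i c => c * iteratedDeriv i y 1) = 0) ∧
    ∀ x : Set.Icc (0 : ℝ) 1, v x = (-Complex.I) ^ n * iteratedDeriv n y x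

/-- `l` is an eigenvalue of `𝕃₀`. -/
def IsEigenvalue (l : ℂ) : Prop := ∃ u, u ≠ 0 ∧ B.Maps u (l • u)

/-- `B.IsRootFun l m u`: `u` lies in the kernel of `(𝕃₀ - l) ^ m`. -/
def IsRootFun (l : ℂ) : ℕ → (Set.Icc (0 : ℝ) 1 → ℂ) → Prop
  | 0, u => u = 0
  | m + 1, u => ∃ v, B.Maps u v ∧ IsRootFun l m (v - l • u)

/-- The algebraic multiplicity of `l`: the dimension of its root subspace
`⋃ m, ker (𝕃₀ - l) ^ m`. -/
def multiplicity (l : ℂ) : ℕ∞ :=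
  Cardinal.toENat (Module.rank ℂ (Submodule.span ℂ {u | ∃ m, B.IsRootFun l m u}))

/-! ### The determinants with hats

The functions `P_j(i z ρ^m) / (i z)^{d_j}` and `Q_j(i z ρ^m) / (i z)^{d_j}` are polynomials in
`z⁻¹` with constant terms `ρ^{m d_j} a_j` and `ρ^{m d_j} b_j`. In the sector `0 < Arg z < π / n`
all exponentials in the characteristic determinant are negligible except `e^{iz}`, which enters
the columns `1` and `k + 1`; in the sector `π / n < Arg z < 2 π / n` the exception is
`e^{i z ρ^{k-1}}`, which enters the columns `k` and `n`. Columns are numbered from `0` below. -/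

/-- Column `m` with entries `P_j(i z ρ^m) / (i z)^{d_j}`. -/
def colP (z : ℂ) (m : ℕ) : Fin n → ℂ := fun j =>
  (B.P j).eval (Complex.I * z * rho n ^ m) / (Complex.I * z) ^ B.d j

/-- Column `m` with entries `Q_j(i z ρ^m) / (i z)^{d_j}`. -/
def colQ (z : ℂ) (m : ℕ) : Fin n → ℂ := fun j =>
  (B.Q j).eval (Complex.I * z * rho n ^ m) / (Complex.I * z) ^ B.d j

/-- The columns of `[𝒜₁ | ℬ₁]`, for the first sector. -/
def cols₁ (z : ℂ) : ℕ → Fin n → ℂ :=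
  truncCols (B.colP z) (B.colQ z) (Complex.exp (Complex.I * z)) 0 (n / 2)

/-- The columns of `[𝒜₂ | ℬ₂]`, for the second sector. -/
def cols₂ (z : ℂ) : ℕ → Fin n → ℂ :=
  truncCols (B.colP z) (B.colQ z) (Complex.exp (Complex.I * z * rho n ^ (n / 2 - 1)))
    (n / 2 - 1) (n - 1)

/-- `Δ̂_{1,k+1}(z)`, where `W` are the columns for the sector of `z`. -/
def hatDelta1k (W : ℕ → Fin n → ℂ) (z : ℂ) : ℂ :=
  detCols (Function.update (Function.update W 0 (B.colP z 0)) (n / 2) (B.colQ z 0))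

/-- `Δ̂_{k+1,1}(z)`, where `W` are the columns for the sector of `z`. -/
def hatDeltak1 (W : ℕ → Fin n → ℂ) (z : ℂ) : ℂ :=
  detCols (Function.update (Function.update W 0 (B.colQ z (n / 2))) (n / 2) (B.colP z (n / 2)))

/-- `Δ̂_{k,n}(z)`, where `W` are the columns for the sector of `z`. -/
def hatDeltakn (W : ℕ → Fin n → ℂ) (z : ℂ) : ℂ :=
  detCols (Function.update (Function.update W (n / 2 - 1) (B.colP z (n / 2 - 1)))
    (n - 1) (B.colQ z (n / 2 - 1)))

/-- `Δ̂_{n,k}(z)`, where `W` are the columns for the sector of `z`. -/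
def hatDeltank (W : ℕ → Fin n → ℂ) (z : ℂ) : ℂ :=
  detCols (Function.update (Function.update W (n / 2 - 1) (B.colQ z (n - 1)))
    (n - 1) (B.colP z (n - 1)))

/-- The sum `𝕀_{1,k+1} + 𝕀_{k+1,1} + 𝕀_{k,n} + 𝕀_{n,k}` at `z`, where `W` are the columns for the
sector of `z` (so that `Δ̂(z) = detCols W`). -/
def integrand (W : ℕ → Fin n → ℂ) (z : ℂ) : ℂ :=
  Complex.exp (Complex.I * z) * (B.hatDelta1k W z / detCols W)
    + rho n ^ (n / 2) * Complex.exp (Complex.I * z) * (B.hatDeltak1 W z / detCols W)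
    + rho n ^ (n / 2 - 1) * Complex.exp (Complex.I * z * rho n ^ (n / 2 - 1))
      * (B.hatDeltakn W z / detCols W)
    + rho n ^ (n - 1) * Complex.exp (Complex.I * z * rho n ^ (n / 2 - 1))
      * (B.hatDeltank W z / detCols W)

end BoundaryConditions

/-! ### Contours -/

/-- A contour `Γ = {r(φ) e^{iφ} : 0 ≤ φ ≤ 2 π / n}` such that `γ = Γⁿ` is a closed smooth curve:
`r` is positive, continuously differentiable and has period `2 π / n`. -/
structure Contour (n : ℕ) where
  r : ℝ → ℝ
  pos : ∀ φ, 0 < r φ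
  contDiff : ContDiff ℝ 1 r
  periodic : Function.Periodic r (2 * Real.pi / n)

namespace Contour

variable {n : ℕ} (Γ : Contour n)

/-- The point of `Γ` with argument `φ`. -/
def pt (φ : ℝ) : ℂ := Γ.r φ * Complex.exp (Complex.I * φ)

/-- The point `l` lies inside the closed curve `γ = Γⁿ`. -/
def Encloses (l : ℂ) : Prop := ‖l‖ < Γ.r (l.arg / n) ^ n

/-- The integral along `Γ`, from `φ = 0` to `φ = 2 π / n`, of
`𝕀_{1,k+1} + 𝕀_{k+1,1} + 𝕀_{k,n} + 𝕀_{n,k}`. -/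
def integral (B : BoundaryConditions n) : ℂ :=
  (∫ φ in (0 : ℝ)..(Real.pi / n), B.integrand (B.cols₁ (Γ.pt φ)) (Γ.pt φ) * deriv Γ.pt φ)
    + ∫ φ in (Real.pi / n)..(2 * Real.pi / n),
        B.integrand (B.cols₂ (Γ.pt φ)) (Γ.pt φ) * deriv Γ.pt φ

end Contour

/-- `z` is the root `l^{1/n}` with `Arg z ∈ [0, 2 π / n)`. -/
def IsNthRoot (n : ℕ) (l z : ℂ) : Prop :=
  z ^ n = l ∧ ∃ t φ : ℝ, 0 ≤ t ∧ 0 ≤ φ ∧ φ < 2 * Real.pi / n ∧ z = t * Complex.exp (Complex.I * φ)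

variable {n : ℕ}

/-- The sequence of contours is acceptable for `𝕃₀`. (As `w = e^{iφ}`, one has
`|dR/dw| = |r'(φ)|`.) -/
def Acceptable (B : BoundaryConditions n) (Γ : ℕ → Contour n) : Prop :=
  Tendsto (fun ℓ => (Γ ℓ).r 0) atTop atTop ∧
  (∃ c₁ > 0, ∀ ℓ φ, |(Γ ℓ).r φ - (Γ ℓ).r 0| ≤ c₁) ∧
  (∃ c₂ > 0, ∀ ℓ φ, |deriv (Γ ℓ).r φ| ≤ c₂ * (Γ ℓ).r φ) ∧
  ∃ δ > 0, ∀ ℓ l z, B.IsEigenvalue l → IsNthRoot n l z →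
    ∀ φ ∈ Set.Icc (0 : ℝ) (2 * Real.pi / n), δ ≤ ‖(Γ ℓ).pt φ - z‖

/-- From some place on, the contours are nested and there are exactly `N` eigenvalues of `𝕃₀`,
counted with multiplicities, between each two neighbouring ones. -/
def Separates (B : BoundaryConditions n) (Γ : ℕ → Contour n) (N : ℕ∞) : Prop :=
  ∀ᶠ ℓ in atTop, (∀ φ, (Γ ℓ).r φ ≤ (Γ (ℓ + 1)).r φ) ∧
    ∑ᶠ l ∈ {l | B.IsEigenvalue l ∧ ¬ (Γ ℓ).Encloses l ∧ (Γ (ℓ + 1)).Encloses l},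
      B.multiplicity l = N

/-- The contours exhaust the eigenvalues in ascending order of their absolute values, where only
asymptotically close absolute values of `l^{1/n}` may be taken in any order. -/
def Ascending (B : BoundaryConditions n) (Γ : ℕ → Contour n) : Prop :=
  ∀ ε > (0 : ℝ), ∀ᶠ ℓ in atTop, ∀ l l', B.IsEigenvalue l → B.IsEigenvalue l' →
    ‖l‖ ^ (1 / n : ℝ) + ε ≤ ‖l'‖ ^ (1 / n : ℝ) → (Γ ℓ).Encloses l' → (Γ ℓ).Encloses l

/-- Of two eigenvalues in the upper and in the lower half-plane with close absolute values, the
one in the upper half-plane is enclosed first. -/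
def UpperFirst (B : BoundaryConditions n) (Γ : ℕ → Contour n) : Prop :=
  ∀ᶠ ℓ in atTop, ∀ l l', B.IsEigenvalue l → B.IsEigenvalue l' → 0 < l.im → l'.im < 0 →
    |‖l‖ ^ (1 / n : ℝ) - ‖l'‖ ^ (1 / n : ℝ)| < Real.pi → (Γ ℓ).Encloses l' → (Γ ℓ).Encloses l

/-- Of two eigenvalues in the upper and in the lower half-plane with close absolute values, the
one in the lower half-plane is enclosed first. -/
def LowerFirst (B : BoundaryConditions n) (Γ : ℕ → Contour n) : Prop :=
  ∀ᶠ ℓ in atTop, ∀ l l', B.IsEigenvalue l → B.IsEigenvalue l' → 0 < l.im → l'.im < 0 →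
    |‖l‖ ^ (1 / n : ℝ) - ‖l'‖ ^ (1 / n : ℝ)| < Real.pi → (Γ ℓ).Encloses l → (Γ ℓ).Encloses l'

/-- The Cesàro limit of order one: `I` is mean-value convergent to `L`. -/
def CesaroLim (I : ℕ → ℂ) (L : ℂ) : Prop :=
  Tendsto (fun m : ℕ => (1 / (m : ℂ)) * ∑ ℓ ∈ Finset.range m, I ℓ) atTop (𝓝 L)

/-- `𝔠 = L`: the Cesàro limit that defines the coefficient `𝔠` for the given sequence of contours
exists and equals `L`. -/
def CoefficientEq (B : BoundaryConditions n) (Γ : ℕ → Contour n) (L : ℂ) : Prop :=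
  CesaroLim (fun ℓ => (Γ ℓ).integral B) L

end BirkhoffTrace

end

/-! Write w = e^{iz}, let b be the Birkhoff polynomial and choose ω₀, ω₁ with e^{iω₀} = ξ₁, e^{iω₁}
= ξ₂. The proof reduces the contour integral to a logarithmic integral of a rational function of w
and then counts points of the lattices ω₀ + 2πℤ and ω₁ + 2πℤ.

Reduction. Replacing z by ρz shifts the columns p_m, q_m cyclically, so the second sector turned
back by 2π/n becomes the sector -π/n ≤ Arg z ≤ 0, and its integrand becomes the same function
`mainTerm` as in the first sector, up to an exponentially small remainder (`integrand_cols₁`,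
`integrand_cols₂_rho`). As z → ∞ the determinants tend to those of the leading coefficients, and
`mainTerm` tends to `limitTerm` = (𝔪_{1,k+1} - 𝔪_{k+1,1}) w / b(w). The error is o(1) e^{-|Im z|},
whose integral along the contour tends to zero although the contour gets longer
(`tendsto_integral_sub`). This needs contours that stay away from both lattices. The acceptability
condition speaks of eigenvalues instead; but the characteristic determinant is close to b(e^{iz}),
so every remote lattice point has an eigenvalue root nearby (`eventually_exists_isEigenvalue`) and
the distance condition carries over (`exists_away`).

Distinct roots. By partial fractions the limit integral is -𝔠₀/(ξ₁ - ξ₂) times the difference of the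
integrals of d log(w - ξ₁) and d log(w - ξ₂). Each of these is computed exactly by
`Contour.integral_dlog`; up to o(1) it equals i(ω + 2πJ + π) plus a term common to both lattices,
where J is the index of the last lattice point inside the contour. Hence I_ℓ = 𝔠₀ i(ω₁ - ω₀ - 2π(J₀
- J₁))/(ξ₁ - ξ₂) + o(1). One eigenvalue between neighbouring contours makes J₀ + J₁ grow by one at
each step (`eventually_index_succ`), and the ascending order forces J₁ ≤ J₀ ≤ J₁ + 1. So J₀ - J₁
alternates between 0 and 1, and the mean of I_ℓ tends to the value with π in place of 2π(J₀ - J₁)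
(`coefficientEq_of_index`). If Re(ω₁ - ω₀) is taken in (0, 2π), then i(ω₁ - ω₀ - π) is the principal
logarithm of -ξ₂/ξ₁.

If ξ₂ = tξ₁, the two lattices have the same real parts and the ascending order leaves a tie. Since
|ξ₁ξ₂| = 1, one lattice lies above the real axis and the other below, and the rule on half-planes
breaks the tie. This gives ln t ∓ iπ.

Double root. Here `limitTerm` has the antiderivative 𝔠₀/(w - ξ), and w tends to 0 and to ∞ at the
two ends of the contour, so I_ℓ itself converges. -/

namespace BirkhoffTrace

/-! ### Multilinear algebra of determinants given by columns. -/

section Determinants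

variable {R : Type*} [CommRing R] {n : ℕ}

theorem detCols_congr {c c' : ℕ → Fin n → R} (h : ∀ m < n, c m = c' m) :
    detCols c = detCols c' := by
  unfold detCols
  congr 1
  ext j m
  simp [h m m.2]

/-- A cycle of even length is an odd permutation. All the signs produced by rotating the sector come
from here. -/
theorem detCols_cyclic (hn : Even n) (h0 : 0 < n) (c : ℕ → Fin n → R) :
    detCols (fun m => c ((m + 1) % n)) = -detCols c := by
  obtain ⟨N, rfl⟩ : ∃ N, n = N + 1 := ⟨n - 1, by omega⟩
  have h1 : (Matrix.of fun (j m : Fin (N + 1)) => c (((m : ℕ) + 1) % (N + 1)) j)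
      = (Matrix.of fun (j m : Fin (N + 1)) => c m j).submatrix id (finRotate (N + 1)) := by
    ext j m
    simp only [Matrix.of_apply, Matrix.submatrix_apply, id]
    congr 1
    simp [Fin.val_add]
  have hodd : Odd N := by
    rcases Nat.even_or_odd N with h | h
    · exact absurd hn (by simpa [Nat.even_add_one] using h)
    · exact h
  unfold detCols
  rw [h1, Matrix.det_permute', sign_finRotate, Nat.add_sub_cancel, hodd.neg_one_pow]
  simp

theorem detCols_rowScale (s : Fin n → R) (c : ℕ → Fin n → R) :
    detCols (fun m j => s j * c m j) = (∏ j, s j) * detCols c := by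
  unfold detCols
  exact Matrix.det_mul_column s _

theorem detCols_colScale (s : ℕ → R) (c : ℕ → Fin n → R) :
    detCols (fun m j => s m * c m j) = (∏ m : Fin n, s m) * detCols c := by
  unfold detCols
  exact Matrix.det_mul_row (fun m : Fin n => s m) _

theorem detCols_map {S : Type*} [CommRing S] (f : R →+* S) (c : ℕ → Fin n → R) :
    f (detCols c) = detCols (fun m j => f (c m j)) := by
  unfold detCols
  rw [RingHom.map_det]
  rfl

/-- The columns `p m` for `m < n / 2` and `q m` for `m ≥ n / 2`, with the columns `0` and `n / 2`
replaced by `x` and `y`. -/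
def pairCols (p q : ℕ → Fin n → R) (x y : Fin n → R) : ℕ → Fin n → R :=
  Function.update (Function.update (fun m => if m < n / 2 then p m else q m) 0 x) (n / 2) y

theorem detCols_update_add (c : ℕ → Fin n → R) {i : ℕ} (hi : i < n) (x x' : Fin n → R) :
    detCols (Function.update c i (x + x'))
      = detCols (Function.update c i x) + detCols (Function.update c i x') := by
  have key : ∀ x : Fin n → R, detCols (Function.update c i x)
      = ((Matrix.of fun (j m : Fin n) => c m j).updateCol ⟨i, hi⟩ x).det := by
    intro x
    unfold detCols
    congr 1
    ext j m
    by_cases h : m = ⟨i, hi⟩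
    · subst h; simp
    · have : (m : ℕ) ≠ i := fun h' => h (Fin.ext h')
      simp [Matrix.updateCol_ne h, this]
  rw [key, key, key, Matrix.det_updateCol_add]

theorem detCols_update_smul (c : ℕ → Fin n → R) {i : ℕ} (hi : i < n) (s : R) (x : Fin n → R) :
    detCols (Function.update c i (s • x)) = s * detCols (Function.update c i x) := by
  have key : ∀ x : Fin n → R, detCols (Function.update c i x)
      = ((Matrix.of fun (j m : Fin n) => c m j).updateCol ⟨i, hi⟩ x).det := by
    intro x
    unfold detCols
    congr 1
    ext j m
    by_cases h : m = ⟨i, hi⟩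
    · subst h; simp
    · have : (m : ℕ) ≠ i := fun h' => h (Fin.ext h')
      simp [Matrix.updateCol_ne h, this]
  rw [key, key, Matrix.det_updateCol_smul]

theorem detCols_pairCols_bilin (hn : 2 ≤ n) (p q : ℕ → Fin n → R) (s t s' t' : R)
    (x x' y y' : Fin n → R) :
    detCols (pairCols p q (s • x + t • x') (s' • y + t' • y'))
      = s * s' * detCols (pairCols p q x y) + s * t' * detCols (pairCols p q x y')
        + t * s' * detCols (pairCols p q x' y) + t * t' * detCols (pairCols p q x' y') := by
  have hk : n / 2 < n := Nat.div_lt_self (by omega) (by omega)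
  have hk0 : n / 2 ≠ 0 := by omega
  unfold pairCols
  simp only [detCols_update_add _ hk, detCols_update_smul _ hk]
  simp only [Function.update_comm hk0.symm, detCols_update_add _ (by omega : 0 < n),
    detCols_update_smul _ (by omega : 0 < n)]
  ring

theorem truncCols_eq_pairCols (hn : 2 ≤ n) (p q : ℕ → Fin n → R) (s : R) :
    truncCols p q s 0 (n / 2)
      = pairCols p q ((1 : R) • p 0 + s • q 0) (s • p (n / 2) + (1 : R) • q (n / 2)) := by
  have hk0 : n / 2 ≠ 0 := by omega
  funext m
  unfold truncCols pairCols
  by_cases h0 : m = 0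
  · subst h0; simp [hk0.symm]
  · by_cases h1 : m = n / 2
    · subst h1; simp [hk0]
    · simp [h0, h1]

/-- Used both for the actual columns and for the leading ones: the truncated determinant and the
Birkhoff polynomial are quadratics in the same variable, so comparing them means comparing these
four determinants. -/
theorem detCols_truncCols (hn : 2 ≤ n) (p q : ℕ → Fin n → R) (s : R) :
    detCols (truncCols p q s 0 (n / 2))
      = detCols (pairCols p q (p 0) (q (n / 2)))
        + s * (detCols (pairCols p q (p 0) (p (n / 2))) + detCols (pairCols p q (q 0) (q (n / 2))))
        + s ^ 2 * detCols (pairCols p q (q 0) (p (n / 2))) := by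
  rw [truncCols_eq_pairCols hn, detCols_pairCols_bilin hn]
  ring

end Determinants

/-! ### The Birkhoff polynomial and its cyclic symmetry. -/

section Leading

variable {n : ℕ} (d : Fin n → ℕ) (a b : Fin n → ℂ)

theorem birkhoffPoly_eval (w : ℂ) :
    (birkhoffPoly d a b).eval w
      = detCols (truncCols (leadCol d a) (leadCol d b) w 0 (n / 2)) := by
  unfold birkhoffPoly
  rw [← coe_evalRingHom, detCols_map]
  congr 1
  funext m j
  unfold truncCols
  split_ifs <;> simp <;> ring

theorem birkhoffPoly_eq (hn : 2 ≤ n) :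
    birkhoffPoly d a b
      = C (detCols (pairCols (leadCol d a) (leadCol d b) (leadCol d a 0) (leadCol d b (n / 2))))
        + X * C (detCols (pairCols (leadCol d a) (leadCol d b) (leadCol d a 0) (leadCol d a (n / 2)))
          + detCols (pairCols (leadCol d a) (leadCol d b) (leadCol d b 0) (leadCol d b (n / 2))))
        + X ^ 2 * C (detCols (pairCols (leadCol d a) (leadCol d b) (leadCol d b 0)
            (leadCol d a (n / 2)))) := by
  refine Polynomial.funext fun w => ?_
  rw [birkhoffPoly_eval, detCols_truncCols hn]
  simp only [eval_add, eval_mul, eval_C, eval_X, eval_pow]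

theorem birkhoffPoly_coeff_zero (hn : 2 ≤ n) : (birkhoffPoly d a b).coeff 0
    = detCols (pairCols (leadCol d a) (leadCol d b) (leadCol d a 0) (leadCol d b (n / 2))) := by
  rw [birkhoffPoly_eq d a b hn]
  simp [coeff_X_pow]

theorem birkhoffPoly_coeff_two (hn : 2 ≤ n) : (birkhoffPoly d a b).coeff 2
    = detCols (pairCols (leadCol d a) (leadCol d b) (leadCol d b 0) (leadCol d a (n / 2))) := by
  rw [birkhoffPoly_eq d a b hn]
  simp [coeff_X_pow]

theorem birkhoffPoly_natDegree_le (hn : 2 ≤ n) : (birkhoffPoly d a b).natDegree ≤ 2 := by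
  rw [birkhoffPoly_eq d a b hn]
  compute_degree

theorem frakM1k_eq (hn : 2 ≤ n) : frakM1k d a b
    = detCols (pairCols (leadCol d a) (leadCol d b) (leadCol d a 0) (leadCol d b 0)) := by
  have hk0 : 0 < n / 2 := by omega
  unfold frakM1k pairCols leadCols
  congr 2
  rw [eq_comm, Function.update_eq_self_iff]
  simp [hk0]

theorem frakMk1_eq : frakMk1 d a b
    = detCols (pairCols (leadCol d a) (leadCol d b) (leadCol d b (n / 2))
        (leadCol d a (n / 2))) := rfl

theorem rho_pow_self (hn : n ≠ 0) : rho n ^ n = 1 := by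
  unfold rho
  rw [← Complex.exp_nat_mul, Complex.exp_eq_one_iff]
  refine ⟨1, ?_⟩
  have : (n : ℂ) ≠ 0 := by exact_mod_cast hn
  field_simp
  simp

theorem rho_ne_zero : rho n ≠ 0 := Complex.exp_ne_zero _

theorem isPrimitiveRoot_rho (hn : n ≠ 0) : IsPrimitiveRoot (rho n) n :=
  Complex.isPrimitiveRoot_exp n hn

theorem rho_pow_half (hn : Even n) (h0 : n ≠ 0) : rho n ^ (n / 2) = -1 := by
  obtain ⟨k, rfl⟩ := hn
  have hk : (k : ℂ) ≠ 0 := by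
    have : k ≠ 0 := by omega
    exact_mod_cast this
  rw [show (k + k) / 2 = k by omega]
  unfold rho
  rw [← Complex.exp_nat_mul, ← Complex.exp_pi_mul_I]
  congr 1
  push_cast
  field_simp
  ring

theorem leadCol_add_period (hn : n ≠ 0) (c : Fin n → ℂ) (m : ℕ) :
    leadCol d c (m + n) = leadCol d c m := by
  funext j
  unfold leadCol
  rw [add_mul, pow_add, pow_mul (rho n) n, rho_pow_self hn, one_pow, mul_one]

theorem leadCol_succ (c : Fin n → ℂ) (m : ℕ) (j : Fin n) :
    leadCol d c (m + 1) j = rho n ^ d j * leadCol d c m j := by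
  unfold leadCol
  rw [add_mul, pow_add, one_mul]
  ring

/-- The extreme coefficients of the Birkhoff polynomial differ by a root of unity. -/
theorem birkhoffPoly_coeff_two_eq (hn : Even n) (h4 : 4 ≤ n) :
    (birkhoffPoly d a b).coeff 2 = -rho n ^ (∑ j, d j) * (birkhoffPoly d a b).coeff 0 := by
  rw [birkhoffPoly_coeff_zero d a b (by omega), birkhoffPoly_coeff_two d a b (by omega),
    ← Finset.prod_pow_eq_pow_sum, neg_mul, ← detCols_rowScale, eq_comm, neg_eq_iff_eq_neg,
    ← detCols_cyclic hn (by omega)]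
  apply detCols_congr
  intro m hm
  funext j
  obtain ⟨k, hk⟩ := hn
  have hk2 : n / 2 = k := by omega
  have h0 := leadCol_add_period d (by omega : n ≠ 0) b 0
  rw [zero_add] at h0
  simp only [pairCols, hk2]
  -- Multiplication by ρ^{d_j} raises the column index by one. Column n-1 wraps round to the
  -- b-column number 0 because ρⁿ = 1, and column k-1 becomes the a-column number k: these are
  -- exactly the two replaced columns of the leading coefficient.
  by_cases h1 : m + 1 = n
  · have e1 : m ≠ k := by omega
    have e2 : m ≠ 0 := by omega
    have e3 : ¬ m < k := by omega
    have e4 : (0 : ℕ) ≠ k := by omega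
    rw [h1, Nat.mod_self]
    simp only [Function.update_of_ne e4, Function.update_self, Function.update_of_ne e1,
      Function.update_of_ne e2, if_neg e3]
    rw [← leadCol_succ, h1, h0]
  · rw [Nat.mod_eq_of_lt (by omega : m + 1 < n)]
    by_cases h3 : m + 1 = k
    · have e1 : m ≠ k := by omega
      rw [h3, Function.update_self, Function.update_of_ne e1, ← h3, leadCol_succ]
      by_cases e2 : m = 0
      · subst e2; simp
      · simp [e2]
    · have e0 : m + 1 ≠ 0 := by omega
      rw [Function.update_of_ne h3, Function.update_of_ne e0]
      by_cases h4 : m = k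
      · subst h4
        rw [Function.update_self, if_neg (by omega), leadCol_succ]
      · rw [Function.update_of_ne h4]
        by_cases h5 : m = 0
        · subst h5
          rw [Function.update_self, if_pos (by omega), leadCol_succ]
        · rw [Function.update_of_ne h5]
          by_cases h6 : m < k
          · rw [if_pos h6, if_pos (by omega), leadCol_succ]
          · rw [if_neg h6, if_neg (by omega), leadCol_succ]

end Leading

/-! ### Rotation by ρ: the second sector in terms of the first. -/

section Shift

variable {R : Type*} [CommRing R] {n : ℕ}

theorem detCols_of_cyclic (hn : Even n) (h0 : 0 < n) {s : Fin n → R} {c c' : ℕ → Fin n → R}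
    (h : ∀ m < n, c m = fun j => s j * c' ((m + 1) % n) j) :
    detCols c = -(∏ j, s j) * detCols c' := by
  rw [detCols_congr h, detCols_rowScale s (fun m => c' ((m + 1) % n)), detCols_cyclic hn h0]
  ring

/-- A cyclic shift turns the columns `n / 2 - 1` and `n - 1` into the columns `n / 2` and `0`. -/
theorem detCols_shift (hn : Even n) (h4 : 4 ≤ n) {s : Fin n → R} {p q p' q' : ℕ → Fin n → R}
    (hp : ∀ m, p m = fun j => s j * p' (m + 1) j) (hq : ∀ m, q m = fun j => s j * q' (m + 1) j)
    (x y : Fin n → R) :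
    detCols (Function.update (Function.update (fun m => if m < n / 2 then p m else q m)
        (n / 2 - 1) (fun j => s j * x j)) (n - 1) (fun j => s j * y j))
      = -(∏ j, s j) * detCols (pairCols p' q' y x) := by
  apply detCols_of_cyclic hn (by omega)
  intro m hm
  obtain ⟨k, hk⟩ := hn
  have hk2 : n / 2 = k := by omega
  simp only [pairCols, hk2]
  by_cases h1 : m = n - 1
  · have e4 : (0 : ℕ) ≠ k := by omega
    subst h1
    rw [show n - 1 + 1 = n by omega, Nat.mod_self, Function.update_self,
      Function.update_of_ne e4, Function.update_self]
  · rw [Nat.mod_eq_of_lt (by omega : m + 1 < n), Function.update_of_ne h1]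
    by_cases h3 : m = k - 1
    · subst h3
      rw [Function.update_self, show k - 1 + 1 = k by omega, Function.update_self]
    · rw [Function.update_of_ne h3, Function.update_of_ne (by omega : m + 1 ≠ k),
        Function.update_of_ne (by omega : m + 1 ≠ 0)]
      by_cases h6 : m < k
      · rw [if_pos h6, if_pos (by omega), hp]
      · rw [if_neg h6, if_neg (by omega), hq]

theorem truncCols_eq_update (h4 : 4 ≤ n) (p q : ℕ → Fin n → R) (s : R) :
    truncCols p q s (n / 2 - 1) (n - 1)
      = Function.update (Function.update (fun m => if m < n / 2 then p m else q m)
        (n / 2 - 1) (p (n / 2 - 1) + s • q (n / 2 - 1))) (n - 1)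
        (s • p (n - 1) + q (n - 1)) := by
  funext m
  unfold truncCols
  by_cases h0 : m = n / 2 - 1
  · have : n / 2 - 1 ≠ n - 1 := by omega
    subst h0; simp [this]
  · by_cases h1 : m = n - 1
    · subst h1; simp [h0]
    · simp [h0, h1]

end Shift

namespace BoundaryConditions

variable {n : ℕ} (B : BoundaryConditions n)

/-- The argument i(ρz)ρ^m equals izρ^{m+1}, so a rotation of z is a shift of the column index; the
row factor comes from the denominator (iρz)^{d_j}. -/
theorem colP_rho_mul (z : ℂ) (m : ℕ) : B.colP (rho n * z) m
    = fun j => (rho n ^ B.d j)⁻¹ * B.colP z (m + 1) j := by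
  funext j
  unfold colP
  rw [show Complex.I * (rho n * z) = rho n * (Complex.I * z) by ring, mul_pow, pow_succ',
    show rho n * (Complex.I * z) * rho n ^ m = Complex.I * z * (rho n * rho n ^ m) by ring]
  have := rho_ne_zero (n := n)
  rw [mul_comm (rho n ^ B.d j), ← div_div]
  ring

theorem colQ_rho_mul (z : ℂ) (m : ℕ) : B.colQ (rho n * z) m
    = fun j => (rho n ^ B.d j)⁻¹ * B.colQ z (m + 1) j := by
  funext j
  unfold colQ
  rw [show Complex.I * (rho n * z) = rho n * (Complex.I * z) by ring, mul_pow, pow_succ',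
    show rho n * (Complex.I * z) * rho n ^ m = Complex.I * z * (rho n * rho n ^ m) by ring]
  have := rho_ne_zero (n := n)
  rw [mul_comm (rho n ^ B.d j), ← div_div]
  ring

theorem colP_self (hn : n ≠ 0) (z : ℂ) : B.colP z n = B.colP z 0 := by
  funext j
  simp [colP, rho_pow_self hn]

theorem colQ_self (hn : n ≠ 0) (z : ℂ) : B.colQ z n = B.colQ z 0 := by
  funext j
  simp [colQ, rho_pow_self hn]

/-- `B.pairDet z x y` is the determinant of `p₀, …, p_{k-1}, q_k, …, q_{n-1}` at `z` with the
columns `0` and `k` replaced by `x` and `y`. -/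
noncomputable def pairDet (z : ℂ) (x y : Fin n → ℂ) : ℂ :=
  detCols (pairCols (B.colP z) (B.colQ z) x y)

theorem detCols_shift_rho (hn : Even n) (h4 : 4 ≤ n) (z : ℂ) (x y : Fin n → ℂ) :
    detCols (Function.update (Function.update
      (fun m => if m < n / 2 then B.colP (rho n * z) m else B.colQ (rho n * z) m)
        (n / 2 - 1) (fun j => (rho n ^ B.d j)⁻¹ * x j)) (n - 1)
          (fun j => (rho n ^ B.d j)⁻¹ * y j))
      = -(rho n ^ (∑ j, B.d j))⁻¹ * B.pairDet z y x := by
  rw [detCols_shift hn h4 (B.colP_rho_mul z) (B.colQ_rho_mul z), Finset.prod_inv_distrib,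
    Finset.prod_pow_eq_pow_sum]
  rfl

theorem hatDelta1k_cols₁ (z : ℂ) :
    B.hatDelta1k (B.cols₁ z) z = B.pairDet z (B.colP z 0) (B.colQ z 0) := by
  unfold hatDelta1k pairDet
  congr 1
  funext m
  unfold pairCols cols₁ truncCols
  by_cases h1 : m = n / 2
  · subst h1; simp
  · by_cases h0 : m = 0
    · subst h0; simp [h1]
    · simp [h1, h0]

theorem hatDeltak1_cols₁ (z : ℂ) :
    B.hatDeltak1 (B.cols₁ z) z = B.pairDet z (B.colQ z (n / 2)) (B.colP z (n / 2)) := by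
  unfold hatDeltak1 pairDet
  congr 1
  funext m
  unfold pairCols cols₁ truncCols
  by_cases h1 : m = n / 2
  · subst h1; simp
  · by_cases h0 : m = 0
    · subst h0; simp [h1]
    · simp [h1, h0]

/-- As ρ^k = -1, the exponential kept in the second sector becomes e^{-iz} after the rotation, the
inverse of the one kept in the first. -/
theorem exp_rho_half (hn : Even n) (h4 : 4 ≤ n) (z : ℂ) :
    Complex.exp (Complex.I * (rho n * z) * rho n ^ (n / 2 - 1)) = Complex.exp (-(Complex.I * z)) := by
  congr 1
  have : rho n * rho n ^ (n / 2 - 1) = -1 := by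
    rw [← pow_succ', show n / 2 - 1 + 1 = n / 2 by omega, rho_pow_half hn (by omega)]
  linear_combination Complex.I * z * this

theorem cols₂_rho (hn : Even n) (h4 : 4 ≤ n) (z : ℂ) : B.cols₂ (rho n * z)
    = Function.update (Function.update
      (fun m => if m < n / 2 then B.colP (rho n * z) m else B.colQ (rho n * z) m)
        (n / 2 - 1) (fun j => (rho n ^ B.d j)⁻¹ * (B.colP z (n / 2)
          + Complex.exp (-(Complex.I * z)) • B.colQ z (n / 2)) j)) (n - 1)
          (fun j => (rho n ^ B.d j)⁻¹ * (Complex.exp (-(Complex.I * z)) • B.colP z 0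
            + B.colQ z 0) j) := by
  unfold cols₂
  rw [exp_rho_half hn h4, truncCols_eq_update h4]
  congr 1
  · congr 1
    rw [colP_rho_mul, colQ_rho_mul, show n / 2 - 1 + 1 = n / 2 by omega]
    funext j
    simp only [Pi.add_apply, Pi.smul_apply, smul_eq_mul]
    ring
  · rw [colP_rho_mul, colQ_rho_mul, show n - 1 + 1 = n by omega, colP_self B (by omega),
      colQ_self B (by omega)]
    funext j
    simp only [Pi.add_apply, Pi.smul_apply, smul_eq_mul]
    ring

/-- With s = e^{-iz} and w = e^{iz}, the special columns after the shift are s p₀ + q₀ = s(p₀ + w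
q₀) and p_k + s q_k = s(w p_k + q_k). These are s times the special columns of the first sector,
whence the factor s². -/
theorem detCols_cols₂_rho (hn : Even n) (h4 : 4 ≤ n) (z : ℂ) :
    detCols (B.cols₂ (rho n * z)) = -(rho n ^ (∑ j, B.d j))⁻¹ *
      (Complex.exp (-(Complex.I * z)) ^ 2 * detCols (B.cols₁ z)) := by
  rw [cols₂_rho B hn h4, detCols_shift_rho B hn h4]
  congr 1
  unfold cols₁ pairDet
  rw [truncCols_eq_pairCols (by omega)]
  have h2 : 2 ≤ n := by omega
  set s := Complex.exp (-(Complex.I * z)) with hs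
  have hsw : s * Complex.exp (Complex.I * z) = 1 := by rw [hs, ← Complex.exp_add]; simp
  have e1 : s • B.colP z 0 + B.colQ z 0 = s • B.colP z 0 + (1 : ℂ) • B.colQ z 0 := by simp
  have e2 : B.colP z (n / 2) + s • B.colQ z (n / 2)
    = (1 : ℂ) • B.colP z (n / 2) + s • B.colQ z (n / 2) := by simp
  rw [e1, e2, detCols_pairCols_bilin h2, detCols_pairCols_bilin h2]
  set w := Complex.exp (Complex.I * z)
  set t1 := detCols (pairCols (B.colP z) (B.colQ z) (B.colP z 0) (B.colP z (n / 2)))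
  set t2 := detCols (pairCols (B.colP z) (B.colQ z) (B.colP z 0) (B.colQ z (n / 2)))
  set t3 := detCols (pairCols (B.colP z) (B.colQ z) (B.colQ z 0) (B.colP z (n / 2)))
  set t4 := detCols (pairCols (B.colP z) (B.colQ z) (B.colQ z 0) (B.colQ z (n / 2)))
  linear_combination (-s * t1 - s * t4 - t3 * (1 + s * w)) * hsw

/-- The shift moves the columns k-1 and n-1 to k and 0, so the replaced pair of the second sector
becomes that of the first. The factor in front is shared with the denominator and cancels in the
quotient. -/
theorem hatDeltakn_rho (hn : Even n) (h4 : 4 ≤ n) (z : ℂ) :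
    B.hatDeltakn (B.cols₂ (rho n * z)) (rho n * z)
      = -(rho n ^ (∑ j, B.d j))⁻¹ * B.hatDeltak1 (B.cols₁ z) z := by
  rw [hatDeltak1_cols₁, ← detCols_shift_rho B hn h4]
  unfold hatDeltakn
  rw [cols₂_rho B hn h4, colP_rho_mul, colQ_rho_mul, show n / 2 - 1 + 1 = n / 2 by omega]
  congr 1
  funext m
  by_cases h1 : m = n - 1
  · subst h1; simp
  · by_cases h0 : m = n / 2 - 1
    · subst h0; simp [h1]
    · simp [h1, h0]

theorem hatDeltank_rho (hn : Even n) (h4 : 4 ≤ n) (z : ℂ) :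
    B.hatDeltank (B.cols₂ (rho n * z)) (rho n * z)
      = -(rho n ^ (∑ j, B.d j))⁻¹ * B.hatDelta1k (B.cols₁ z) z := by
  rw [hatDelta1k_cols₁, ← detCols_shift_rho B hn h4]
  unfold hatDeltank
  rw [cols₂_rho B hn h4, colP_rho_mul, colQ_rho_mul, show n - 1 + 1 = n by omega,
    colP_self B (by omega), colQ_self B (by omega)]
  congr 1
  funext m
  by_cases h1 : m = n - 1
  · subst h1; simp
  · by_cases h0 : m = n / 2 - 1
    · subst h0; simp [h1]
    · simp [h1, h0]

/-- The part of the integrand that does not decay exponentially. -/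
noncomputable def mainTerm (z : ℂ) : ℂ :=
  Complex.exp (Complex.I * z) * (B.pairDet z (B.colP z 0) (B.colQ z 0)
    - B.pairDet z (B.colQ z (n / 2)) (B.colP z (n / 2))) / detCols (B.cols₁ z)

/-- Since ρ^k = -1, the four terms combine into two differences. One is `mainTerm`; the other
carries e^{izρ^{k-1}}, which is exponentially small in the first sector. -/
theorem integrand_cols₁ (hn : Even n) (h4 : 4 ≤ n) (z : ℂ) : B.integrand (B.cols₁ z) z
    = B.mainTerm z + rho n ^ (n / 2 - 1) * Complex.exp (Complex.I * z * rho n ^ (n / 2 - 1)) *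
        ((B.hatDeltakn (B.cols₁ z) z - B.hatDeltank (B.cols₁ z) z) / detCols (B.cols₁ z)) := by
  unfold integrand mainTerm
  rw [hatDelta1k_cols₁, hatDeltak1_cols₁, show n - 1 = n / 2 - 1 + n / 2 by
    obtain ⟨k, rfl⟩ := hn; omega, pow_add, rho_pow_half hn (by omega)]
  ring

/-- The factor ρ is that of d(ρz) = ρ dz. The two differences exchange their roles: the one with
index pair (k, n) yields `mainTerm`, the other becomes negligible. -/
theorem integrand_cols₂_rho (hn : Even n) (h4 : 4 ≤ n) (z : ℂ) :
    B.integrand (B.cols₂ (rho n * z)) (rho n * z) * rho n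
    = B.mainTerm z + rho n * Complex.exp (Complex.I * (rho n * z)) *
        ((B.hatDelta1k (B.cols₂ (rho n * z)) (rho n * z)
          - B.hatDeltak1 (B.cols₂ (rho n * z)) (rho n * z)) / detCols (B.cols₂ (rho n * z))) := by
  have hr : rho n * rho n ^ (n / 2 - 1) = -1 := by
    rw [← pow_succ', show n / 2 - 1 + 1 = n / 2 by omega, rho_pow_half hn (by omega)]
  have key : (Complex.exp (-(Complex.I * z))) * (B.hatDeltakn (B.cols₂ (rho n * z)) (rho n * z)
      - B.hatDeltank (B.cols₂ (rho n * z)) (rho n * z)) / detCols (B.cols₂ (rho n * z))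
      = -B.mainTerm z := by
    rw [hatDeltakn_rho B hn h4, hatDeltank_rho B hn h4, detCols_cols₂_rho B hn h4, mainTerm,
      ← hatDelta1k_cols₁, ← hatDeltak1_cols₁]
    have hk : -(rho n ^ (∑ j, B.d j))⁻¹ ≠ 0 := by
      simp [rho_ne_zero]
    rw [← mul_sub, mul_left_comm, mul_div_mul_left _ _ hk, ← mul_div_mul_left _ (detCols _)
      (pow_ne_zero 2 (Complex.exp_ne_zero (-(Complex.I * z)))), ← neg_div]
    congr 1
    have hsw : Complex.exp (-(Complex.I * z)) * Complex.exp (Complex.I * z) = 1 := by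
      rw [← Complex.exp_add]; simp
    linear_combination (B.hatDelta1k (B.cols₁ z) z - B.hatDeltak1 (B.cols₁ z) z) *
      Complex.exp (-(Complex.I * z)) * hsw
  unfold integrand
  rw [exp_rho_half hn h4, show n - 1 = n / 2 - 1 + n / 2 by
    obtain ⟨k, rfl⟩ := hn; omega, pow_add, rho_pow_half hn (by omega)]
  linear_combination (-1 : ℂ) * key + Complex.exp (-(Complex.I * z)) *
    (B.hatDeltakn (B.cols₂ (rho n * z)) (rho n * z)
      - B.hatDeltank (B.cols₂ (rho n * z)) (rho n * z)) / detCols (B.cols₂ (rho n * z)) * hr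

end BoundaryConditions

/-! ### Limits of the columns and determinants as z → ∞. -/

section Limits

variable {n : ℕ} {X : Type*} {l : Filter X}

theorem tendsto_detCols {c : X → ℕ → Fin n → ℂ} {c₀ : ℕ → Fin n → ℂ}
    (h : ∀ m < n, Tendsto (fun x => c x m) l (𝓝 (c₀ m))) :
    Tendsto (fun x => detCols (c x)) l (𝓝 (detCols c₀)) := by
  unfold detCols
  have hc : Continuous fun M : Matrix (Fin n) (Fin n) ℂ => M.det := continuous_id.matrix_det
  refine (hc.tendsto _).comp ?_
  refine tendsto_pi_nhds.2 fun j => tendsto_pi_nhds.2 fun m => ?_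
  exact (tendsto_pi_nhds.1 (h m m.2)) j

theorem norm_detCols_le {c : ℕ → Fin n → ℂ} {x : ℝ} (h : ∀ m < n, ∀ j, ‖c m j‖ ≤ x) :
    ‖detCols c‖ ≤ n.factorial * x ^ n := by
  have := Matrix.det_le (abv := (IsAbsoluteValue.toAbsoluteValue (norm : ℂ → ℝ)))
    (A := Matrix.of fun (j m : Fin n) => c m j) (x := x) (fun j m => h m m.2 j)
  simpa [detCols] using this

theorem tendsto_pairCols {p q : X → ℕ → Fin n → ℂ} {x y : X → Fin n → ℂ}
    {p₀ q₀ : ℕ → Fin n → ℂ} {x₀ y₀ : Fin n → ℂ}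
    (hp : ∀ m < n, Tendsto (fun t => p t m) l (𝓝 (p₀ m)))
    (hq : ∀ m < n, Tendsto (fun t => q t m) l (𝓝 (q₀ m)))
    (hx : Tendsto x l (𝓝 x₀)) (hy : Tendsto y l (𝓝 y₀)) {m : ℕ} (hm : m < n) :
    Tendsto (fun t => pairCols (p t) (q t) (x t) (y t) m) l (𝓝 (pairCols p₀ q₀ x₀ y₀ m)) := by
  unfold pairCols
  by_cases h1 : m = n / 2
  · subst h1; simpa using hy
  · by_cases h0 : m = 0
    · subst h0; simpa [h1] using hx
    · by_cases h2 : m < n / 2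
      · simpa [h1, h0, h2] using hp m hm
      · simpa [h1, h0, h2] using hq m hm

/-- If the columns converge to those of leading coefficients, then the truncated characteristic
determinant is approximated by the Birkhoff polynomial, uniformly in the second variable. -/
theorem eventually_norm_detCols_truncCols_sub_le (hn : 2 ≤ n) {d : Fin n → ℕ} {a b : Fin n → ℂ}
    {p q : X → ℕ → Fin n → ℂ}
    (hp : ∀ m < n, Tendsto (fun t => p t m) l (𝓝 (leadCol d a m)))
    (hq : ∀ m < n, Tendsto (fun t => q t m) l (𝓝 (leadCol d b m))) {ε : ℝ} (hε : 0 < ε) :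
    ∀ᶠ t in l, ∀ w : ℂ, ‖detCols (truncCols (p t) (q t) w 0 (n / 2))
      - (birkhoffPoly d a b).eval w‖ ≤ ε * (1 + ‖w‖) ^ 2 := by
  have h0 : 0 < n := by omega
  have hk : n / 2 < n := Nat.div_lt_self (by omega) (by omega)
  have key : ∀ {x y : X → Fin n → ℂ} {x₀ y₀ : Fin n → ℂ}, Tendsto x l (𝓝 x₀) →
      Tendsto y l (𝓝 y₀) → Tendsto (fun t => detCols (pairCols (p t) (q t) (x t) (y t))
        - detCols (pairCols (leadCol d a) (leadCol d b) x₀ y₀)) l (𝓝 0) := by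
    intro x y x₀ y₀ hx hy
    have := tendsto_detCols (fun m hm => tendsto_pairCols hp hq hx hy hm)
    simpa using this.sub_const (detCols (pairCols (leadCol d a) (leadCol d b) x₀ y₀))
  -- Four errors of size ε/2 with weights 1, |w|, |w|, |w|² add up to ε(1 + |w|)²/2.
  have t1 := (key (hp 0 h0) (hq _ hk)).norm.eventually_le_const (u := ε / 2) (by simpa using hε)
  have t2 := (key (hp 0 h0) (hp _ hk)).norm.eventually_le_const (u := ε / 2) (by simpa using hε)
  have t3 := (key (hq 0 h0) (hq _ hk)).norm.eventually_le_const (u := ε / 2) (by simpa using hε)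
  have t4 := (key (hq 0 h0) (hp _ hk)).norm.eventually_le_const (u := ε / 2) (by simpa using hε)
  filter_upwards [t1, t2, t3, t4] with t h1 h2 h3 h4 w
  rw [birkhoffPoly_eval, detCols_truncCols hn, detCols_truncCols hn]
  set T1 := detCols (pairCols (p t) (q t) (p t 0) (q t (n / 2)))
  set T2 := detCols (pairCols (p t) (q t) (p t 0) (p t (n / 2)))
  set T3 := detCols (pairCols (p t) (q t) (q t 0) (q t (n / 2)))
  set T4 := detCols (pairCols (p t) (q t) (q t 0) (p t (n / 2)))
  set S1 := detCols (pairCols (leadCol d a) (leadCol d b) (leadCol d a 0) (leadCol d b (n / 2)))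
  set S2 := detCols (pairCols (leadCol d a) (leadCol d b) (leadCol d a 0) (leadCol d a (n / 2)))
  set S3 := detCols (pairCols (leadCol d a) (leadCol d b) (leadCol d b 0) (leadCol d b (n / 2)))
  set S4 := detCols (pairCols (leadCol d a) (leadCol d b) (leadCol d b 0) (leadCol d a (n / 2)))
  have e : T1 + w * (T2 + T3) + w ^ 2 * T4 - (S1 + w * (S2 + S3) + w ^ 2 * S4)
    = (T1 - S1) + w * (T2 - S2) + w * (T3 - S3) + w ^ 2 * (T4 - S4) := by ring
  rw [e]
  calc _ ≤ ‖T1 - S1‖ + ‖w‖ * ‖T2 - S2‖ + ‖w‖ * ‖T3 - S3‖ + ‖w‖ ^ 2 * ‖T4 - S4‖ := by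
        refine (norm_add_le _ _).trans (add_le_add ((norm_add_le _ _).trans
          (add_le_add ((norm_add_le _ _).trans (add_le_add le_rfl ?_)) ?_)) ?_)
        all_goals simp
    _ ≤ ε / 2 + ‖w‖ * (ε / 2) + ‖w‖ * (ε / 2) + ‖w‖ ^ 2 * (ε / 2) := by gcongr
    _ ≤ ε * (1 + ‖w‖) ^ 2 := by
        have h5 := mul_nonneg hε.le (norm_nonneg w)
        have h6 := mul_nonneg hε.le (sq_nonneg ‖w‖)
        linarith

theorem tendsto_eval_div (P : ℂ[X]) {d : ℕ} (hd : P.natDegree ≤ d) (c : ℂ) :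
    Tendsto (fun z : ℂ => P.eval (Complex.I * z * c) / (Complex.I * z) ^ d)
      (Bornology.cobounded ℂ) (𝓝 (c ^ d * P.coeff d)) := by
  have h1 : ∀ i ∈ Finset.range (d + 1), Tendsto (fun z : ℂ =>
      P.coeff i * (Complex.I * z * c) ^ i / (Complex.I * z) ^ d) (Bornology.cobounded ℂ)
      (𝓝 (if i = d then c ^ d * P.coeff d else 0)) := by
    intro i hi
    have hi' : i ≤ d := by simpa [Nat.lt_succ_iff] using hi
    split_ifs with h
    · subst h
      refine tendsto_const_nhds.congr' ?_
      filter_upwards [Bornology.eventually_ne_cobounded (0 : ℂ)] with z hz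
      rw [mul_pow]
      have : (Complex.I * z) ^ i ≠ 0 := pow_ne_zero _ (mul_ne_zero Complex.I_ne_zero hz)
      field_simp
    · obtain ⟨e, rfl⟩ := Nat.exists_eq_add_of_lt (lt_of_le_of_ne hi' h)
      have h2 : Tendsto (fun z : ℂ => P.coeff i * c ^ i * ((Complex.I)⁻¹ * z⁻¹) ^ (e + 1))
          (Bornology.cobounded ℂ) (𝓝 (P.coeff i * c ^ i * ((Complex.I)⁻¹ * 0) ^ (e + 1))) :=
        ((tendsto_inv₀_cobounded.const_mul _).pow _).const_mul _
      simp only [mul_zero, ne_eq, Nat.add_eq_zero_iff, one_ne_zero, and_false, not_false_eq_true,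
        zero_pow] at h2
      refine h2.congr' ?_
      filter_upwards [Bornology.eventually_ne_cobounded (0 : ℂ)] with z hz
      have hIz : Complex.I * z ≠ 0 := mul_ne_zero Complex.I_ne_zero hz
      rw [mul_pow _ c, add_assoc, pow_add _ i (e + 1), ← mul_inv, inv_pow]
      field_simp
  have h3 := tendsto_finsetSum _ h1
  rw [Finset.sum_ite_eq' (Finset.range (d + 1)) d] at h3
  simp only [Finset.mem_range, Nat.lt_succ_self, if_true] at h3
  refine h3.congr fun z => ?_
  rw [Polynomial.eval_eq_sum_range' (Nat.lt_succ_of_le hd), Finset.sum_div]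

end Limits

namespace BoundaryConditions

variable {n : ℕ} (B : BoundaryConditions n)

theorem tendsto_colP (m : ℕ) :
    Tendsto (fun z => B.colP z m) (Bornology.cobounded ℂ) (𝓝 (leadCol B.d B.a m)) := by
  refine tendsto_pi_nhds.2 fun j => ?_
  have := tendsto_eval_div (B.P j) (le_max_left _ _ : _ ≤ B.d j) (rho n ^ m)
  rw [← pow_mul] at this
  exact this

theorem tendsto_colQ (m : ℕ) :
    Tendsto (fun z => B.colQ z m) (Bornology.cobounded ℂ) (𝓝 (leadCol B.d B.b m)) := by
  refine tendsto_pi_nhds.2 fun j => ?_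
  have := tendsto_eval_div (B.Q j) (le_max_right _ _ : _ ≤ B.d j) (rho n ^ m)
  rw [← pow_mul] at this
  exact this

theorem tendsto_pairDet_1k (hn : 2 ≤ n) :
    Tendsto (fun z => B.pairDet z (B.colP z 0) (B.colQ z 0)) (Bornology.cobounded ℂ)
      (𝓝 (frakM1k B.d B.a B.b)) := by
  rw [frakM1k_eq _ _ _ hn]
  exact tendsto_detCols fun m hm => tendsto_pairCols (fun m _ => B.tendsto_colP m)
    (fun m _ => B.tendsto_colQ m) (B.tendsto_colP 0) (B.tendsto_colQ 0) hm

theorem tendsto_pairDet_k1 :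
    Tendsto (fun z => B.pairDet z (B.colQ z (n / 2)) (B.colP z (n / 2))) (Bornology.cobounded ℂ)
      (𝓝 (frakMk1 B.d B.a B.b)) := by
  rw [frakMk1_eq]
  exact tendsto_detCols fun m hm => tendsto_pairCols (fun m _ => B.tendsto_colP m)
    (fun m _ => B.tendsto_colQ m) (B.tendsto_colQ _) (B.tendsto_colP _) hm

theorem exists_norm_col_le : ∃ C : ℝ, 0 < C ∧ ∀ᶠ z in Bornology.cobounded ℂ, ∀ m < n, ∀ j,
    ‖B.colP z m j‖ ≤ C ∧ ‖B.colQ z m j‖ ≤ C := by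
  have h : ∀ (f : ℂ → ℂ) (y : ℂ), Tendsto f (Bornology.cobounded ℂ) (𝓝 y) →
      ∀ᶠ z in Bornology.cobounded ℂ, ‖f z‖ ≤ ‖y‖ + 1 := fun f y hf =>
    hf.norm.eventually_le_const (by linarith)
  have hP : ∀ m : Fin n, ∀ j, ∀ᶠ z in Bornology.cobounded ℂ,
      ‖B.colP z m j‖ ≤ ‖leadCol B.d B.a m j‖ + 1 := fun m j =>
    h _ _ (tendsto_pi_nhds.1 (B.tendsto_colP m) j)
  have hQ : ∀ m : Fin n, ∀ j, ∀ᶠ z in Bornology.cobounded ℂ,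
      ‖B.colQ z m j‖ ≤ ‖leadCol B.d B.b m j‖ + 1 := fun m j =>
    h _ _ (tendsto_pi_nhds.1 (B.tendsto_colQ m) j)
  refine ⟨1 + ∑ m : Fin n, ∑ j : Fin n, (‖leadCol B.d B.a m j‖ + ‖leadCol B.d B.b m j‖),
    by positivity, ?_⟩
  have hP' := eventually_all.2 fun m => eventually_all.2 (hP m)
  have hQ' := eventually_all.2 fun m => eventually_all.2 (hQ m)
  filter_upwards [hP', hQ'] with z h1 h2 m hm j
  have hs : ‖leadCol B.d B.a m j‖ + ‖leadCol B.d B.b m j‖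
      ≤ ∑ m : Fin n, ∑ j : Fin n, (‖leadCol B.d B.a m j‖ + ‖leadCol B.d B.b m j‖) := by
    refine le_trans ?_ (Finset.single_le_sum (f := fun m : Fin n => ∑ j : Fin n,
      (‖leadCol B.d B.a m j‖ + ‖leadCol B.d B.b m j‖)) (fun _ _ => by positivity)
      (Finset.mem_univ ⟨m, hm⟩))
    exact Finset.single_le_sum (f := fun j : Fin n =>
      (‖leadCol B.d B.a m j‖ + ‖leadCol B.d B.b m j‖)) (fun _ _ => by positivity)
      (Finset.mem_univ j)
  have := h1 ⟨m, hm⟩ j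
  have := h2 ⟨m, hm⟩ j
  have := norm_nonneg (leadCol B.d B.a m j)
  have := norm_nonneg (leadCol B.d B.b m j)
  constructor <;> linarith

end BoundaryConditions

/-! ### Lower bounds for e^{iz} - e^{iω} away from the lattice. -/

section Lattice

/-- The point `ω + 2 π j`; these are the solutions of `e^{iz} = e^{iω}`. -/
noncomputable def latticePt (ω : ℂ) (j : ℤ) : ℂ := ω + 2 * Real.pi * j

/-- The point `z` has distance at least `δ` from `ω + 2 π ℤ`. -/
def Away (ω : ℂ) (δ : ℝ) (z : ℂ) : Prop := ∀ j : ℤ, δ ≤ ‖z - latticePt ω j‖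

theorem exp_latticePt (ω : ℂ) (j : ℤ) :
    Complex.exp (Complex.I * latticePt ω j) = Complex.exp (Complex.I * ω) := by
  rw [Complex.exp_eq_exp_iff_exists_int]
  exact ⟨j, by unfold latticePt; ring⟩

theorem latticePt_re (ω : ℂ) (j : ℤ) : (latticePt ω j).re = ω.re + 2 * Real.pi * j := by
  simp [latticePt]

theorem latticePt_im (ω : ℂ) (j : ℤ) : (latticePt ω j).im = ω.im := by
  simp [latticePt]

/-- If the bound fails, e^u is close to 1, so its principal logarithm is small; but this logarithm
differs from u by a period, which contradicts the distance condition. -/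
theorem exists_mul_le_norm_exp_sub_one {δ : ℝ} (hδ : 0 < δ) : ∃ c > 0, ∀ u : ℂ,
    (∀ j : ℤ, δ ≤ ‖u - 2 * Real.pi * Complex.I * j‖) →
      c * (1 + ‖Complex.exp u‖) ≤ ‖Complex.exp u - 1‖ := by
  -- For c ≤ 1/8 the negation gives |e^u - 1| < 3c < 1/2, as the logarithm estimate requires; then
  -- |log e^u| ≤ 9c/2 < δ because c ≤ δ/8.
  refine ⟨min (1 / 8) (δ / 8), by positivity, fun u hu => ?_⟩
  by_contra! hlt
  set c := min (1 / 8 : ℝ) (δ / 8)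
  have hc1 : c ≤ 1 / 8 := min_le_left _ _
  have hc2 : c ≤ δ / 8 := min_le_right _ _
  have hc0 : 0 < c := by positivity
  set E := Complex.exp u
  have h1 : ‖E‖ ≤ 1 + ‖E - 1‖ := by
    calc ‖E‖ = ‖1 + (E - 1)‖ := by ring_nf
      _ ≤ 1 + ‖E - 1‖ := (norm_add_le _ _).trans (by simp)
  have h2 : ‖E - 1‖ < 3 * c := by nlinarith [norm_nonneg (E - 1)]
  have h3 := Complex.norm_log_one_add_half_le_self (z := E - 1) (by linarith)
  rw [add_sub_cancel] at h3
  have h4 : Complex.exp (Complex.log E) = Complex.exp u := Complex.exp_log (Complex.exp_ne_zero u)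
  obtain ⟨j, hj⟩ := Complex.exp_eq_exp_iff_exists_int.1 h4
  have h5 := hu (-j)
  have h6 : u - 2 * Real.pi * Complex.I * ((-j : ℤ) : ℂ) = Complex.log E := by
    rw [hj]; push_cast; ring
  rw [h6] at h5
  linarith

/-- The weight 1 + |e^{iz}| keeps the bound sharp in both half-planes. The product of two such
bounds controls the Birkhoff polynomial from below by (1 + |w|)². -/
theorem exists_mul_le_norm_exp_sub {δ : ℝ} (hδ : 0 < δ) (ω : ℂ) : ∃ c > 0, ∀ z : ℂ, Away ω δ z →
    c * (1 + ‖Complex.exp (Complex.I * z)‖)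
      ≤ ‖Complex.exp (Complex.I * z) - Complex.exp (Complex.I * ω)‖ := by
  obtain ⟨c, hc, h⟩ := exists_mul_le_norm_exp_sub_one hδ
  set X := Complex.exp (Complex.I * ω) with hX
  have hX0 : 0 < ‖X‖ := norm_pos_iff.2 (Complex.exp_ne_zero _)
  refine ⟨c * min 1 ‖X‖, by positivity, fun z hz => ?_⟩
  have h1 := h (Complex.I * (z - ω)) fun j => by
    have : Complex.I * (z - ω) - 2 * Real.pi * Complex.I * j
        = Complex.I * (z - latticePt ω j) := by unfold latticePt; ring
    rw [this, norm_mul, Complex.norm_I, one_mul]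
    exact hz j
  have h2 : Complex.exp (Complex.I * z) = Complex.exp (Complex.I * (z - ω)) * X := by
    rw [hX, ← Complex.exp_add]; ring_nf
  set E := Complex.exp (Complex.I * (z - ω))
  rw [h2, show E * X - X = (E - 1) * X by ring, norm_mul, norm_mul]
  have h3 : c * min 1 ‖X‖ * (1 + ‖E‖ * ‖X‖) ≤ c * (1 + ‖E‖) * ‖X‖ := by
    have h4 : min 1 ‖X‖ ≤ 1 := min_le_left _ _
    have h5 : min 1 ‖X‖ ≤ ‖X‖ := min_le_right _ _
    have h6 : min 1 ‖X‖ * (‖E‖ * ‖X‖) ≤ 1 * (‖E‖ * ‖X‖) := by gcongr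
    nlinarith
  exact h3.trans (by gcongr)

theorem exp_ne_of_away {ω : ℂ} {δ : ℝ} (hδ : 0 < δ) {z : ℂ} (h : Away ω δ z) :
    Complex.exp (Complex.I * z) ≠ Complex.exp (Complex.I * ω) := by
  obtain ⟨c, hc, hc'⟩ := exists_mul_le_norm_exp_sub hδ ω
  intro heq
  have := hc' z h
  rw [heq, sub_self, norm_zero] at this
  have : 0 < c * (1 + ‖Complex.exp (Complex.I * ω)‖) := by positivity
  linarith

end Lattice

/-! ### Pointwise estimates for the integrand. -/

theorem norm_update_le {n : ℕ} {c : ℕ → Fin n → ℂ} {v : Fin n → ℂ} {x : ℝ} (i : ℕ)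
    (hc : ∀ m < n, ∀ j, ‖c m j‖ ≤ x) (hv : ∀ j, ‖v j‖ ≤ x) :
    ∀ m < n, ∀ j, ‖Function.update c i v m j‖ ≤ x := by
  intro m hm j
  by_cases h : m = i
  · subst h; simpa using hv j
  · simpa [h] using hc m hm j

theorem norm_truncCols_le {n : ℕ} {p q : ℕ → Fin n → ℂ} {C : ℝ}
    (h : ∀ m < n, ∀ j, ‖p m j‖ ≤ C ∧ ‖q m j‖ ≤ C) {s : ℂ} (hs : ‖s‖ ≤ 1) (i₁ i₂ : ℕ) :
    ∀ m < n, ∀ j, ‖truncCols p q s i₁ i₂ m j‖ ≤ 2 * C := by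
  intro m hm j
  obtain ⟨h1, h2⟩ := h m hm j
  have h3 : ∀ x : ℂ, ‖s * x‖ ≤ ‖x‖ := fun x => by
    rw [norm_mul]; exact mul_le_of_le_one_left (norm_nonneg _) hs
  have := norm_nonneg (p m j)
  unfold truncCols
  split_ifs
  · refine (norm_add_le _ _).trans ?_
    have := h3 (q m j)
    simp only [Pi.smul_apply, smul_eq_mul]
    linarith
  · refine (norm_add_le _ _).trans ?_
    have := h3 (p m j)
    simp only [Pi.smul_apply, smul_eq_mul]
    linarith
  · linarith
  · linarith

/-- The function x/(1 + x)² is invariant under x ↦ 1/x and at most min(x, 1/x), so there is decay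
both above and below the real axis. This supplies the integrable majorant along the contours. -/
theorem norm_div_one_add_sq_le_exp (z : ℂ) : ‖Complex.exp (Complex.I * z)‖ /
    (1 + ‖Complex.exp (Complex.I * z)‖) ^ 2 ≤ Real.exp (-|z.im|) := by
  have h : ‖Complex.exp (Complex.I * z)‖ = Real.exp (-z.im) := by
    rw [Complex.norm_exp]; simp
  rw [h, div_le_iff₀ (by positivity)]
  have h1 := Real.exp_pos (-z.im)
  have h2 := Real.exp_pos (-|z.im|)
  rcases abs_cases z.im with ⟨h3, _⟩ | ⟨h3, _⟩
  · rw [h3]; nlinarith [mul_pos h1 h1, mul_pos h1 (mul_pos h1 h1)]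
  · rw [h3, neg_neg]
    have h4 : Real.exp z.im * Real.exp (-z.im) = 1 := by rw [← Real.exp_add]; simp
    have h5 := Real.exp_pos z.im
    have : Real.exp z.im * (1 + Real.exp (-z.im)) ^ 2 = Real.exp z.im
      + 2 * (Real.exp z.im * Real.exp (-z.im))
        + (Real.exp z.im * Real.exp (-z.im)) * Real.exp (-z.im) := by ring
    rw [this, h4]
    linarith

namespace BoundaryConditions

variable {n : ℕ} (B : BoundaryConditions n)

/-- The Birkhoff polynomial is quadratic with the roots `e^{iω 0}` and `e^{iω 1}`. -/
def HasRootLogs (ω : Fin 2 → ℂ) : Prop :=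
  B.birkhoff.coeff 2 ≠ 0 ∧ ∀ w, B.birkhoff.eval w = B.birkhoff.coeff 2 *
    ((w - Complex.exp (Complex.I * ω 0)) * (w - Complex.exp (Complex.I * ω 1)))

variable {B} {ω : Fin 2 → ℂ}

theorem HasRootLogs.exists_mul_le_norm_birkhoff (hω : B.HasRootLogs ω) {δ : ℝ} (hδ : 0 < δ) :
    ∃ c > 0, ∀ z, (∀ a, Away (ω a) δ z) → c * (1 + ‖Complex.exp (Complex.I * z)‖) ^ 2
      ≤ ‖B.birkhoff.eval (Complex.exp (Complex.I * z))‖ := by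
  obtain ⟨c₀, hc₀, h₀⟩ := exists_mul_le_norm_exp_sub hδ (ω 0)
  obtain ⟨c₁, hc₁, h₁⟩ := exists_mul_le_norm_exp_sub hδ (ω 1)
  have h2 := norm_pos_iff.2 hω.1
  refine ⟨‖B.birkhoff.coeff 2‖ * (c₀ * c₁), by positivity, fun z hz => ?_⟩
  rw [hω.2, norm_mul, norm_mul, mul_assoc]
  refine mul_le_mul_of_nonneg_left ?_ (norm_nonneg _)
  have := mul_le_mul (h₀ z (hz 0)) (h₁ z (hz 1)) (by positivity) (norm_nonneg _)
  linarith

theorem HasRootLogs.exists_mul_le_norm_detCols (hω : B.HasRootLogs ω) (hn : 2 ≤ n) {δ : ℝ}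
    (hδ : 0 < δ) :
    ∃ c > 0, ∀ᶠ z in Bornology.cobounded ℂ, (∀ a, Away (ω a) δ z) →
      c * (1 + ‖Complex.exp (Complex.I * z)‖) ^ 2 ≤ ‖detCols (B.cols₁ z)‖ := by
  obtain ⟨c, hc, h⟩ := hω.exists_mul_le_norm_birkhoff hδ
  refine ⟨c / 2, by positivity, ?_⟩
  filter_upwards [eventually_norm_detCols_truncCols_sub_le hn (fun m _ => B.tendsto_colP m)
    (fun m _ => B.tendsto_colQ m) (half_pos hc)] with z h1 hz
  have h2 := h1 (Complex.exp (Complex.I * z))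
  have h3 := h z hz
  have h4 := norm_sub_norm_le (B.birkhoff.eval (Complex.exp (Complex.I * z)))
    (detCols (B.cols₁ z))
  rw [norm_sub_rev] at h2
  unfold birkhoff cols₁ at *
  linarith

variable (B) in
/-- The limit of the integrand, expressed through `w = e^{iz}`. -/
noncomputable def limitTerm (z : ℂ) : ℂ :=
  Complex.exp (Complex.I * z) * (frakM1k B.d B.a B.b - frakMk1 B.d B.a B.b)
    / B.birkhoff.eval (Complex.exp (Complex.I * z))

/-- Numerator and denominator converge separately, the latter relative to (1 + |w|)², while both
denominators are at least a constant times (1 + |w|)². What remains is a small multiple of |w|/(1 +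
|w|)². -/
theorem HasRootLogs.eventually_norm_mainTerm_sub_le (hω : B.HasRootLogs ω) (hn : 2 ≤ n) {δ : ℝ}
    (hδ : 0 < δ) {ε : ℝ} (hε : 0 < ε) :
    ∀ᶠ z in Bornology.cobounded ℂ, (∀ a, Away (ω a) δ z) →
      ‖B.mainTerm z - B.limitTerm z‖ ≤ ε * Real.exp (-|z.im|) := by
  obtain ⟨c, hc, h⟩ := hω.exists_mul_le_norm_birkhoff hδ
  obtain ⟨c', hc', h'⟩ := hω.exists_mul_le_norm_detCols hn hδ
  set γ := frakM1k B.d B.a B.b - frakMk1 B.d B.a B.b with hγ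
  have hlim : Tendsto (fun z => B.pairDet z (B.colP z 0) (B.colQ z 0)
      - B.pairDet z (B.colQ z (n / 2)) (B.colP z (n / 2)) - γ) (Bornology.cobounded ℂ) (𝓝 0) := by
    simpa only [hγ, sub_self] using
      ((B.tendsto_pairDet_1k hn).sub B.tendsto_pairDet_k1).sub_const γ
  have t1 := hlim.norm.eventually_le_const (u := ε * c' / 2) (by simp; positivity)
  filter_upwards [t1, h', eventually_norm_detCols_truncCols_sub_le hn
    (fun m _ => B.tendsto_colP m) (fun m _ => B.tendsto_colQ m)
    (show 0 < ε * (c * c') / (2 * (‖γ‖ + 1)) by positivity)] with z h1 h2 h3 hz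
  replace h2 := h2 hz
  replace h3 := h3 (Complex.exp (Complex.I * z))
  have h4 := h z hz
  unfold mainTerm limitTerm
  rw [← hγ]
  refine le_trans ?_ (mul_le_mul_of_nonneg_left (norm_div_one_add_sq_le_exp z) hε.le)
  change ‖detCols (B.cols₁ z) - B.birkhoff.eval _‖ ≤ _ at h3
  set w := Complex.exp (Complex.I * z)
  set G := B.pairDet z (B.colP z 0) (B.colQ z 0)
    - B.pairDet z (B.colQ z (n / 2)) (B.colP z (n / 2))
  set D := detCols (B.cols₁ z)
  set p := B.birkhoff.eval w
  set T := (1 + ‖w‖) ^ 2 with hT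
  have hT0 : 0 < T := by positivity
  have hD : D ≠ 0 := norm_pos_iff.1 (lt_of_lt_of_le (by positivity) h2)
  have hp : p ≠ 0 := norm_pos_iff.1 (lt_of_lt_of_le (by positivity) h4)
  -- Separates the error of the numerator from that of the denominator. The tolerances in `t1` and
  -- `h3` are chosen so that each contributes at most ε/(2T).
  have e : w * G / D - w * γ / p = w * ((G - γ) / D - γ * (D - p) / (D * p)) := by
    field_simp
    ring
  rw [e, norm_mul, show ε * (‖w‖ / T) = ‖w‖ * (ε / T) by ring]
  refine mul_le_mul_of_nonneg_left ?_ (norm_nonneg _)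
  have a1 : ‖(G - γ) / D‖ ≤ (ε * c' / 2) / (c' * T) := by
    rw [norm_div]; gcongr
  have a2 : ‖γ * (D - p) / (D * p)‖ ≤
      (‖γ‖ + 1) * (ε * (c * c') / (2 * (‖γ‖ + 1)) * T) / ((c' * T) * (c * T)) := by
    rw [norm_div, norm_mul, norm_mul]
    gcongr
    linarith
  have b1 : (ε * c' / 2) / (c' * T) = ε / T / 2 := by field_simp
  have b2 : (‖γ‖ + 1) * (ε * (c * c') / (2 * (‖γ‖ + 1)) * T) / ((c' * T) * (c * T))
      = ε / T / 2 := by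
    have : ‖γ‖ + 1 ≠ 0 := by positivity
    field_simp
  calc _ ≤ ‖(G - γ) / D‖ + ‖γ * (D - p) / (D * p)‖ := norm_sub_le _ _
    _ ≤ _ := by rw [b1] at a1; rw [b2] at a2; linarith

/-- Bounds for the quotients of determinants whose factors decay exponentially, first sector. -/
theorem HasRootLogs.exists_norm_quotient₁_le (hω : B.HasRootLogs ω) (hn : 4 ≤ n) {δ : ℝ}
    (hδ : 0 < δ) :
    ∃ K > 0, ∀ᶠ z in Bornology.cobounded ℂ, (∀ a, Away (ω a) δ z) → 0 ≤ z.im →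
      ‖(B.hatDeltakn (B.cols₁ z) z - B.hatDeltank (B.cols₁ z) z) / detCols (B.cols₁ z)‖ ≤ K := by
  obtain ⟨c', hc', h'⟩ := hω.exists_mul_le_norm_detCols (by omega) hδ
  obtain ⟨C, hC, hcol⟩ := B.exists_norm_col_le
  refine ⟨(n.factorial * (2 * C) ^ n + n.factorial * (2 * C) ^ n) / c', by positivity, ?_⟩
  filter_upwards [h', hcol] with z h1 h2 hz him
  have hw : ‖Complex.exp (Complex.I * z)‖ ≤ 1 := by
    rw [Complex.norm_exp]; simpa using him
  have h3 := h1 hz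
  have h4 : c' ≤ ‖detCols (B.cols₁ z)‖ := le_trans (by
    nlinarith [norm_nonneg (Complex.exp (Complex.I * z)),
      mul_nonneg hc'.le (sq_nonneg ‖Complex.exp (Complex.I * z)‖),
      mul_nonneg hc'.le (norm_nonneg (Complex.exp (Complex.I * z)))]) h3
  have h5 : ∀ m < n, ∀ j, ‖B.colP z m j‖ ≤ 2 * C ∧ ‖B.colQ z m j‖ ≤ 2 * C := fun m hm j =>
    ⟨by linarith [(h2 m hm j).1], by linarith [(h2 m hm j).2]⟩
  rw [norm_div]
  gcongr
  refine (norm_sub_le _ _).trans (add_le_add (norm_detCols_le ?_) (norm_detCols_le ?_))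
  · exact norm_update_le _ (norm_update_le _ (norm_truncCols_le h2 hw _ _)
      fun j => (h5 _ (by omega) j).1) fun j => (h5 _ (by omega) j).2
  · exact norm_update_le _ (norm_update_le _ (norm_truncCols_le h2 hw _ _)
      fun j => (h5 _ (by omega) j).2) fun j => (h5 _ (by omega) j).1

/-- Bounds for the quotients of determinants whose factors decay exponentially, second sector. -/
theorem HasRootLogs.exists_norm_quotient₂_le (hω : B.HasRootLogs ω) (he : Even n) (hn : 4 ≤ n)
    {δ : ℝ} (hδ : 0 < δ) :
    ∃ K > 0, ∀ᶠ z in Bornology.cobounded ℂ, (∀ a, Away (ω a) δ z) → z.im ≤ 0 →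
      ‖(B.hatDelta1k (B.cols₂ (rho n * z)) (rho n * z)
          - B.hatDeltak1 (B.cols₂ (rho n * z)) (rho n * z))
            / detCols (B.cols₂ (rho n * z))‖ ≤ K := by
  obtain ⟨c', hc', h'⟩ := hω.exists_mul_le_norm_detCols (by omega) hδ
  obtain ⟨C, hC, hcol⟩ := B.exists_norm_col_le
  refine ⟨(n.factorial * (2 * C) ^ n + n.factorial * (2 * C) ^ n) / c', by positivity, ?_⟩
  have hr : Tendsto (fun z => rho n * z) (Bornology.cobounded ℂ) (Bornology.cobounded ℂ) :=
    Filter.tendsto_mul_left_cobounded rho_ne_zero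
  filter_upwards [h', hr.eventually hcol] with z h1 h2 hz him
  have hs : ‖Complex.exp (-(Complex.I * z))‖ ≤ 1 := by
    rw [Complex.norm_exp]; simpa using him
  have hs' : ‖Complex.exp (Complex.I * (rho n * z) * rho n ^ (n / 2 - 1))‖ ≤ 1 := by
    rwa [exp_rho_half he hn]
  have hrho : ‖rho n‖ = 1 := by
    have := (isPrimitiveRoot_rho (by omega : n ≠ 0)).norm'_eq_one (by omega)
    exact this
  have h3 := h1 hz
  have h4 : c' ≤ ‖detCols (B.cols₂ (rho n * z))‖ := by
    rw [detCols_cols₂_rho B he hn]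
    simp only [norm_mul, norm_neg, norm_inv, norm_pow, hrho, one_pow, inv_one, one_mul]
    have hsw : ‖Complex.exp (-(Complex.I * z))‖ * ‖Complex.exp (Complex.I * z)‖ = 1 := by
      rw [← norm_mul, ← Complex.exp_add]; simp
    set s := ‖Complex.exp (-(Complex.I * z))‖
    set w := ‖Complex.exp (Complex.I * z)‖
    have hs0 : 0 ≤ s := norm_nonneg _
    have hs1 := mul_nonneg hc'.le hs0
    have hs2 := mul_nonneg hc'.le (sq_nonneg s)
    -- The factor s² of the rotation absorbs the growth of (1 + |w|)² in the lower half-plane, since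
    -- s|w| = 1 turns s(1 + |w|) into 1 + s.
    calc c' ≤ c' * (1 + s) ^ 2 := by linarith
      _ = s ^ 2 * (c' * (1 + w) ^ 2) := by
          have : s * (1 + w) = 1 + s := by linear_combination hsw
          rw [← this]; ring
      _ ≤ _ := by gcongr
  have h5 : ∀ m < n, ∀ j, ‖B.colP (rho n * z) m j‖ ≤ 2 * C ∧ ‖B.colQ (rho n * z) m j‖ ≤ 2 * C :=
    fun m hm j => ⟨by linarith [(h2 m hm j).1], by linarith [(h2 m hm j).2]⟩
  rw [norm_div]
  gcongr
  refine (norm_sub_le _ _).trans (add_le_add (norm_detCols_le ?_) (norm_detCols_le ?_))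
  · exact norm_update_le _ (norm_update_le _ (norm_truncCols_le h2 hs' _ _)
      fun j => (h5 _ (by omega) j).1) fun j => (h5 _ (by omega) j).2
  · exact norm_update_le _ (norm_update_le _ (norm_truncCols_le h2 hs' _ _)
      fun j => (h5 _ (by omega) j).2) fun j => (h5 _ (by omega) j).1

end BoundaryConditions

/-! ### Eigenvalues as zeros of the characteristic determinant. -/

/-- The characteristic exponents `i z ρ^m`. -/
noncomputable def charExp (n : ℕ) (z : ℂ) (m : ℕ) : ℂ := Complex.I * z * rho n ^ m

theorem charExp_injective {n : ℕ} (hn : n ≠ 0) {z : ℂ} (hz : z ≠ 0) :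
    Function.Injective fun m : Fin n => charExp n z m := by
  intro m m' h
  have h1 : Complex.I * z ≠ 0 := mul_ne_zero Complex.I_ne_zero hz
  have h2 := mul_left_cancel₀ h1 h
  exact Fin.ext ((isPrimitiveRoot_rho hn).pow_inj m.2 m'.2 h2)

theorem charExp_pow_self {n : ℕ} (hn : n ≠ 0) (z : ℂ) (m : ℕ) :
    charExp n z m ^ n = (Complex.I * z) ^ n := by
  unfold charExp
  rw [mul_pow, ← pow_mul, mul_comm m, pow_mul, rho_pow_self hn, one_pow, mul_one]

theorem iteratedDeriv_sum_exp {n : ℕ} (c κ : Fin n → ℂ) (i : ℕ) :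
    iteratedDeriv i (fun x : ℝ => ∑ m, c m * Complex.exp (κ m * x))
      = fun x : ℝ => ∑ m, c m * κ m ^ i * Complex.exp (κ m * x) := by
  induction i with
  | zero => simp
  | succ i ih =>
    rw [iteratedDeriv_succ, ih]
    funext x
    refine HasDerivAt.deriv (HasDerivAt.fun_sum fun m _ => ?_)
    have h1 : HasDerivAt (fun x : ℝ => κ m * (x : ℂ)) (κ m) x := by
      simpa using (Complex.ofRealCLM.hasDerivAt (x := x)).const_mul (κ m)
    have := h1.cexp.const_mul (c m * κ m ^ i)
    rwa [show c m * κ m ^ i * (Complex.exp (κ m * x) * κ m)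
      = c m * κ m ^ (i + 1) * Complex.exp (κ m * x) by ring] at this

/-- Orthogonality of powers of ρ: the exponent i + n - i' lies strictly between 0 and 2n, so it is
divisible by n only when i = i'. -/
theorem sum_rho_pow {n : ℕ} (hn : n ≠ 0) {i i' : ℕ} (hi : i < n) (hi' : i' < n) (z : ℂ) :
    ∑ m : Fin n, charExp n z m ^ (i + 1) * charExp n z m ^ (n - 1 - i')
      = if i = i' then n * (Complex.I * z) ^ n else 0 := by
  have h1 : ∀ m : Fin n, charExp n z m ^ (i + 1) * charExp n z m ^ (n - 1 - i')
      = (Complex.I * z) ^ (i + n - i') * (rho n ^ (i + n - i')) ^ (m : ℕ) := by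
    intro m
    rw [← pow_add, show i + 1 + (n - 1 - i') = i + n - i' by omega]
    unfold charExp
    rw [mul_pow, ← pow_mul, ← pow_mul, mul_comm (m : ℕ)]
  simp_rw [h1]
  rw [← Finset.mul_sum]
  split_ifs with h
  · subst h
    rw [show i + n - i = n by omega, rho_pow_self hn]
    simp [mul_comm]
  · have h2 : rho n ^ (i + n - i') ≠ 1 := by
      intro h3
      obtain ⟨q, hq⟩ := ((isPrimitiveRoot_rho hn).pow_eq_one_iff_dvd _).1 h3
      have h4 : q = 1 := by
        rcases q with _ | _ | q
        · omega
        · rfl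
        · exfalso
          have : n * 2 ≤ n * (q + 1 + 1) := Nat.mul_le_mul_left _ (by omega)
          omega
      subst h4
      omega
    rw [Fin.sum_univ_eq_sum_range (fun m => (rho n ^ (i + n - i')) ^ m) n]
    have h5 := geom_sum_mul (rho n ^ (i + n - i')) n
    rw [← pow_mul, mul_comm (i + n - i'), pow_mul, rho_pow_self hn, one_pow, sub_self] at h5
    rw [(mul_eq_zero.1 h5).resolve_right (sub_ne_zero.2 h2), mul_zero]

/-- A solution of `y⁽ⁿ⁾ = (i z)ⁿ y` on `[0, 1]` is a combination of exponentials. -/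
theorem exists_eq_sum_exp {n : ℕ} (hn : n ≠ 0) {z : ℂ} (hz : z ≠ 0) {y : ℝ → ℂ}
    (hy : ContDiff ℝ n y)
    (h : ∀ x ∈ Set.Icc (0 : ℝ) 1, iteratedDeriv n y x = (Complex.I * z) ^ n * y x) :
    ∃ c : Fin n → ℂ, ∀ i < n, ∀ x ∈ Set.Icc (0 : ℝ) 1, iteratedDeriv i y x
      = ∑ m, c m * charExp n z m ^ i * Complex.exp (charExp n z m * x) := by
  set κ : Fin n → ℂ := fun m => charExp n z m with hκ
  -- This is the quotient (Dⁿ - κ_mⁿ)/(D - κ_m) applied to y, so the differential equation of order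
  -- n becomes ψ_m' = κ_m ψ_m on [0, 1].
  set ψ : Fin n → ℝ → ℂ := fun m x => ∑ i ∈ Finset.range n, κ m ^ (n - 1 - i) * iteratedDeriv i y x
    with hψ
  have hIz : (n : ℂ) * (Complex.I * z) ^ n ≠ 0 :=
    mul_ne_zero (by exact_mod_cast hn) (pow_ne_zero _ (mul_ne_zero Complex.I_ne_zero hz))
  have hd : ∀ m x, HasDerivAt (ψ m)
      (∑ i ∈ Finset.range n, κ m ^ (n - 1 - i) * iteratedDeriv (i + 1) y x) x := by
    intro m x
    refine HasDerivAt.fun_sum fun i hi => ?_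
    have h1 : Differentiable ℝ (iteratedDeriv i y) :=
      hy.differentiable_iteratedDeriv i (by exact_mod_cast Finset.mem_range.1 hi)
    have h2 := (h1 x).hasDerivAt
    rw [← iteratedDeriv_succ] at h2
    exact h2.const_mul _
  have hd' : ∀ m, ∀ x ∈ Set.Icc (0 : ℝ) 1,
      ∑ i ∈ Finset.range n, κ m ^ (n - 1 - i) * iteratedDeriv (i + 1) y x = κ m * ψ m x := by
    intro m x hx
    obtain ⟨N, rfl⟩ : ∃ N, n = N + 1 := ⟨n - 1, by omega⟩
    simp only [hψ]
    rw [Finset.sum_range_succ, Finset.sum_range_succ', mul_add, Finset.mul_sum, h x hx,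
      ← charExp_pow_self hn z m]
    congr 1
    · refine Finset.sum_congr rfl fun i hi => ?_
      have : N + 1 - 1 - i = (N + 1 - 1 - (i + 1)) + 1 := by
        have := Finset.mem_range.1 hi; omega
      rw [this, pow_succ']; ring
    · simp only [hκ, Nat.add_sub_cancel, Nat.sub_self, pow_zero, one_mul, Nat.sub_zero,
        iteratedDeriv_zero]
      rw [pow_succ']; ring
  have hconst : ∀ m, ∀ x ∈ Set.Icc (0 : ℝ) 1, ψ m x = ψ m 0 * Complex.exp (κ m * x) := by
    intro m x hx
    have hE : ∀ x : ℝ, HasDerivAt (fun x : ℝ => Complex.exp (-(κ m * x)))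
        (Complex.exp (-(κ m * x)) * -(κ m)) x := by
      intro x
      have h1 : HasDerivAt (fun x : ℝ => -(κ m * (x : ℂ))) (-(κ m)) x := by
        simpa using ((Complex.ofRealCLM.hasDerivAt (x := x)).const_mul (κ m)).fun_neg
      exact h1.cexp
    have hprod := fun x => (hd m x).mul (hE x)
    have := constant_of_has_deriv_right_zero (f := ψ m * fun x : ℝ => Complex.exp (-(κ m * x)))
      (a := 0) (b := 1) (fun x _ => (hprod x).continuousAt.continuousWithinAt)
      (fun x hx => by
        have h2 := (hprod x).hasDerivWithinAt (s := Set.Ici x)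
        rw [hd' m x ⟨hx.1, hx.2.le⟩] at h2
        convert h2 using 1
        ring) x hx
    simp only [Pi.mul_apply, Complex.ofReal_zero, mul_zero, neg_zero, Complex.exp_zero,
      mul_one] at this
    rw [← this, mul_assoc, ← Complex.exp_add]
    simp
  refine ⟨fun m => κ m * ψ m 0 / (n * (Complex.I * z) ^ n), fun i hi x hx => ?_⟩
  -- Discrete Fourier inversion recovers every derivative of y of order less than n from the ψ_m;
  -- the coefficients c_m are read off from it.
  have h3 : ∑ m, κ m ^ (i + 1) * ψ m x = (n * (Complex.I * z) ^ n) * iteratedDeriv i y x := by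
    simp only [hψ, Finset.mul_sum]
    rw [Finset.sum_comm]
    simp_rw [← mul_assoc, ← Finset.sum_mul]
    rw [Finset.sum_congr rfl fun i' hi' => by
      rw [sum_rho_pow hn hi (Finset.mem_range.1 hi') z]]
    simp only [ite_mul, zero_mul]
    rw [Finset.sum_ite_eq, if_pos (Finset.mem_range.2 hi)]
  rw [← mul_right_inj' hIz, ← h3, Finset.mul_sum]
  refine Finset.sum_congr rfl fun m _ => ?_
  rw [hconst m x hx]
  have : (n : ℂ) * (Complex.I * z) ^ n * (κ m * ψ m 0 / (n * (Complex.I * z) ^ n)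
      * κ m ^ i * Complex.exp (κ m * x)) = (n * (Complex.I * z) ^ n / (n * (Complex.I * z) ^ n))
        * (κ m ^ (i + 1) * (ψ m 0 * Complex.exp (κ m * x))) := by ring
  rw [this, div_self hIz, one_mul]

namespace BoundaryConditions

variable {n : ℕ} (B : BoundaryConditions n)

/-- The columns of the characteristic matrix, with the exponentials `e^{i z ρ^m}`, `m ≥ k`, factored
out. -/
noncomputable def charCols (z : ℂ) : ℕ → Fin n → ℂ := fun m =>
  if m < n / 2 then B.colP z m + Complex.exp (charExp n z m) • B.colQ z m
  else Complex.exp (-charExp n z m) • B.colP z m + B.colQ z m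

/-- The matrix of the boundary forms of the exponential solutions. -/
noncomputable def formMatrix (z : ℂ) : Matrix (Fin n) (Fin n) ℂ := Matrix.of fun j m =>
  (B.P j).eval (charExp n z m) + Complex.exp (charExp n z m) * (B.Q j).eval (charExp n z m)

/-- The two matrices differ only by nonvanishing factors: powers of iz in the rows and exponentials
in the columns numbered from k on. -/
theorem detCols_charCols_eq_zero_iff {z : ℂ} (hz : z ≠ 0) :
    detCols (B.charCols z) = 0 ↔ (B.formMatrix z).det = 0 := by
  have hIz : Complex.I * z ≠ 0 := mul_ne_zero Complex.I_ne_zero hz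
  have h : B.charCols z = fun m j => ((Complex.I * z) ^ B.d j)⁻¹ *
      ((if m < n / 2 then 1 else Complex.exp (-charExp n z m)) *
        ((B.P j).eval (charExp n z m)
          + Complex.exp (charExp n z m) * (B.Q j).eval (charExp n z m))) := by
    funext m j
    unfold charCols colP colQ
    split_ifs
    · simp only [Pi.add_apply, Pi.smul_apply, smul_eq_mul, charExp]
      ring
    · have h1 : Complex.exp (-charExp n z m) * Complex.exp (charExp n z m) = 1 := by
        rw [← Complex.exp_add]; simp
      simp only [Pi.add_apply, Pi.smul_apply, smul_eq_mul]
      rw [mul_add (Complex.exp (-charExp n z m)), ← mul_assoc (Complex.exp (-charExp n z m)), h1]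
      simp only [charExp]
      ring
  rw [h, detCols_rowScale (fun j => ((Complex.I * z) ^ B.d j)⁻¹)
    (fun m j => ((if m < n / 2 then 1 else Complex.exp (-charExp n z m)) *
        ((B.P j).eval (charExp n z m)
          + Complex.exp (charExp n z m) * (B.Q j).eval (charExp n z m)))),
    detCols_colScale (fun m => if m < n / 2 then 1 else Complex.exp (-charExp n z m))
    (fun m j => (B.P j).eval (charExp n z m)
          + Complex.exp (charExp n z m) * (B.Q j).eval (charExp n z m)), mul_eq_zero, mul_eq_zero]
  have h1 : ∏ j, ((Complex.I * z) ^ B.d j)⁻¹ ≠ 0 :=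
    Finset.prod_ne_zero_iff.2 fun j _ => inv_ne_zero (pow_ne_zero _ hIz)
  have h2 : ∏ m : Fin n, (if (m : ℕ) < n / 2 then 1 else Complex.exp (-charExp n z m)) ≠ 0 :=
    Finset.prod_ne_zero_iff.2 fun m _ => by
      split_ifs
      · exact one_ne_zero
      · exact Complex.exp_ne_zero _
  simp only [h1, h2, false_or]
  rfl

theorem boundaryForm_eq {z : ℂ} {y : ℝ → ℂ} {c : Fin n → ℂ}
    (hy : ∀ i < n, ∀ x ∈ Set.Icc (0 : ℝ) 1, iteratedDeriv i y x
      = ∑ m, c m * charExp n z m ^ i * Complex.exp (charExp n z m * x)) (j : Fin n) :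
    ((B.P j).sum fun i a => a * iteratedDeriv i y 0) +
      ((B.Q j).sum fun i a => a * iteratedDeriv i y 1) = (B.formMatrix z).mulVec c j := by
  have h0 : ∀ i < n, iteratedDeriv i y 0 = ∑ m, c m * charExp n z m ^ i := fun i hi => by
    simpa using hy i hi 0 (by simp)
  have h1 : ∀ i < n, iteratedDeriv i y 1
      = ∑ m, c m * charExp n z m ^ i * Complex.exp (charExp n z m) := fun i hi => by
    simpa using hy i hi 1 (by simp)
  have hP : ((B.P j).sum fun i a => a * iteratedDeriv i y 0)
      = ∑ m : Fin n, (B.P j).eval (charExp n z m) * c m := by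
    rw [Polynomial.sum_def]
    rw [Finset.sum_congr rfl fun i hi => by
      rw [h0 i (WithBot.coe_lt_coe.1 ((Polynomial.le_degree_of_mem_supp i hi).trans_lt
        (B.degree_P_lt j))), Finset.mul_sum]]
    rw [Finset.sum_comm]
    refine Finset.sum_congr rfl fun m _ => ?_
    rw [Polynomial.eval_eq_sum, Polynomial.sum_def, Finset.sum_mul]
    exact Finset.sum_congr rfl fun i _ => by ring
  have hQ : ((B.Q j).sum fun i a => a * iteratedDeriv i y 1)
      = ∑ m : Fin n, Complex.exp (charExp n z m) * (B.Q j).eval (charExp n z m) * c m := by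
    rw [Polynomial.sum_def]
    rw [Finset.sum_congr rfl fun i hi => by
      rw [h1 i (WithBot.coe_lt_coe.1 ((Polynomial.le_degree_of_mem_supp i hi).trans_lt
        (B.degree_Q_lt j))), Finset.mul_sum]]
    rw [Finset.sum_comm]
    refine Finset.sum_congr rfl fun m _ => ?_
    rw [Polynomial.eval_eq_sum, Polynomial.sum_def, Finset.mul_sum, Finset.sum_mul]
    exact Finset.sum_congr rfl fun i _ => by ring
  rw [hP, hQ, ← Finset.sum_add_distrib]
  simp only [Matrix.mulVec, dotProduct, formMatrix, Matrix.of_apply]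
  exact Finset.sum_congr rfl fun m _ => by ring

theorem neg_I_pow_mul (z : ℂ) : (-Complex.I) ^ n * (Complex.I * z) ^ n = z ^ n := by
  rw [← mul_pow, ← mul_assoc]
  simp

theorem isEigenvalue_of_detCols_charCols (hn : n ≠ 0) {z : ℂ} (hz : z ≠ 0)
    (h : detCols (B.charCols z) = 0) : B.IsEigenvalue (z ^ n) := by
  rw [detCols_charCols_eq_zero_iff B hz, ← Matrix.exists_mulVec_eq_zero_iff] at h
  obtain ⟨c, hc, hM⟩ := h
  set κ : Fin n → ℂ := fun m => charExp n z m with hκ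
  set y : ℝ → ℂ := fun x => ∑ m, c m * Complex.exp (κ m * x) with hy
  have hder : ∀ i x, iteratedDeriv i y x = ∑ m, c m * κ m ^ i * Complex.exp (κ m * x) :=
    fun i x => by rw [hy, iteratedDeriv_sum_exp]
  refine ⟨fun x => y x, ?_, y, ?_, fun _ => rfl, fun j => ?_, fun x => ?_⟩
  · intro h0
    apply hc
    -- Nontriviality: if y vanished on [0, 1], all its derivatives would vanish at an interior
    -- point, and the Vandermonde matrix of the distinct exponents would annihilate the
    -- coefficients.
    have hloc : y =ᶠ[𝓝 (1 / 2 : ℝ)] fun _ => 0 := by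
      filter_upwards [Ioo_mem_nhds (show (0 : ℝ) < 1 / 2 by norm_num)
        (show (1 / 2 : ℝ) < 1 by norm_num)] with x hx
      exact congrFun h0 ⟨x, hx.1.le, hx.2.le⟩
    have h1 : ∀ i : Fin n, ∑ m, (c m * Complex.exp (κ m * (1 / 2 : ℝ))) * κ m ^ (i : ℕ) = 0 := by
      intro i
      have h2 := hloc.iteratedDeriv_eq i
      rw [hder] at h2
      rw [show iteratedDeriv i (fun _ : ℝ => (0 : ℂ)) (1 / 2) = 0 by simp] at h2
      rw [← h2]
      exact Finset.sum_congr rfl fun m _ => by ring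
    have h3 := Matrix.eq_zero_of_forall_pow_sum_mul_pow_eq_zero (charExp_injective hn hz) h1
    funext m
    have h4 := congrFun h3 m
    simpa using h4
  · apply ContDiff.sum
    intro m _
    apply ContDiff.mul contDiff_const
    apply ContDiff.cexp
    exact contDiff_const.mul Complex.ofRealCLM.contDiff
  · rw [B.boundaryForm_eq (fun i _ x _ => hder i x), hM]
    rfl
  · rw [hder, ← neg_I_pow_mul z]
    simp only [Pi.smul_apply, smul_eq_mul, hy]
    rw [mul_assoc, Finset.mul_sum]
    congr 1
    refine Finset.sum_congr rfl fun m _ => ?_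
    rw [hκ]
    simp only
    rw [charExp_pow_self hn]
    ring

theorem detCols_charCols_eq_zero (hn : n ≠ 0) {z : ℂ} (hz : z ≠ 0) (h : B.IsEigenvalue (z ^ n)) :
    detCols (B.charCols z) = 0 := by
  obtain ⟨u, hu, y, hy, hyu, hbc, hL⟩ := h
  rw [detCols_charCols_eq_zero_iff B hz, ← Matrix.exists_mulVec_eq_zero_iff]
  have hode : ∀ x ∈ Set.Icc (0 : ℝ) 1, iteratedDeriv n y x = (Complex.I * z) ^ n * y x := by
    intro x hx
    have h1 := hL ⟨x, hx⟩
    rw [Pi.smul_apply, smul_eq_mul, ← hyu, ← neg_I_pow_mul z, mul_assoc] at h1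
    exact (mul_left_cancel₀ (pow_ne_zero _ (neg_ne_zero.2 Complex.I_ne_zero)) h1).symm
  obtain ⟨c, hc⟩ := exists_eq_sum_exp hn hz hy hode
  refine ⟨c, ?_, ?_⟩
  · rintro rfl
    apply hu
    funext x
    have := hc 0 (Nat.pos_of_ne_zero hn) x x.2
    rw [← hyu x]
    simpa using this
  · funext j
    rw [← B.boundaryForm_eq hc j, hbc j]
    rfl

end BoundaryConditions

/-! ### Asymptotic location of the eigenvalues in the sector |Arg z| ≤ π/n. -/

theorem sin_le_sin_of_mem {a x : ℝ} (ha : 0 ≤ a) (h1 : a ≤ x) (h2 : x ≤ Real.pi - a) :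
    Real.sin a ≤ Real.sin x := by
  rcases le_total x (Real.pi / 2) with h | h
  · exact Real.sin_le_sin_of_le_of_le_pi_div_two (by linarith [Real.pi_pos]) h h1
  · rw [← Real.sin_pi_sub x]
    exact Real.sin_le_sin_of_le_of_le_pi_div_two (by linarith [Real.pi_pos]) (by linarith)
      (by linarith)

theorem im_mul_rho_pow (n : ℕ) (z : ℂ) (m : ℕ) :
    (z * rho n ^ m).im = ‖z‖ * Real.sin (z.arg + 2 * Real.pi / n * m) := by
  have h : z * rho n ^ m = ‖z‖ * Complex.exp ((z.arg + 2 * Real.pi / n * m : ℝ) * Complex.I) := by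
    conv_lhs => rw [← Complex.norm_mul_exp_arg_mul_I z]
    unfold rho
    rw [← Complex.exp_nat_mul, mul_assoc, ← Complex.exp_add]
    congr 2
    push_cast
    ring
  rw [h, Complex.im_ofReal_mul, Complex.exp_ofReal_mul_I_im]

theorem norm_exp_charExp (n : ℕ) (z : ℂ) (m : ℕ) :
    ‖Complex.exp (charExp n z m)‖
      = Real.exp (-(‖z‖ * Real.sin (z.arg + 2 * Real.pi / n * m))) := by
  rw [Complex.norm_exp, ← im_mul_rho_pow, charExp, mul_assoc]
  simp

theorem norm_exp_charExp_le {n : ℕ} (hn : 0 < n) {z : ℂ} {m : ℕ}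
    (h1 : Real.pi / n ≤ z.arg + 2 * Real.pi / n * m)
    (h2 : z.arg + 2 * Real.pi / n * m ≤ Real.pi - Real.pi / n) :
    ‖Complex.exp (charExp n z m)‖ ≤ Real.exp (-(Real.sin (Real.pi / n) * ‖z‖)) := by
  have hn' : (0 : ℝ) < n := by exact_mod_cast hn
  rw [norm_exp_charExp, Real.exp_le_exp, neg_le_neg_iff, mul_comm]
  exact mul_le_mul_of_nonneg_left (sin_le_sin_of_mem (by positivity) h1 h2) (norm_nonneg z)

/-- `z → ∞` in the sector `|Arg z| ≤ π / n`. -/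
noncomputable def sectorFilter (n : ℕ) : Filter ℂ :=
  Bornology.cobounded ℂ ⊓ 𝓟 {z | |z.arg| ≤ Real.pi / n}

theorem sin_pi_div_pos {n : ℕ} (hn : 2 ≤ n) : 0 < Real.sin (Real.pi / n) := by
  have hn' : (2 : ℝ) ≤ n := by exact_mod_cast hn
  apply Real.sin_pos_of_pos_of_lt_pi (by positivity)
  rw [div_lt_iff₀ (by linarith)]
  nlinarith [Real.pi_pos]

/-- For 0 < m < k the rotated argument arg z + 2πm/n stays within [π/n, π - π/n], so Im(zρ^m) is at
least |z| sin(π/n). -/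
theorem tendsto_exp_charExp {n : ℕ} (hn : Even n) (h4 : 4 ≤ n) {m : ℕ} (h0 : 0 < m)
    (hm : m < n / 2) :
    Tendsto (fun z => Complex.exp (charExp n z m)) (sectorFilter n) (𝓝 0) := by
  have hs := sin_pi_div_pos (by omega : 2 ≤ n)
  have h1 : Tendsto (fun z : ℂ => Real.exp (-(Real.sin (Real.pi / n) * ‖z‖))) (sectorFilter n)
      (𝓝 0) :=
    Real.tendsto_exp_neg_atTop_nhds_zero.comp
      ((tendsto_norm_cobounded_atTop.mono_left inf_le_left).const_mul_atTop hs)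
  refine squeeze_zero_norm' ?_ h1
  filter_upwards [mem_inf_of_right (mem_principal_self _)] with z hz
  obtain ⟨k, hk⟩ := hn
  have hn' : (0 : ℝ) < n := by exact_mod_cast (by omega : 0 < n)
  have hm1 : (1 : ℝ) ≤ m := by exact_mod_cast h0
  have hm2 : 2 * (m : ℝ) + 2 ≤ n := by
    have : 2 * m + 2 ≤ n := by omega
    exact_mod_cast this
  have hz' := abs_le.1 (show |z.arg| ≤ Real.pi / n from hz)
  have e1 : 2 * Real.pi / n * m = Real.pi / n * (2 * m) := by ring
  have e2 : Real.pi / n * n = Real.pi := by field_simp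
  have hpn : 0 < Real.pi / n := by positivity
  apply norm_exp_charExp_le (by omega) <;> nlinarith

theorem charExp_half_add {n : ℕ} (hn : Even n) (h0 : n ≠ 0) (z : ℂ) (m : ℕ) :
    -charExp n z (n / 2 + m) = charExp n z m := by
  unfold charExp
  rw [pow_add, rho_pow_half hn h0]
  ring

theorem differentiableAt_detCols {n : ℕ} {c : ℂ → ℕ → Fin n → ℂ} {z : ℂ}
    (h : ∀ m < n, ∀ j, DifferentiableAt ℂ (fun z => c z m j) z) :
    DifferentiableAt ℂ (fun z => detCols (c z)) z := by
  unfold detCols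
  simp only [Matrix.det_apply]
  refine DifferentiableAt.fun_sum fun σ _ => DifferentiableAt.const_smul ?_ _
  exact DifferentiableAt.fun_finsetProd fun i _ => h i i.2 _

/-- Points far to the right in a horizontal strip lie in the sector. -/
theorem exists_forall_abs_arg_lt {n : ℕ} (hn : 2 ≤ n) (Y : ℝ) : ∃ X > 0, ∀ z : ℂ, X ≤ z.re →
    |z.im| ≤ Y → |z.arg| < Real.pi / n := by
  have hs := sin_pi_div_pos hn
  have hn' : (2 : ℝ) ≤ n := by exact_mod_cast hn
  refine ⟨(|Y| + 1) / Real.sin (Real.pi / n), by positivity, fun z hX hY => ?_⟩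
  have hre : 0 < z.re := lt_of_lt_of_le (by positivity) hX
  have hnorm : z.re ≤ ‖z‖ := Complex.re_le_norm z
  have hz0 : 0 < ‖z‖ := hre.trans_le hnorm
  have hle : Real.pi / n ≤ Real.pi / 2 := by gcongr
  have hpos : 0 < Real.pi / n := by positivity
  have h1 : |z.im / ‖z‖| < Real.sin (Real.pi / n) := by
    rw [abs_div, abs_norm, div_lt_iff₀ hz0]
    rw [div_le_iff₀ hs] at hX
    nlinarith [le_abs_self Y]
  rw [Complex.arg_of_re_nonneg hre.le, abs_lt]
  have h2 := abs_lt.1 h1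
  have e : Real.arcsin (Real.sin (Real.pi / n)) = Real.pi / n :=
    Real.arcsin_sin (by linarith) hle
  have hb := Real.sin_le_one (Real.pi / n)
  constructor
  · rw [← e, ← Real.arcsin_neg]
    exact Real.arcsin_lt_arcsin (by linarith) h2.1 (by linarith)
  · rw [← e]
    exact Real.arcsin_lt_arcsin (by linarith) h2.2 hb

theorem exists_forall_of_eventually_sector {n : ℕ} (hn : 2 ≤ n) {Q : ℂ → Prop}
    (hQ : ∀ᶠ z in sectorFilter n, Q z) (Y : ℝ) :
    ∃ X > 0, ∀ z : ℂ, X ≤ z.re → |z.im| ≤ Y → Q z := by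
  unfold sectorFilter at hQ
  rw [eventually_inf_principal, ← comap_norm_atTop, eventually_comap] at hQ
  obtain ⟨R, hR⟩ := eventually_atTop.1 hQ
  obtain ⟨X, hX, h⟩ := exists_forall_abs_arg_lt hn Y
  refine ⟨max X R, by positivity, fun z h1 h2 => ?_⟩
  exact hR _ ((le_max_right X R).trans (h1.trans (Complex.re_le_norm z))) z rfl
    (h z ((le_max_left X R).trans h1) h2).le

namespace BoundaryConditions

variable {n : ℕ} {B : BoundaryConditions n} {ω : Fin 2 → ℂ}

variable (B) in
-- Outside the columns 0 and k all exponentials tend to zero and can be absorbed into modified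
-- columns p and q with unchanged limits. The full characteristic matrix then has truncated form,
-- with e^{iz} as the second variable.
theorem eventually_norm_charCols_sub_le (hn : Even n) (h4 : 4 ≤ n) {ε : ℝ} (hε : 0 < ε) :
    ∀ᶠ z in sectorFilter n, ‖detCols (B.charCols z)
      - B.birkhoff.eval (Complex.exp (Complex.I * z))‖
        ≤ ε * (1 + ‖Complex.exp (Complex.I * z)‖) ^ 2 := by
  set p : ℂ → ℕ → Fin n → ℂ := fun z m => if 0 < m ∧ m < n / 2 then
    B.colP z m + Complex.exp (charExp n z m) • B.colQ z m else B.colP z m with hp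
  set q : ℂ → ℕ → Fin n → ℂ := fun z m => if n / 2 < m then
    Complex.exp (-charExp n z m) • B.colP z m + B.colQ z m else B.colQ z m with hq
  have tP : ∀ m, Tendsto (fun z => B.colP z m) (sectorFilter n) (𝓝 (leadCol B.d B.a m)) :=
    fun m => (B.tendsto_colP m).mono_left inf_le_left
  have tQ : ∀ m, Tendsto (fun z => B.colQ z m) (sectorFilter n) (𝓝 (leadCol B.d B.b m)) :=
    fun m => (B.tendsto_colQ m).mono_left inf_le_left
  have hp' : ∀ m < n, Tendsto (fun z => p z m) (sectorFilter n) (𝓝 (leadCol B.d B.a m)) := by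
    intro m _
    simp only [hp]
    split_ifs with h
    · simpa using (tP m).add ((tendsto_exp_charExp hn h4 h.1 h.2).smul (tQ m))
    · exact tP m
  have hq' : ∀ m < n, Tendsto (fun z => q z m) (sectorFilter n) (𝓝 (leadCol B.d B.b m)) := by
    intro m hm
    simp only [hq]
    split_ifs with h
    · obtain ⟨e, rfl⟩ := Nat.exists_eq_add_of_le h.le
      simp only [charExp_half_add hn (by omega : n ≠ 0)]
      have := tendsto_exp_charExp hn h4 (by omega : 0 < e)
        (by have := Nat.even_iff.1 hn; omega)
      simpa using (this.smul (tP _)).add (tQ _)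
    · exact tQ m
  filter_upwards [eventually_norm_detCols_truncCols_sub_le (by omega) hp' hq' hε] with z hz
  have h1 := hz (Complex.exp (Complex.I * z))
  rwa [← detCols_congr (c := B.charCols z)] at h1
  intro m hm
  simp only [charCols, truncCols, hp, hq]
  by_cases h0 : m = 0
  · subst h0
    simp [show 0 < n / 2 by omega, charExp]
  · by_cases hk : m = n / 2
    · subst hk
      have := charExp_half_add hn (by omega : n ≠ 0) z 0
      rw [add_zero, show charExp n z 0 = Complex.I * z by simp [charExp]] at this
      simp [h0, this]
    · by_cases hl : m < n / 2
      · simp [h0, hk, hl, Nat.pos_of_ne_zero h0]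
      · simp [h0, hk, hl, lt_of_le_of_ne (not_lt.1 hl) (Ne.symm hk)]

variable (B) in
theorem differentiableAt_charCols {z : ℂ} (hz : z ≠ 0) :
    DifferentiableAt ℂ (fun z => detCols (B.charCols z)) z := by
  have hP : ∀ m j, DifferentiableAt ℂ (fun z => B.colP z m j) z := by
    intro m j
    unfold colP
    refine DifferentiableAt.div ?_ (by fun_prop)
      (pow_ne_zero _ (mul_ne_zero Complex.I_ne_zero hz))
    exact (B.P j).differentiable.differentiableAt.comp z
      (f := fun z => Complex.I * z * rho n ^ m) (by fun_prop)
  have hQ : ∀ m j, DifferentiableAt ℂ (fun z => B.colQ z m j) z := by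
    intro m j
    unfold colQ
    refine DifferentiableAt.div ?_ (by fun_prop)
      (pow_ne_zero _ (mul_ne_zero Complex.I_ne_zero hz))
    exact (B.Q j).differentiable.differentiableAt.comp z
      (f := fun z => Complex.I * z * rho n ^ m) (by fun_prop)
  refine differentiableAt_detCols fun m _ j => ?_
  unfold charCols charExp
  split_ifs
  · simp only [Pi.add_apply, Pi.smul_apply, smul_eq_mul]
    exact (hP m j).add (DifferentiableAt.mul (by fun_prop) (hQ m j))
  · simp only [Pi.add_apply, Pi.smul_apply, smul_eq_mul]
    exact (DifferentiableAt.mul (by fun_prop) (hP m j)).add (hQ m j)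

/-- Large eigenvalues are close to the lattices. -/
theorem HasRootLogs.eventually_exists_norm_sub_lt (hω : B.HasRootLogs ω) (hn : Even n)
    (h4 : 4 ≤ n) {η : ℝ} (hη : 0 < η) :
    ∀ᶠ z in sectorFilter n, B.IsEigenvalue (z ^ n) →
      ∃ a j, ‖z - latticePt (ω a) j‖ < η := by
  obtain ⟨c, hc, h⟩ := hω.exists_mul_le_norm_birkhoff hη
  have h0 : ∀ᶠ z in sectorFilter n, z ≠ 0 :=
    (Bornology.eventually_ne_cobounded (0 : ℂ)).filter_mono inf_le_left
  filter_upwards [B.eventually_norm_charCols_sub_le hn h4 (half_pos hc), h0] with z h1 hz hl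
  by_contra! hcon
  have h2 := h z fun a j => hcon a j
  rw [B.detCols_charCols_eq_zero (by omega) hz hl, zero_sub, norm_neg] at h1
  have : 0 < c / 2 * (1 + ‖Complex.exp (Complex.I * z)‖) ^ 2 := by positivity
  linarith

/-- Close to every remote lattice point there is an eigenvalue. -/
theorem HasRootLogs.eventually_exists_isEigenvalue (hω : B.HasRootLogs ω) (hn : Even n)
    (h4 : 4 ≤ n) (a : Fin 2) {η : ℝ} (hη : 0 < η) :
    ∀ᶠ j : ℤ in atTop, ∃ z, ‖z - latticePt (ω a) j‖ < η ∧ B.IsEigenvalue (z ^ n) := by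
  set f : ℂ → ℂ := fun z => B.birkhoff.eval (Complex.exp (Complex.I * z)) with hf
  have hper : ∀ z (j : ℤ), f (z + 2 * Real.pi * j) = f z := by
    intro z j
    simp only [hf]
    rw [show z + 2 * Real.pi * j = latticePt z j from rfl, exp_latticePt]
  have hfa : f (ω a) = 0 := by
    simp only [hf]
    rw [hω.2]
    fin_cases a <;> simp
  have hne : ∀ᶠ z in 𝓝[≠] (ω a), f z ≠ 0 := by
    have hd : HasDerivAt (fun z => Complex.exp (Complex.I * z))
        (Complex.exp (Complex.I * ω a) * Complex.I) (ω a) := by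
      have : HasDerivAt (fun z => Complex.I * z) Complex.I (ω a) := by
        simpa using (hasDerivAt_id (ω a)).const_mul Complex.I
      exact this.cexp
    have hd0 : Complex.exp (Complex.I * ω a) * Complex.I ≠ 0 :=
      mul_ne_zero (Complex.exp_ne_zero _) Complex.I_ne_zero
    filter_upwards [hd.eventually_ne hd0 (c := Complex.exp (Complex.I * ω 0)),
      hd.eventually_ne hd0 (c := Complex.exp (Complex.I * ω 1))] with z h1 h2
    simp only [hf]
    rw [hω.2]
    exact mul_ne_zero hω.1 (mul_ne_zero (sub_ne_zero.2 h1) (sub_ne_zero.2 h2))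
  -- The zero ω_a of f is isolated because z ↦ e^{iz} is locally injective. On a small circle about
  -- it |f| has a positive minimum c, and by periodicity the same c serves for every translate.
  obtain ⟨r, hr, hball⟩ := Metric.mem_nhdsWithin_iff.1 hne
  set s := min r η / 2 with hs
  have hs0 : 0 < s := by positivity
  have hsr : s < r := by have := min_le_left r η; linarith
  have hsη : s < η := by have := min_le_right r η; linarith
  have hfc : Continuous f := by fun_prop
  obtain ⟨z₀, hz₀, hmin⟩ := (isCompact_sphere (ω a) s).exists_isMinOn
    (NormedSpace.sphere_nonempty.2 hs0.le) hfc.norm.continuousOn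
  have hz₀' : dist z₀ (ω a) = s := hz₀
  have hc0 : 0 < ‖f z₀‖ := by
    refine norm_pos_iff.2 (hball ⟨?_, ?_⟩)
    · rw [Metric.mem_ball, hz₀']; exact hsr
    · intro h
      rw [Set.mem_singleton_iff.1 h, dist_self] at hz₀'
      linarith
  set c := ‖f z₀‖
  have hsph : ∀ z, ‖z - ω a‖ = s → c ≤ ‖f z‖ := fun z hz =>
    hmin (by rw [mem_sphere_iff_norm]; exact hz)
  set Y := |(ω a).im| + s
  -- W bounds (1 + |e^{iz}|)² on the translated discs, so the tolerance c/8/W keeps the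
  -- characteristic determinant N within c/8 of f there.
  set W := (1 + Real.exp Y) ^ 2
  have hW : 0 < W := by positivity
  obtain ⟨X, hX0, hX⟩ := exists_forall_of_eventually_sector (by omega)
    (B.eventually_norm_charCols_sub_le hn h4 (show 0 < c / 8 / W by positivity)) Y
  have hev : ∀ᶠ j : ℤ in atTop, X ≤ (ω a).re + 2 * Real.pi * j - s := by
    have : Tendsto (fun j : ℤ => (ω a).re + 2 * Real.pi * (j : ℝ) - s) atTop atTop :=
      tendsto_atTop_add_const_right _ _ (tendsto_atTop_add_const_left _ _
        (tendsto_intCast_atTop_atTop.const_mul_atTop (by positivity)))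
    exact this.eventually_ge_atTop X
  filter_upwards [hev] with j hj
  set Z := latticePt (ω a) j with hZ
  have hre : ∀ z, ‖z - Z‖ ≤ s → X ≤ z.re := by
    intro z hz
    have h1 := (Complex.abs_re_le_norm (z - Z)).trans hz
    rw [Complex.sub_re, hZ, latticePt_re] at h1
    have := abs_le.1 h1
    linarith
  have him : ∀ z, ‖z - Z‖ ≤ s → |z.im| ≤ Y := by
    intro z hz
    have h1 := (Complex.abs_im_le_norm (z - Z)).trans hz
    rw [Complex.sub_im, hZ, latticePt_im] at h1
    have := abs_sub_abs_le_abs_sub z.im (ω a).im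
    linarith
  set N : ℂ → ℂ := fun z => detCols (B.charCols z)
  have happ : ∀ z, ‖z - Z‖ ≤ s → ‖N z - f z‖ ≤ c / 8 := by
    intro z hz
    refine (hX z (hre z hz) (him z hz)).trans ?_
    have h1 : ‖Complex.exp (Complex.I * z)‖ ≤ Real.exp Y := by
      rw [Complex.norm_exp, Real.exp_le_exp]
      have := (neg_le_abs z.im).trans (him z hz)
      simpa using this
    calc c / 8 / W * (1 + ‖Complex.exp (Complex.I * z)‖) ^ 2 ≤ c / 8 / W * W :=
          mul_le_mul_of_nonneg_left (pow_le_pow_left₀ (by positivity) (by linarith) 2)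
            (by positivity)
      _ = c / 8 := by field_simp
  have hfZ : f Z = 0 := by rw [hZ]; exact (hper _ _).trans hfa
  have hNZ : ‖N Z‖ ≤ c / 8 := by
    have := happ Z (by simpa using hs0.le)
    rwa [hfZ, sub_zero] at this
  have hne0 : ∀ z, ‖z - Z‖ ≤ s → z ≠ 0 := by
    rintro z hz rfl
    have := hre 0 hz
    simp only [Complex.zero_re] at this
    linarith
  have hdiff : DiffContOnCl ℂ N (Metric.ball Z s) := by
    apply DifferentiableOn.diffContOnCl_ball (U := Metric.closedBall Z s) _ subset_rfl
    intro z hz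
    exact (B.differentiableAt_charCols
      (hne0 z (mem_closedBall_iff_norm.1 hz))).differentiableWithinAt
  have hsphN : ∀ z ∈ Metric.sphere Z s, c / 2 ≤ ‖N z - N Z‖ := by
    intro z hz
    have hz' : ‖z - Z‖ = s := mem_sphere_iff_norm.1 hz
    have h1 := hsph (z - 2 * Real.pi * j) (by
      rw [← hz', hZ, latticePt]; congr 1; ring)
    rw [← hper (z - 2 * Real.pi * j) j, sub_add_cancel] at h1
    have h2 := happ z hz'.le
    have h3 := norm_sub_norm_le (f z) (N z)
    have h4 := norm_sub_norm_le (N z) (N Z)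
    rw [norm_sub_rev] at h3
    linarith
  -- Were N constant near Z, the identity theorem would make it constant on the closed disc, against
  -- `hsphN`.
  have hfreq : ∃ᶠ z in 𝓝 Z, N z ≠ N Z := by
    intro hcon
    simp only [ne_eq, not_not] at hcon
    have hanal : AnalyticOnNhd ℂ N (Metric.ball Z s) := by
      apply DifferentiableOn.analyticOnNhd _ Metric.isOpen_ball
      exact hdiff.differentiableOn
    have heq := hanal.eqOn_of_preconnected_of_eventuallyEq (g := fun _ => N Z)
      analyticOnNhd_const (convex_ball Z s).isPreconnected (Metric.mem_ball_self hs0) hcon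
    obtain ⟨z₁, hz₁⟩ : (Metric.sphere Z s).Nonempty := NormedSpace.sphere_nonempty.2 hs0.le
    have hcl : Set.EqOn N (fun _ => N Z) (closure (Metric.ball Z s)) :=
      heq.of_subset_closure hdiff.continuousOn continuousOn_const subset_closure subset_rfl
    have h1 := hcl (by
      rw [closure_ball _ hs0.ne']; exact Metric.sphere_subset_closedBall hz₁)
    have h2 := hsphN z₁ hz₁
    rw [h1, sub_self, norm_zero] at h2
    linarith
  -- The quantitative open mapping theorem takes the place of Rouché's: the image of the disc
  -- contains the ball of radius c/4 about N Z, and this ball contains 0 because |N Z| ≤ c/8.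
  have himg := hdiff.ball_subset_image_closedBall hs0 hsphN hfreq
  obtain ⟨z, hz, hNz⟩ := himg (show (0 : ℂ) ∈ Metric.ball (N Z) (c / 2 / 2) by
    rw [mem_ball_iff_norm, zero_sub, norm_neg]; linarith)
  have hz' : ‖z - Z‖ ≤ s := mem_closedBall_iff_norm.1 hz
  exact ⟨z, hz'.trans_lt hsη,
    B.isEigenvalue_of_detCols_charCols (by omega) (hne0 z hz') hNz⟩

end BoundaryConditions

/-! ### Geometry of the contours. -/

theorem arg_mul_exp {t φ : ℝ} (ht : 0 < t) (h1 : -Real.pi < φ) (h2 : φ ≤ Real.pi) :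
    (t * Complex.exp (Complex.I * φ)).arg = φ := by
  rw [mul_comm Complex.I, Complex.exp_mul_I]
  exact Complex.arg_mul_cos_add_sin_mul_I ht ⟨h1, h2⟩

theorem norm_mul_exp {t φ : ℝ} (ht : 0 ≤ t) : ‖(t : ℂ) * Complex.exp (Complex.I * φ)‖ = t := by
  rw [norm_mul, mul_comm Complex.I, Complex.norm_exp_ofReal_mul_I, mul_one, Complex.norm_real,
    Real.norm_of_nonneg ht]

theorem norm_mul_exp_arg (z : ℂ) : (‖z‖ : ℂ) * Complex.exp (Complex.I * z.arg) = z := by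
  rw [mul_comm Complex.I]; exact Complex.norm_mul_exp_arg_mul_I z

theorem arg_pow_of_abs_lt {n : ℕ} (hn : 0 < n) {z : ℂ} (hz : z ≠ 0)
    (h : |z.arg| < Real.pi / n) : (z ^ n).arg = n * z.arg := by
  have hn' : (0 : ℝ) < n := by exact_mod_cast hn
  have h1 := abs_lt.1 h
  have e : z ^ n = ((‖z‖ ^ n : ℝ) : ℂ) * Complex.exp (Complex.I * ((n * z.arg : ℝ) : ℂ)) := by
    conv_lhs => rw [← norm_mul_exp_arg z]
    rw [mul_pow, ← Complex.exp_nat_mul]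
    push_cast
    ring_nf
  have e2 : Real.pi / n * n = Real.pi := by field_simp
  rw [e, arg_mul_exp (pow_pos (norm_pos_iff.2 hz) n)]
  · nlinarith
  · nlinarith

namespace Contour

variable {n : ℕ} (Γ : Contour n)

theorem norm_pt (φ : ℝ) : ‖Γ.pt φ‖ = Γ.r φ := norm_mul_exp (Γ.pos φ).le

theorem pt_ne_zero (φ : ℝ) : Γ.pt φ ≠ 0 := by
  rw [← norm_pos_iff, norm_pt]; exact Γ.pos φ

theorem arg_pt {φ : ℝ} (h1 : -Real.pi < φ) (h2 : φ ≤ Real.pi) : (Γ.pt φ).arg = φ :=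
  arg_mul_exp (Γ.pos φ) h1 h2

theorem pt_eq (φ : ℝ) :
    Γ.pt φ = ⟨Γ.r φ * Real.cos φ, Γ.r φ * Real.sin φ⟩ := by
  unfold pt
  rw [mul_comm Complex.I]
  apply Complex.ext
  · rw [Complex.re_ofReal_mul, Complex.exp_ofReal_mul_I_re]
  · rw [Complex.im_ofReal_mul, Complex.exp_ofReal_mul_I_im]

theorem pt_re (φ : ℝ) : (Γ.pt φ).re = Γ.r φ * Real.cos φ := by rw [pt_eq]

theorem pt_im (φ : ℝ) : (Γ.pt φ).im = Γ.r φ * Real.sin φ := by rw [pt_eq]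

theorem pt_add_period (φ : ℝ) : Γ.pt (φ + 2 * Real.pi / n) = rho n * Γ.pt φ := by
  unfold pt rho
  rw [Γ.periodic φ, mul_left_comm, ← Complex.exp_add]
  congr 2
  push_cast
  ring

theorem hasDerivAt_pt (φ : ℝ) :
    HasDerivAt Γ.pt ((deriv Γ.r φ + Γ.r φ * Complex.I) * Complex.exp (Complex.I * φ)) φ := by
  have h1 : HasDerivAt (fun φ : ℝ => (Γ.r φ : ℂ)) ((deriv Γ.r φ : ℝ) : ℂ) φ :=
    ((Γ.contDiff.differentiable (by simp)) φ).hasDerivAt.ofReal_comp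
  have h2 : HasDerivAt (fun φ : ℝ => Complex.I * (φ : ℂ)) Complex.I φ := by
    simpa using (Complex.ofRealCLM.hasDerivAt (x := φ)).const_mul Complex.I
  have h3 := h1.mul h2.cexp
  have e : (deriv Γ.r φ + Γ.r φ * Complex.I) * Complex.exp (Complex.I * φ)
      = deriv Γ.r φ * Complex.exp (Complex.I * φ)
        + Γ.r φ * (Complex.exp (Complex.I * φ) * Complex.I) := by ring
  rw [e]
  exact h3

theorem continuous_pt : Continuous Γ.pt :=
  continuous_iff_continuousAt.2 fun φ => (Γ.hasDerivAt_pt φ).continuousAt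

theorem continuous_deriv_pt : Continuous (deriv Γ.pt) := by
  have h : deriv Γ.pt = fun φ : ℝ =>
      (deriv Γ.r φ + Γ.r φ * Complex.I) * Complex.exp (Complex.I * φ) :=
    funext fun φ => (Γ.hasDerivAt_pt φ).deriv
  rw [h]
  have h1 := Γ.contDiff.continuous_deriv le_rfl
  have h2 := Γ.contDiff.continuous
  fun_prop

theorem deriv_pt_add_period (φ : ℝ) :
    deriv Γ.pt (φ + 2 * Real.pi / n) = rho n * deriv Γ.pt φ := by
  have h1 := (Γ.hasDerivAt_pt φ).const_mul (rho n)
  have h2 : HasDerivAt (fun φ => Γ.pt (φ + 2 * Real.pi / n))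
      (deriv Γ.pt (φ + 2 * Real.pi / n)) φ :=
    (Γ.hasDerivAt_pt _).differentiableAt.hasDerivAt.comp_add_const φ (2 * Real.pi / n)
  have h3 : (fun φ => Γ.pt (φ + 2 * Real.pi / n)) = fun φ => rho n * Γ.pt φ :=
    funext Γ.pt_add_period
  rw [h3] at h2
  rw [(Γ.hasDerivAt_pt φ).deriv]
  exact h2.unique h1

theorem encloses_pow_iff (hn : 0 < n) {z : ℂ} (hz : z ≠ 0) (h : |z.arg| < Real.pi / n) :
    Γ.Encloses (z ^ n) ↔ ‖z‖ < Γ.r z.arg := by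
  have hn' : (n : ℝ) ≠ 0 := by exact_mod_cast hn.ne'
  unfold Encloses
  rw [arg_pow_of_abs_lt hn hz h, mul_div_cancel_left₀ _ hn', norm_pow]
  exact pow_lt_pow_iff_left₀ (norm_nonneg z) (Γ.pos _).le hn.ne'

/-- The contour is almost circular: the oscillation of the radius is at most `c₁`, and its
logarithmic derivative is bounded by `c₂`. -/
structure Tame (c₁ c₂ : ℝ) : Prop where
  osc : ∀ φ, |Γ.r φ - Γ.r 0| ≤ c₁
  slope : ∀ φ, |deriv Γ.r φ| ≤ c₂ * Γ.r φ

variable {Γ} {c₁ c₂ : ℝ}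

theorem Tame.le_r (h : Γ.Tame c₁ c₂) (φ : ℝ) : Γ.r 0 - c₁ ≤ Γ.r φ := by
  have := abs_le.1 (h.osc φ); linarith

theorem Tame.r_le (h : Γ.Tame c₁ c₂) (φ : ℝ) : Γ.r φ ≤ Γ.r 0 + c₁ := by
  have := abs_le.1 (h.osc φ); linarith

theorem Tame.norm_deriv_pt_le (h : Γ.Tame c₁ c₂) (φ : ℝ) :
    ‖deriv Γ.pt φ‖ ≤ (c₂ + 1) * Γ.r φ := by
  rw [(Γ.hasDerivAt_pt φ).deriv, norm_mul, mul_comm Complex.I, Complex.norm_exp_ofReal_mul_I,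
    mul_one]
  refine (norm_add_le _ _).trans ?_
  rw [norm_mul, Complex.norm_I, mul_one, Complex.norm_real, Complex.norm_real,
    Real.norm_of_nonneg (Γ.pos φ).le, Real.norm_eq_abs]
  linarith [h.slope φ]

/-- Both sides are comparable with r(0)|φ|: the speed is at most 2(c₂ + 1) r(0), while |Im| =
r(φ)|sin φ| ≥ (r(0)/2)(2/π)|φ|. This pays for a detour through the point with argument 0. -/
theorem Tame.norm_pt_zero_sub_le (h : Γ.Tame c₁ c₂) (hc₂ : 0 < c₂) (hr : 2 * c₁ ≤ Γ.r 0) {φ : ℝ}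
    (hφ : |φ| ≤ Real.pi / 2) :
    ‖Γ.pt φ - Γ.pt 0‖ ≤ 2 * Real.pi * (c₂ + 1) * |(Γ.pt φ).im| := by
  have hr0 := Γ.pos 0
  have h1 : ‖Γ.pt φ - Γ.pt 0‖ ≤ ((c₂ + 1) * (2 * Γ.r 0)) * ‖φ - 0‖ := by
    refine Convex.norm_image_sub_le_of_norm_deriv_le (s := Set.univ)
      (fun φ _ => (Γ.hasDerivAt_pt φ).differentiableAt) (fun φ _ => ?_) convex_univ
      (Set.mem_univ _) (Set.mem_univ _)
    refine (h.norm_deriv_pt_le φ).trans ?_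
    have := h.r_le φ
    have : Γ.r φ ≤ 2 * Γ.r 0 := by linarith
    gcongr
  have h2 := Real.mul_abs_le_abs_sin hφ
  have h3 : Γ.r 0 / 2 ≤ Γ.r φ := by linarith [h.le_r φ]
  rw [pt_im, abs_mul, abs_of_pos (Γ.pos φ)]
  rw [sub_zero, Real.norm_eq_abs] at h1
  refine h1.trans ?_
  have hpi := Real.pi_pos
  calc (c₂ + 1) * (2 * Γ.r 0) * |φ|
      = 2 * Real.pi * (c₂ + 1) * ((Γ.r 0 / 2) * (2 / Real.pi * |φ|)) := by field_simp
    _ ≤ _ := by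
      have := Γ.pos φ
      gcongr

/-- The imaginary part crosses each given level exactly once, if the contour is large enough. -/
theorem exists_crossing (hn : 2 ≤ n) (hc₂ : 0 < c₂) (Y : ℝ) :
    ∃ R : ℝ, ∀ Γ : Contour n, Γ.Tame c₁ c₂ → R ≤ Γ.r 0 → ∃ ψ ∈ Set.Ioo (-(Real.pi / n)) (Real.pi / n),
      (Γ.pt ψ).im = Y ∧ (∀ φ ∈ Set.Ico (-(Real.pi / n)) ψ, (Γ.pt φ).im < Y) ∧
        ∀ φ ∈ Set.Ioc ψ (Real.pi / n), Y < (Γ.pt φ).im := by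
  have hn' : (2 : ℝ) ≤ n := by exact_mod_cast hn
  have hpi := Real.pi_pos
  have hpn : 0 < Real.pi / n := by positivity
  have hpn2 : Real.pi / n ≤ Real.pi / 2 := by gcongr
  set φ₀ := min (Real.pi / n) (1 / (2 * (c₂ + 1))) with hφ₀
  have h0 : 0 < φ₀ := by positivity
  have h01 : φ₀ ≤ Real.pi / n := min_le_left _ _
  have h02 : φ₀ * (2 * (c₂ + 1)) ≤ 1 := by
    have := min_le_right (Real.pi / n) (1 / (2 * (c₂ + 1)))
    rwa [← hφ₀, le_div_iff₀ (by positivity)] at this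
  have h03 : φ₀ ≤ 1 / 2 := by nlinarith
  have hs : 0 < Real.sin φ₀ := Real.sin_pos_of_pos_of_lt_pi h0 (by linarith)
  refine ⟨c₁ + (|Y| + 1) / Real.sin φ₀, fun Γ h hR => ?_⟩
  have hlow : ∀ φ, |Y| + 1 ≤ Γ.r φ * Real.sin φ₀ := by
    intro φ
    have h1 : (|Y| + 1) / Real.sin φ₀ ≤ Γ.r φ := by linarith [h.le_r φ]
    rwa [div_le_iff₀ hs] at h1
  have hY := abs_le.1 (le_refl |Y|)
  have hhigh : ∀ φ, φ₀ ≤ φ → φ ≤ Real.pi / n → Y < (Γ.pt φ).im := by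
    intro φ h1 h2
    rw [pt_im]
    have := Real.sin_le_sin_of_le_of_le_pi_div_two (by linarith) (by linarith) h1
    have := mul_le_mul_of_nonneg_left this (Γ.pos φ).le
    linarith [hlow φ]
  have hneg : ∀ φ, φ ≤ -φ₀ → -(Real.pi / n) ≤ φ → (Γ.pt φ).im < Y := by
    intro φ h1 h2
    rw [pt_im]
    have := Real.sin_le_sin_of_le_of_le_pi_div_two (x := φ) (y := -φ₀)
      (by linarith) (by linarith) h1
    rw [Real.sin_neg] at this
    have := mul_le_mul_of_nonneg_left this (Γ.pos φ).le
    linarith [hlow φ]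
  have hcont : Continuous fun φ => (Γ.pt φ).im := Complex.continuous_im.comp Γ.continuous_pt
  have hmono : StrictMonoOn (fun φ => (Γ.pt φ).im) (Set.Icc (-φ₀) φ₀) := by
    refine strictMonoOn_of_deriv_pos (convex_Icc _ _) hcont.continuousOn fun φ hφ => ?_
    rw [interior_Icc] at hφ
    have hd : HasDerivAt (fun φ => (Γ.pt φ).im)
        (deriv Γ.r φ * Real.sin φ + Γ.r φ * Real.cos φ) φ := by
      simp_rw [pt_im]
      exact (((Γ.contDiff.differentiable (by simp)) φ).hasDerivAt).mul (Real.hasDerivAt_sin φ)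
    rw [hd.deriv]
    have hφ' : |φ| ≤ φ₀ := abs_le.2 ⟨hφ.1.le, hφ.2.le⟩
    have h1 : |deriv Γ.r φ * Real.sin φ| ≤ c₂ * Γ.r φ * φ₀ := by
      rw [abs_mul]
      exact mul_le_mul (h.slope φ) (Real.abs_sin_le_abs.trans hφ') (abs_nonneg _)
        (mul_nonneg hc₂.le (Γ.pos φ).le)
    have h2 := (abs_le.1 h1).1
    have h3 := Real.one_sub_sq_div_two_le_cos (x := φ)
    have h4 : φ ^ 2 ≤ 1 / 4 := by rw [← sq_abs]; nlinarith [abs_nonneg φ]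
    have h5 := Γ.pos φ
    have h6 : 7 / 8 ≤ Real.cos φ := by linarith
    have h7 : c₂ * φ₀ ≤ 1 / 2 := by nlinarith
    have h8 : Γ.r φ * (c₂ * φ₀) ≤ Γ.r φ * (1 / 2) := by gcongr
    have h9 : Γ.r φ * (7 / 8) ≤ Γ.r φ * Real.cos φ := by gcongr
    nlinarith
  obtain ⟨ψ, hψ, hψY⟩ := intermediate_value_Ioo (by linarith : -φ₀ ≤ φ₀) hcont.continuousOn
    ⟨hneg (-φ₀) le_rfl (by linarith), hhigh φ₀ le_rfl h01⟩
  refine ⟨ψ, ⟨by linarith [hψ.1], by linarith [hψ.2]⟩, hψY, fun φ hφ => ?_, fun φ hφ => ?_⟩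
  · rcases le_total φ (-φ₀) with h1 | h1
    · exact hneg φ h1 hφ.1
    · have := hmono ⟨h1, by linarith [hφ.2, hψ.2]⟩ ⟨hψ.1.le, hψ.2.le⟩ hφ.2
      simp only at this hψY
      linarith
  · rcases le_total φ₀ φ with h1 | h1
    · exact hhigh φ h1 hφ.2
    · have := hmono ⟨hψ.1.le, hψ.2.le⟩ ⟨by linarith [hφ.1, hψ.1], h1⟩ hφ.1
      simp only at this hψY
      linarith

end Contour

/-! ### From the distance to the eigenvalues to the sector |φ| ≤ π/n. -/

section Distance

variable {n : ℕ} {B : BoundaryConditions n} {Γ : Contour n} {c₁ c₂ δ : ℝ}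

/-- The distance condition for `0 ≤ φ ≤ 2 π / n` carries over to `|φ| ≤ π / n`. -/
theorem Contour.Tame.le_norm_pt_sub (h : Γ.Tame c₁ c₂) (hn : 2 ≤ n) (hc₂ : 0 < c₂)
    (hr : 2 * c₁ ≤ Γ.r 0)
    (hδ : ∀ l z, B.IsEigenvalue l → IsNthRoot n l z →
      ∀ φ ∈ Set.Icc (0 : ℝ) (2 * Real.pi / n), δ ≤ ‖Γ.pt φ - z‖)
    {z : ℂ} (hz : |z.arg| < Real.pi / n) (hl : B.IsEigenvalue (z ^ n)) {φ : ℝ}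
    (hφ : |φ| ≤ Real.pi / n) :
    δ / (2 * Real.pi * (c₂ + 1) + 1) ≤ ‖Γ.pt φ - z‖ := by
  have hn' : (2 : ℝ) ≤ n := by exact_mod_cast hn
  have hpi := Real.pi_pos
  have hpn : 0 < Real.pi / n := by positivity
  have hpn2 : Real.pi / n ≤ Real.pi / 2 := by gcongr
  have e2 : 2 * Real.pi / n = 2 * (Real.pi / n) := by ring
  have hn0 : n ≠ 0 := by omega
  have hz1 := abs_lt.1 hz
  have hφ1 := abs_le.1 hφ
  have hrho : ‖rho n‖ = 1 := (isPrimitiveRoot_rho hn0).norm'_eq_one hn0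
  set K := 2 * Real.pi * (c₂ + 1) with hK
  have hK0 : 0 < K := by positivity
  have hdir : ∀ {x : ℝ}, δ ≤ x → 0 ≤ x → δ / (K + 1) ≤ x := by
    intro x h1 h2
    rw [div_le_iff₀ (by positivity)]
    nlinarith
  -- If the contour point and the root lie on opposite sides of the real axis, the hypothesis does
  -- not compare them directly. It bounds the distance of z from the point with argument 0, and
  -- reaching that point costs at most K|Im| ≤ K times the distance in question.
  have hpass : δ ≤ ‖Γ.pt 0 - z‖ → |(Γ.pt φ).im| ≤ ‖Γ.pt φ - z‖ →
      δ / (K + 1) ≤ ‖Γ.pt φ - z‖ := by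
    intro h1 h2
    have h3 := h.norm_pt_zero_sub_le hc₂ hr (hφ.trans hpn2)
    have h4 := norm_sub_le_norm_sub_add_norm_sub (Γ.pt 0) (Γ.pt φ) z
    rw [norm_sub_rev (Γ.pt 0) (Γ.pt φ)] at h4
    have h5 : K * |(Γ.pt φ).im| ≤ K * ‖Γ.pt φ - z‖ := by gcongr
    rw [div_le_iff₀ (by positivity)]
    linarith
  have himz : z.im = ‖z‖ * Real.sin z.arg := by rw [Complex.norm_mul_sin_arg]
  have him : ∀ x : ℂ, |x.im - z.im| ≤ ‖x - z‖ := fun x => by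
    rw [← Complex.sub_im]; exact Complex.abs_im_le_norm _
  rcases le_or_gt 0 z.arg with h0 | h0
  · have hroot : IsNthRoot n (z ^ n) z :=
      ⟨rfl, ‖z‖, z.arg, norm_nonneg z, h0, by rw [e2]; linarith, (norm_mul_exp_arg z).symm⟩
    have hd := hδ _ _ hl hroot
    rcases le_or_gt 0 φ with h1 | h1
    · exact hdir (hd φ ⟨h1, by rw [e2]; linarith⟩) (norm_nonneg _)
    · refine hpass (hd 0 ⟨le_rfl, by positivity⟩) (le_trans ?_ (him _))
      have h2 : 0 ≤ z.im := by
        rw [himz]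
        exact mul_nonneg (norm_nonneg z)
          (Real.sin_nonneg_of_nonneg_of_le_pi h0 (by linarith))
      have h3 : (Γ.pt φ).im ≤ 0 := by
        rw [Γ.pt_im]
        exact mul_nonpos_of_nonneg_of_nonpos (Γ.pos φ).le
          (Real.sin_nonpos_of_nonpos_of_neg_pi_le h1.le (by linarith))
      rw [abs_of_nonpos h3, abs_of_nonpos (by linarith)]
      linarith
  -- For negative argument, the root with argument in [0, 2π/n) is ρz; rotating back gives the
  -- estimate on the arc of nonpositive arguments.
  · have hroot : IsNthRoot n (z ^ n) (rho n * z) := by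
      refine ⟨by rw [mul_pow, rho_pow_self hn0, one_mul], ‖z‖, z.arg + 2 * Real.pi / n,
        norm_nonneg z, by rw [e2]; linarith, by linarith, ?_⟩
      conv_lhs => rw [← norm_mul_exp_arg z]
      unfold rho
      rw [mul_left_comm, ← Complex.exp_add]
      congr 2
      push_cast
      ring
    have hd : ∀ φ' ∈ Set.Icc (-(Real.pi / n)) (Real.pi / n), φ' ≤ 0 → δ ≤ ‖Γ.pt φ' - z‖ := by
      intro φ' h1 h2
      have h3 := hδ _ _ hl hroot (φ' + 2 * Real.pi / n)
        ⟨by rw [e2]; linarith [h1.1], by linarith⟩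
      rwa [Γ.pt_add_period, ← mul_sub, norm_mul, hrho, one_mul] at h3
    rcases le_or_gt φ 0 with h1 | h1
    · exact hdir (hd φ ⟨hφ1.1, hφ1.2⟩ h1) (norm_nonneg _)
    · refine hpass (hd 0 ⟨by linarith, hpn.le⟩ le_rfl) (le_trans ?_ (him _))
      have h2 : z.im ≤ 0 := by
        rw [himz]
        exact mul_nonpos_of_nonneg_of_nonpos (norm_nonneg z)
          (Real.sin_nonpos_of_nonpos_of_neg_pi_le h0.le (by linarith))
      have h3 : 0 ≤ (Γ.pt φ).im := by
        rw [Γ.pt_im]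
        exact mul_nonneg (Γ.pos φ).le (Real.sin_nonneg_of_nonneg_of_le_pi h1.le (by linarith))
      rw [abs_of_nonneg h3, abs_of_nonneg (by linarith)]
      linarith

end Distance

/-! ### Replacing the integrand by its limit under the integral. -/

section ExpIntegral

theorem integral_exp_neg_le {c P : ℝ} (hc : 0 < c) :
    ∫ φ in (0 : ℝ)..P, Real.exp (-(c * φ)) ≤ 1 / c := by
  have hd : ∀ φ : ℝ, HasDerivAt (fun φ => -(Real.exp (-(c * φ)) / c)) (Real.exp (-(c * φ))) φ := by
    intro φ
    have h1 : HasDerivAt (fun φ : ℝ => -(c * φ)) (-c) φ := by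
      simpa using ((hasDerivAt_id φ).const_mul c).fun_neg
    have h2 := (h1.exp.div_const c).fun_neg
    rwa [show -(Real.exp (-(c * φ)) * -c / c) = Real.exp (-(c * φ)) by field_simp] at h2
  rw [intervalIntegral.integral_eq_sub_of_hasDerivAt (fun φ _ => hd φ)
    (Continuous.intervalIntegrable (by fun_prop) _ _)]
  have := div_nonneg (Real.exp_pos (-(c * P))).le hc.le
  simp only [mul_zero, neg_zero, Real.exp_zero]
  linarith

/-- When applied, both A and c are proportional to the radius of the contour, so the bound A/c does
not grow with its length. -/
theorem norm_integral_sub_le {f g : ℝ → ℂ} {P c A : ℝ} (hP : 0 ≤ P) (hc : 0 < c) (hA : 0 ≤ A)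
    (hf : IntervalIntegrable f MeasureTheory.volume 0 P)
    (hg : IntervalIntegrable g MeasureTheory.volume 0 P)
    (h : ∀ φ ∈ Set.Icc 0 P, ‖f φ - g φ‖ ≤ A * Real.exp (-(c * |φ|))) :
    ‖(∫ φ in (0 : ℝ)..P, f φ) - ∫ φ in (0 : ℝ)..P, g φ‖ ≤ A / c := by
  rw [← intervalIntegral.integral_sub hf hg]
  have h1 := intervalIntegral.norm_integral_le_of_norm_le (μ := MeasureTheory.volume)
    (f := fun φ => f φ - g φ) (g := fun φ => A * Real.exp (-(c * φ))) hP
    (Eventually.of_forall fun φ hφ => by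
      have := h φ ⟨hφ.1.le, hφ.2⟩
      rwa [abs_of_pos hφ.1] at this)
    (Continuous.intervalIntegrable (by fun_prop) _ _)
  refine h1.trans ?_
  rw [intervalIntegral.integral_const_mul, div_eq_mul_one_div]
  exact mul_le_mul_of_nonneg_left (integral_exp_neg_le hc) hA

theorem norm_integral_sub_le' {f g : ℝ → ℂ} {P c A : ℝ} (hP : 0 ≤ P) (hc : 0 < c) (hA : 0 ≤ A)
    (hf : IntervalIntegrable f MeasureTheory.volume (-P) 0)
    (hg : IntervalIntegrable g MeasureTheory.volume (-P) 0)
    (h : ∀ φ ∈ Set.Icc (-P) 0, ‖f φ - g φ‖ ≤ A * Real.exp (-(c * |φ|))) :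
    ‖(∫ φ in (-P)..0, f φ) - ∫ φ in (-P)..0, g φ‖ ≤ A / c := by
  have e : ∀ f : ℝ → ℂ, ∫ φ in (-P)..0, f φ = ∫ φ in (0 : ℝ)..P, f (-φ) := fun f => by
    rw [intervalIntegral.integral_comp_neg, neg_zero]
  rw [e f, e g]
  have hi : ∀ {f : ℝ → ℂ}, IntervalIntegrable f MeasureTheory.volume (-P) 0 →
      IntervalIntegrable (fun φ => f (-φ)) MeasureTheory.volume 0 P := fun hf => by
    have := (IntervalIntegrable.iff_comp_neg).1 hf.symm
    simpa using this
  refine norm_integral_sub_le hP hc hA (hi hf) (hi hg) fun φ hφ => ?_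
  have := h (-φ) ⟨by linarith [hφ.2], by linarith [hφ.1]⟩
  rwa [abs_neg] at this

end ExpIntegral

namespace BoundaryConditions

variable {n : ℕ} {B : BoundaryConditions n} {ω : Fin 2 → ℂ}

section Continuity

theorem continuousAt_detCols {n : ℕ} {W : ℂ → ℕ → Fin n → ℂ} {z : ℂ}
    (h : ∀ m < n, ContinuousAt (fun z => W z m) z) : ContinuousAt (fun z => detCols (W z)) z :=
  tendsto_detCols h

theorem continuousAt_update {n : ℕ} {W : ℂ → ℕ → Fin n → ℂ} {v : ℂ → Fin n → ℂ} {z : ℂ} (i : ℕ)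
    (hW : ∀ m < n, ContinuousAt (fun z => W z m) z) (hv : ContinuousAt v z) :
    ∀ m < n, ContinuousAt (fun z => Function.update (W z) i (v z) m) z := by
  intro m hm
  by_cases h : m = i
  · subst h; simpa using hv
  · simpa [h] using hW m hm

variable (B)

theorem continuousAt_colP {z : ℂ} (hz : z ≠ 0) (m : ℕ) : ContinuousAt (fun z => B.colP z m) z := by
  refine continuousAt_pi.2 fun j => ?_
  unfold colP
  refine ContinuousAt.div ?_ (by fun_prop) (pow_ne_zero _ (mul_ne_zero Complex.I_ne_zero hz))
  exact ((B.P j).continuous.comp (f := fun z => Complex.I * z * rho n ^ m)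
    (by fun_prop)).continuousAt

theorem continuousAt_colQ {z : ℂ} (hz : z ≠ 0) (m : ℕ) : ContinuousAt (fun z => B.colQ z m) z := by
  refine continuousAt_pi.2 fun j => ?_
  unfold colQ
  refine ContinuousAt.div ?_ (by fun_prop) (pow_ne_zero _ (mul_ne_zero Complex.I_ne_zero hz))
  exact ((B.Q j).continuous.comp (f := fun z => Complex.I * z * rho n ^ m)
    (by fun_prop)).continuousAt

theorem continuousAt_truncCols {s : ℂ → ℂ} (hs : Continuous s) {z : ℂ} (hz : z ≠ 0) (i₁ i₂ m : ℕ) :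
    ContinuousAt (fun z => truncCols (B.colP z) (B.colQ z) (s z) i₁ i₂ m) z := by
  have hP := B.continuousAt_colP hz m
  have hQ := B.continuousAt_colQ hz m
  unfold truncCols
  split_ifs
  · exact hP.add (hs.continuousAt.smul hQ)
  · exact (hs.continuousAt.smul hP).add hQ
  · exact hP
  · exact hQ

theorem continuousAt_integrand {W : ℂ → ℕ → Fin n → ℂ} {z : ℂ} (hz : z ≠ 0)
    (hW : ∀ m < n, ContinuousAt (fun z => W z m) z) (hdet : detCols (W z) ≠ 0) :
    ContinuousAt (fun z => B.integrand (W z) z) z := by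
  have hD := continuousAt_detCols hW
  have h2 : ∀ {u v : ℂ → Fin n → ℂ} (i i' : ℕ), ContinuousAt u z → ContinuousAt v z →
      ContinuousAt (fun z => detCols (Function.update (Function.update (W z) i (u z)) i' (v z))) z :=
    fun i i' hu hv => continuousAt_detCols (continuousAt_update i' (continuousAt_update i hW hu) hv)
  unfold integrand hatDelta1k hatDeltak1 hatDeltakn hatDeltank
  refine ContinuousAt.add (ContinuousAt.add (ContinuousAt.add ?_ ?_) ?_) ?_
  all_goals
    refine ContinuousAt.mul (by fun_prop) (ContinuousAt.div (h2 _ _ ?_ ?_) hD hdet)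
  all_goals first | exact B.continuousAt_colP hz _ | exact B.continuousAt_colQ hz _

theorem continuousAt_limitTerm {z : ℂ}
    (hp : B.birkhoff.eval (Complex.exp (Complex.I * z)) ≠ 0) : ContinuousAt B.limitTerm z := by
  unfold limitTerm
  exact ContinuousAt.div (by fun_prop) (by fun_prop) hp

end Continuity

theorem exp_neg_abs_im_le {z : ℂ} {b : ℝ} (hb : b ≤ 1 / 2) (hz : |z.arg| ≤ Real.pi / 2) :
    Real.exp (-|z.im|) ≤ Real.exp (-(b * ‖z‖ * |z.arg|)) := by
  rw [Real.exp_le_exp, neg_le_neg_iff]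
  have h1 := Real.mul_abs_le_abs_sin hz
  have h2 : (1 : ℝ) / 2 ≤ 2 / Real.pi := by
    rw [div_le_div_iff₀ two_pos Real.pi_pos]; linarith [Real.pi_le_four]
  rw [← Complex.norm_mul_sin_arg z, abs_mul, abs_norm, mul_comm b, mul_assoc]
  refine mul_le_mul_of_nonneg_left (le_trans ?_ h1) (norm_nonneg z)
  exact mul_le_mul_of_nonneg_right (hb.trans h2) (abs_nonneg _)

theorem eventually_mul_exp_le {K s ε : ℝ} (hs : 0 < s) (hε : 0 < ε) :
    ∀ᶠ z in Bornology.cobounded ℂ, K * Real.exp (-(s * ‖z‖)) ≤ ε * Real.exp (-(s / 2 * ‖z‖)) := by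
  have h1 : Tendsto (fun z : ℂ => K * Real.exp (-(s / 2 * ‖z‖))) (Bornology.cobounded ℂ)
      (𝓝 (K * 0)) :=
    (Real.tendsto_exp_neg_atTop_nhds_zero.comp
      (tendsto_norm_cobounded_atTop.const_mul_atTop (half_pos hs))).const_mul K
  rw [mul_zero] at h1
  filter_upwards [h1.eventually_le_const hε] with z hz
  have e : Real.exp (-(s * ‖z‖)) = Real.exp (-(s / 2 * ‖z‖)) * Real.exp (-(s / 2 * ‖z‖)) := by
    rw [← Real.exp_add]; congr 1; ring
  rw [e, ← mul_assoc]
  exact mul_le_mul_of_nonneg_right hz (Real.exp_pos _).le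

/-- One majorant serves two errors. That of the main term decays like e^{-|Im z|} with |Im z| ≥
(2/π)|z||Arg z|; the neglected exponential is at most e^{-|z| sin(π/n)}, half of whose exponent
absorbs the constant and the other half suffices because |Arg z| ≤ 1. -/
theorem HasRootLogs.eventually_norm_integrand₁_sub_le (hω : B.HasRootLogs ω) (hn : Even n)
    (h4 : 4 ≤ n) {δ : ℝ} (hδ : 0 < δ) {ε : ℝ} (hε : 0 < ε) :
    ∀ᶠ z in Bornology.cobounded ℂ, (∀ a, Away (ω a) δ z) → 0 ≤ z.arg → z.arg ≤ Real.pi / n →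
      ‖B.integrand (B.cols₁ z) z - B.limitTerm z‖
        ≤ ε * Real.exp (-(Real.sin (Real.pi / n) / 2 * ‖z‖ * |z.arg|)) := by
  obtain ⟨K, hK, hquot⟩ := hω.exists_norm_quotient₁_le h4 hδ
  have hs := sin_pi_div_pos (by omega : 2 ≤ n)
  have hs1 := Real.sin_le_one (Real.pi / n)
  have hn4 : (4 : ℝ) ≤ n := by exact_mod_cast h4
  have hpi := Real.pi_pos
  have hpn : Real.pi / n ≤ Real.pi / 4 := by gcongr
  filter_upwards [hquot, hω.eventually_norm_mainTerm_sub_le (by omega) hδ (half_pos hε),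
    eventually_mul_exp_le (K := K) hs (half_pos hε)] with z h1 h2 h3 hz ha0 ha1
  have hrho : ‖rho n‖ = 1 := (isPrimitiveRoot_rho (by omega)).norm'_eq_one (by omega)
  have him : 0 ≤ z.im := by
    rw [← Complex.norm_mul_sin_arg z]
    exact mul_nonneg (norm_nonneg z) (Real.sin_nonneg_of_nonneg_of_le_pi ha0 (by linarith))
  have hE : ‖Complex.exp (Complex.I * z * rho n ^ (n / 2 - 1))‖
      ≤ Real.exp (-(Real.sin (Real.pi / n) * ‖z‖)) := by
    have hm : 2 * (((n / 2 - 1 : ℕ) : ℝ)) = n - 2 := by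
      have : 2 * (n / 2 - 1) + 2 = n := by have := Nat.even_iff.1 hn; omega
      have : (2 : ℝ) * ((n / 2 - 1 : ℕ) : ℝ) + 2 = n := by exact_mod_cast this
      linarith
    have e : 2 * Real.pi / n * ((n / 2 - 1 : ℕ) : ℝ) = Real.pi - 2 * (Real.pi / n) := by
      rw [show 2 * Real.pi / n * ((n / 2 - 1 : ℕ) : ℝ)
        = Real.pi / n * (2 * ((n / 2 - 1 : ℕ) : ℝ)) by ring, hm]
      field_simp
    exact norm_exp_charExp_le (by omega) (by rw [e]; linarith) (by rw [e]; linarith)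
  have habs : |z.arg| ≤ 1 := by rw [abs_of_nonneg ha0]; linarith [Real.pi_le_four]
  have hexp : Real.exp (-(Real.sin (Real.pi / n) / 2 * ‖z‖))
      ≤ Real.exp (-(Real.sin (Real.pi / n) / 2 * ‖z‖ * |z.arg|)) := by
    rw [Real.exp_le_exp, neg_le_neg_iff]
    exact mul_le_of_le_one_right (by positivity) habs
  have hmain := exp_neg_abs_im_le (z := z) (b := Real.sin (Real.pi / n) / 2) (by linarith)
    (by rw [abs_of_nonneg ha0]; linarith)
  rw [B.integrand_cols₁ hn h4, add_sub_right_comm]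
  refine (norm_add_le _ _).trans ?_
  have b1 := h2 hz
  have b2 : ‖rho n ^ (n / 2 - 1) * Complex.exp (Complex.I * z * rho n ^ (n / 2 - 1)) *
        ((B.hatDeltakn (B.cols₁ z) z - B.hatDeltank (B.cols₁ z) z) / detCols (B.cols₁ z))‖
        ≤ Real.exp (-(Real.sin (Real.pi / n) * ‖z‖)) * K := by
    rw [norm_mul, norm_mul, norm_pow, hrho, one_pow, one_mul]
    exact mul_le_mul hE (h1 hz him) (norm_nonneg _) (Real.exp_pos _).le
  rw [mul_comm _ K] at b2
  have c1 := mul_le_mul_of_nonneg_left hmain (half_pos hε).le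
  have c2 := mul_le_mul_of_nonneg_left hexp (half_pos hε).le
  linarith

theorem HasRootLogs.eventually_norm_integrand₂_sub_le (hω : B.HasRootLogs ω) (hn : Even n)
    (h4 : 4 ≤ n) {δ : ℝ} (hδ : 0 < δ) {ε : ℝ} (hε : 0 < ε) :
    ∀ᶠ z in Bornology.cobounded ℂ, (∀ a, Away (ω a) δ z) → -(Real.pi / n) ≤ z.arg → z.arg ≤ 0 →
      ‖B.integrand (B.cols₂ (rho n * z)) (rho n * z) * rho n - B.limitTerm z‖
        ≤ ε * Real.exp (-(Real.sin (Real.pi / n) / 2 * ‖z‖ * |z.arg|)) := by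
  obtain ⟨K, hK, hquot⟩ := hω.exists_norm_quotient₂_le hn h4 hδ
  have hs := sin_pi_div_pos (by omega : 2 ≤ n)
  have hs1 := Real.sin_le_one (Real.pi / n)
  have hn4 : (4 : ℝ) ≤ n := by exact_mod_cast h4
  have hpi := Real.pi_pos
  have hpn : Real.pi / n ≤ Real.pi / 4 := by gcongr
  filter_upwards [hquot, hω.eventually_norm_mainTerm_sub_le (by omega) hδ (half_pos hε),
    eventually_mul_exp_le (K := K) hs (half_pos hε)] with z h1 h2 h3 hz ha0 ha1
  have hrho : ‖rho n‖ = 1 := (isPrimitiveRoot_rho (by omega)).norm'_eq_one (by omega)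
  have him : z.im ≤ 0 := by
    rw [← Complex.norm_mul_sin_arg z]
    exact mul_nonpos_of_nonneg_of_nonpos (norm_nonneg z)
      (Real.sin_nonpos_of_nonpos_of_neg_pi_le ha1 (by linarith))
  have hE : ‖Complex.exp (Complex.I * (rho n * z))‖
      ≤ Real.exp (-(Real.sin (Real.pi / n) * ‖z‖)) := by
    have e : 2 * Real.pi / n * ((1 : ℕ) : ℝ) = 2 * (Real.pi / n) := by
      rw [Nat.cast_one]; ring
    rw [show Complex.I * (rho n * z) = charExp n z 1 by unfold charExp; ring]
    exact norm_exp_charExp_le (by omega) (by rw [e]; linarith) (by rw [e]; linarith)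
  have habs : |z.arg| ≤ 1 := by rw [abs_of_nonpos ha1]; linarith [Real.pi_le_four]
  have hexp : Real.exp (-(Real.sin (Real.pi / n) / 2 * ‖z‖))
      ≤ Real.exp (-(Real.sin (Real.pi / n) / 2 * ‖z‖ * |z.arg|)) := by
    rw [Real.exp_le_exp, neg_le_neg_iff]
    exact mul_le_of_le_one_right (by positivity) habs
  have hmain := exp_neg_abs_im_le (z := z) (b := Real.sin (Real.pi / n) / 2) (by linarith)
    (by rw [abs_of_nonpos ha1]; linarith)
  rw [B.integrand_cols₂_rho hn h4, add_sub_right_comm]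
  refine (norm_add_le _ _).trans ?_
  have b1 := h2 hz
  have b2 : ‖rho n * Complex.exp (Complex.I * (rho n * z)) *
        ((B.hatDelta1k (B.cols₂ (rho n * z)) (rho n * z)
          - B.hatDeltak1 (B.cols₂ (rho n * z)) (rho n * z)) / detCols (B.cols₂ (rho n * z)))‖
        ≤ Real.exp (-(Real.sin (Real.pi / n) * ‖z‖)) * K := by
    rw [norm_mul, norm_mul, hrho, one_mul]
    exact mul_le_mul hE (h1 hz him) (norm_nonneg _) (Real.exp_pos _).le
  rw [mul_comm _ K] at b2
  have c1 := mul_le_mul_of_nonneg_left hmain (half_pos hε).le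
  have c2 := mul_le_mul_of_nonneg_left hexp (half_pos hε).le
  linarith

end BoundaryConditions

variable {n : ℕ} {B : BoundaryConditions n} {ω : Fin 2 → ℂ} {Γ : ℕ → Contour n} {c₁ c₂ : ℝ}

theorem Acceptable.exists_tame (h : Acceptable B Γ) :
    ∃ c₁ > 0, ∃ c₂ > 0, ∀ ℓ, (Γ ℓ).Tame c₁ c₂ := by
  obtain ⟨-, ⟨c₁, h1, h1'⟩, ⟨c₂, h2, h2'⟩, -⟩ := h
  exact ⟨c₁, h1, c₂, h2, fun ℓ => ⟨h1' ℓ, h2' ℓ⟩⟩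

theorem eventually_forall_pt (hT : ∀ ℓ, (Γ ℓ).Tame c₁ c₂)
    (hr : Tendsto (fun ℓ => (Γ ℓ).r 0) atTop atTop) {Q : ℂ → Prop}
    (hQ : ∀ᶠ z in Bornology.cobounded ℂ, Q z) : ∀ᶠ ℓ in atTop, ∀ φ, Q ((Γ ℓ).pt φ) := by
  rw [← comap_norm_atTop, eventually_comap] at hQ
  obtain ⟨R, hR⟩ := eventually_atTop.1 hQ
  filter_upwards [hr.eventually_ge_atTop (R + c₁)] with ℓ hℓ φ
  refine hR _ ?_ _ rfl
  rw [Contour.norm_pt]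
  linarith [(hT ℓ).le_r φ]

/-- The contours keep a positive distance from the two lattices. -/
theorem BoundaryConditions.HasRootLogs.exists_away (hω : B.HasRootLogs ω) (hn : Even n)
    (h4 : 4 ≤ n) (hΓ : Acceptable B Γ) :
    ∃ δ > 0, ∀ᶠ ℓ in atTop, ∀ φ, |φ| ≤ Real.pi / n → ∀ a, Away (ω a) δ ((Γ ℓ).pt φ) := by
  obtain ⟨c₁, hc₁, c₂, hc₂, hT⟩ := hΓ.exists_tame
  obtain ⟨hr, -, -, δ, hδ, hdist⟩ := hΓ
  have hpi := Real.pi_pos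
  have hn4 : (4 : ℝ) ≤ n := by exact_mod_cast h4
  have hpn : Real.pi / n ≤ Real.pi / 4 := by gcongr
  set δ' := δ / (2 * Real.pi * (c₂ + 1) + 1) with hδ'
  have hδ'0 : 0 < δ' := by positivity
  refine ⟨δ' / 2, by positivity, ?_⟩
  have hcos : ∀ φ : ℝ, |φ| ≤ Real.pi / n → 1 / 2 ≤ Real.cos φ := by
    intro φ hφ
    rw [← Real.cos_abs, ← Real.cos_pi_div_three]
    exact Real.cos_le_cos_of_nonneg_of_le_pi (abs_nonneg φ) (by linarith) (by linarith)
  have hone : ∀ a, ∀ᶠ ℓ in atTop, ∀ φ, |φ| ≤ Real.pi / n → Away (ω a) (δ' / 2) ((Γ ℓ).pt φ) := by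
    intro a
    obtain ⟨X, hX0, hX⟩ := exists_forall_abs_arg_lt (by omega : 2 ≤ n) (|(ω a).im| + δ' / 2)
    have hre : Tendsto (fun j : ℤ => (ω a).re + 2 * Real.pi * (j : ℝ)) atTop atTop :=
      tendsto_atTop_add_const_left _ _
        (tendsto_intCast_atTop_atTop.const_mul_atTop (by positivity))
    obtain ⟨j₀, hj₀⟩ := eventually_atTop.1
      ((hω.eventually_exists_isEigenvalue hn h4 a (half_pos hδ'0)).and
        (hre.eventually_ge_atTop (X + δ' / 2)))
    filter_upwards [hr.eventually_ge_atTop (2 * c₁),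
      hr.eventually_ge_atTop (c₁ + 2 * |(ω a).re + 2 * Real.pi * j₀ + δ' / 2|)]
      with ℓ h1 h2 φ hφ j
    -- A remote lattice point has an eigenvalue root within δ'/2, from which the contour keeps the
    -- distance δ'. The remaining lattice points lie to the left of a fixed line that the contour
    -- eventually leaves behind.
    rcases le_or_gt j₀ j with hj | hj
    · obtain ⟨⟨z, hz, hl⟩, hjX⟩ := hj₀ j hj
      have hzre := (Complex.abs_re_le_norm (z - latticePt (ω a) j)).trans hz.le
      have hzim := (Complex.abs_im_le_norm (z - latticePt (ω a) j)).trans hz.le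
      rw [Complex.sub_re, latticePt_re] at hzre
      rw [Complex.sub_im, latticePt_im] at hzim
      have harg := hX z (by linarith [(abs_le.1 hzre).1])
        (by linarith [abs_sub_abs_le_abs_sub z.im (ω a).im])
      have h3 := (hT ℓ).le_norm_pt_sub (by omega : 2 ≤ n) hc₂ h1 (hdist ℓ) harg hl hφ
      have h5 := norm_sub_le_norm_sub_add_norm_sub ((Γ ℓ).pt φ) (latticePt (ω a) j) z
      rw [norm_sub_rev (latticePt (ω a) j) z] at h5
      linarith
    · refine le_trans ?_ (Complex.re_le_norm _)
      have h3 : ((j : ℤ) : ℝ) ≤ j₀ := by exact_mod_cast hj.le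
      have h5 : 2 * Real.pi * (j : ℝ) ≤ 2 * Real.pi * j₀ := by gcongr
      rw [Complex.sub_re, latticePt_re, Contour.pt_re]
      have h6 := (hT ℓ).le_r φ
      have h7 := mul_le_mul_of_nonneg_left (hcos φ hφ) ((Γ ℓ).pos φ).le
      have := le_abs_self ((ω a).re + 2 * Real.pi * j₀ + δ' / 2)
      linarith
  filter_upwards [eventually_all.2 hone] with ℓ h φ hφ a using h a φ hφ

/-- Up to `o(1)`, the integrand may be replaced by its limit. -/
theorem BoundaryConditions.HasRootLogs.tendsto_integral_sub (hω : B.HasRootLogs ω) (hn : Even n)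
    (h4 : 4 ≤ n) (hΓ : Acceptable B Γ) :
    Tendsto (fun ℓ => (Γ ℓ).integral B - ∫ φ in (-(Real.pi / n))..(Real.pi / n),
      B.limitTerm ((Γ ℓ).pt φ) * deriv (Γ ℓ).pt φ) atTop (𝓝 0) := by
  obtain ⟨δ, hδ, haway⟩ := hω.exists_away hn h4 hΓ
  obtain ⟨c₁, hc₁, c₂, hc₂, hT⟩ := hΓ.exists_tame
  have hr := hΓ.1
  have hs := sin_pi_div_pos (by omega : 2 ≤ n)
  have hn4 : (4 : ℝ) ≤ n := by exact_mod_cast h4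
  have hpi := Real.pi_pos
  have hpn0 : 0 < Real.pi / n := by positivity
  have hpn : Real.pi / n ≤ Real.pi / 4 := by gcongr
  set b := Real.sin (Real.pi / n) / 2 with hb
  have hb0 : 0 < b := half_pos hs
  obtain ⟨c, hc, hbirk⟩ := hω.exists_mul_le_norm_birkhoff hδ
  obtain ⟨c', hc', hdet⟩ := hω.exists_mul_le_norm_detCols (by omega) hδ
  rw [Metric.tendsto_nhds]
  intro ε' hε'
  -- Makes each half of the contour contribute at most ε'/8, see `eA`; the radius R cancels.
  set ε := ε' * b / (4 * (c₂ + 1) * 4) with hε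
  have hε0 : 0 < ε := by positivity
  filter_upwards [haway, hr.eventually_gt_atTop (3 * c₁), eventually_forall_pt hT hr hdet,
    eventually_forall_pt hT hr (hω.eventually_norm_integrand₁_sub_le hn h4 hδ hε0),
    eventually_forall_pt hT hr (hω.eventually_norm_integrand₂_sub_le hn h4 hδ hε0)]
    with ℓ h1 h2 h3 h5 h6
  set G := Γ ℓ with hG
  set R := G.r 0 - c₁ with hR
  have hR0 : 0 < R := by linarith
  have hrle : ∀ φ, G.r φ ≤ 2 * R := fun φ => by linarith [(hT ℓ).r_le φ]
  have hrge : ∀ φ, R ≤ G.r φ := fun φ => (hT ℓ).le_r φ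
  have harg : ∀ φ, |φ| ≤ Real.pi / n → (G.pt φ).arg = φ := fun φ hφ => by
    have := abs_le.1 hφ
    exact G.arg_pt (by linarith) (by linarith)
  have hpne : ∀ φ, |φ| ≤ Real.pi / n →
      B.birkhoff.eval (Complex.exp (Complex.I * G.pt φ)) ≠ 0 := fun φ hφ =>
    norm_pos_iff.1 (lt_of_lt_of_le (by positivity) (hbirk _ (h1 φ hφ)))
  have hdne : ∀ φ, |φ| ≤ Real.pi / n → detCols (B.cols₁ (G.pt φ)) ≠ 0 := fun φ hφ =>
    norm_pos_iff.1 (lt_of_lt_of_le (by positivity) (h3 φ (h1 φ hφ)))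
  have hd2ne : ∀ φ, |φ| ≤ Real.pi / n → detCols (B.cols₂ (rho n * G.pt φ)) ≠ 0 := fun φ hφ => by
    rw [B.detCols_cols₂_rho hn h4]
    refine mul_ne_zero (neg_ne_zero.2 (inv_ne_zero (pow_ne_zero _ rho_ne_zero)))
      (mul_ne_zero (pow_ne_zero _ (Complex.exp_ne_zero _)) (hdne φ hφ))
  set f₁ : ℝ → ℂ := fun φ => B.integrand (B.cols₁ (G.pt φ)) (G.pt φ) * deriv G.pt φ with hf₁
  set f₂ : ℝ → ℂ := fun φ => B.integrand (B.cols₂ (rho n * G.pt φ)) (rho n * G.pt φ) * rho n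
    * deriv G.pt φ with hf₂
  set g : ℝ → ℂ := fun φ => B.limitTerm (G.pt φ) * deriv G.pt φ with hg
  have cont1 : ∀ φ, |φ| ≤ Real.pi / n → ContinuousAt f₁ φ := fun φ hφ => by
    refine ContinuousAt.mul (ContinuousAt.comp (f := G.pt)
      (g := fun z => B.integrand (B.cols₁ z) z) ?_ G.continuous_pt.continuousAt)
      G.continuous_deriv_pt.continuousAt
    exact B.continuousAt_integrand (G.pt_ne_zero φ) (fun m _ => B.continuousAt_truncCols
      (s := fun z => Complex.exp (Complex.I * z)) (by fun_prop) (G.pt_ne_zero φ) _ _ _)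
      (hdne φ hφ)
  have cont2 : ∀ φ, |φ| ≤ Real.pi / n → ContinuousAt f₂ φ := fun φ hφ => by
    have hne : rho n * G.pt φ ≠ 0 := mul_ne_zero rho_ne_zero (G.pt_ne_zero φ)
    refine ContinuousAt.mul (ContinuousAt.mul (ContinuousAt.comp (f := fun φ => rho n * G.pt φ)
      (g := fun z => B.integrand (B.cols₂ z) z) ?_
      (continuous_const.mul G.continuous_pt).continuousAt) continuousAt_const)
      G.continuous_deriv_pt.continuousAt
    exact B.continuousAt_integrand hne (fun m _ => B.continuousAt_truncCols
      (s := fun z => Complex.exp (Complex.I * z * rho n ^ (n / 2 - 1))) (by fun_prop) hne _ _ _)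
      (hd2ne φ hφ)
  have cont3 : ∀ φ, |φ| ≤ Real.pi / n → ContinuousAt g φ := fun φ hφ =>
    ContinuousAt.mul (ContinuousAt.comp (f := G.pt) (g := B.limitTerm)
      (B.continuousAt_limitTerm (hpne φ hφ)) G.continuous_pt.continuousAt)
      G.continuous_deriv_pt.continuousAt
  have hint : ∀ {f : ℝ → ℂ} {u v : ℝ}, (∀ φ, |φ| ≤ Real.pi / n → ContinuousAt f φ) →
      |u| ≤ Real.pi / n → |v| ≤ Real.pi / n → IntervalIntegrable f MeasureTheory.volume u v := by
    intro f u v hf hu hv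
    refine ContinuousOn.intervalIntegrable fun φ hφ => (hf φ ?_).continuousWithinAt
    have hu' := abs_le.1 hu
    have hv' := abs_le.1 hv
    rcases Set.mem_uIcc.1 hφ with h | h
    · exact abs_le.2 ⟨by linarith [h.1], by linarith [h.2]⟩
    · exact abs_le.2 ⟨by linarith [h.1], by linarith [h.2]⟩
  have a0 : |(0 : ℝ)| ≤ Real.pi / n := by rw [abs_zero]; exact hpn0.le
  have aP : |Real.pi / n| ≤ Real.pi / n := by rw [abs_of_pos hpn0]
  have aN : |-(Real.pi / n)| ≤ Real.pi / n := by rw [abs_neg]; exact aP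
  have hI : G.integral B = (∫ φ in (0 : ℝ)..(Real.pi / n), f₁ φ)
      + ∫ φ in (-(Real.pi / n))..0, f₂ φ := by
    unfold Contour.integral
    congr 1
    have := intervalIntegral.integral_comp_add_right (a := -(Real.pi / n)) (b := 0)
      (fun φ => B.integrand (B.cols₂ (G.pt φ)) (G.pt φ) * deriv G.pt φ) (2 * Real.pi / n)
    rw [show -(Real.pi / n) + 2 * Real.pi / n = Real.pi / n by ring, zero_add] at this
    rw [← this]
    refine intervalIntegral.integral_congr fun φ _ => ?_
    simp only [hf₂]
    rw [G.pt_add_period, G.deriv_pt_add_period, mul_assoc]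
  have hexp : ∀ φ, Real.exp (-(b * G.r φ * |φ|)) ≤ Real.exp (-(b * R * |φ|)) := fun φ => by
    rw [Real.exp_le_exp, neg_le_neg_iff]
    have := hrge φ
    gcongr
  have hbd : ∀ φ x, ‖x‖ ≤ ε * Real.exp (-(b * G.r φ * |φ|)) →
      ‖x * deriv G.pt φ‖ ≤ ε * ((c₂ + 1) * (2 * R)) * Real.exp (-(b * R * |φ|)) := by
    intro φ x hx
    rw [norm_mul]
    have d1 := (hT ℓ).norm_deriv_pt_le φ
    have d2 : (c₂ + 1) * G.r φ ≤ (c₂ + 1) * (2 * R) := by have := hrle φ; gcongr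
    calc ‖x‖ * ‖deriv G.pt φ‖
        ≤ (ε * Real.exp (-(b * R * |φ|))) * ((c₂ + 1) * (2 * R)) :=
          mul_le_mul (hx.trans (mul_le_mul_of_nonneg_left (hexp φ) hε0.le)) (d1.trans d2)
            (norm_nonneg _) (by positivity)
      _ = _ := by ring
  have e1 := norm_integral_sub_le (f := f₁) (g := g) (P := Real.pi / n) (c := b * R)
    (A := ε * ((c₂ + 1) * (2 * R))) hpn0.le (by positivity) (by positivity)
    (hint cont1 a0 aP) (hint cont3 a0 aP) fun φ hφ => by
      have hφ' : |φ| ≤ Real.pi / n := by rw [abs_of_nonneg hφ.1]; exact hφ.2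
      have := h5 φ (h1 φ hφ') (by rw [harg φ hφ']; exact hφ.1) (by rw [harg φ hφ']; exact hφ.2)
      rw [harg φ hφ', G.norm_pt] at this
      rw [hf₁, hg, ← sub_mul]
      exact hbd φ _ this
  have e2 := norm_integral_sub_le' (f := f₂) (g := g) (P := Real.pi / n) (c := b * R)
    (A := ε * ((c₂ + 1) * (2 * R))) hpn0.le (by positivity) (by positivity)
    (hint cont2 aN a0) (hint cont3 aN a0) fun φ hφ => by
      have hφ' : |φ| ≤ Real.pi / n := by rw [abs_of_nonpos hφ.2]; linarith [hφ.1]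
      have := h6 φ (h1 φ hφ') (by rw [harg φ hφ']; exact hφ.1) (by rw [harg φ hφ']; exact hφ.2)
      rw [harg φ hφ', G.norm_pt] at this
      rw [hf₂, hg, ← sub_mul]
      exact hbd φ _ this
  have eA : ε * ((c₂ + 1) * (2 * R)) / (b * R) = ε' / 8 := by
    rw [hε]
    field_simp
    ring
  rw [eA] at e1 e2
  rw [dist_zero_right, hI, ← intervalIntegral.integral_add_adjacent_intervals
    (hint cont3 aN a0) (hint cont3 a0 aP)]
  have e3 : (∫ φ in (0 : ℝ)..(Real.pi / n), f₁ φ) + (∫ φ in (-(Real.pi / n))..0, f₂ φ)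
      - ((∫ φ in (-(Real.pi / n))..0, g φ) + ∫ φ in (0 : ℝ)..(Real.pi / n), g φ)
      = ((∫ φ in (0 : ℝ)..(Real.pi / n), f₁ φ) - ∫ φ in (0 : ℝ)..(Real.pi / n), g φ)
        + ((∫ φ in (-(Real.pi / n))..0, f₂ φ) - ∫ φ in (-(Real.pi / n))..0, g φ) := by ring
  rw [e3]
  refine (norm_add_le _ _).trans_lt ?_
  linarith

end BirkhoffTrace

namespace BirkhoffTrace

/-! ### The integral of d log(e^{iz} - e^{iω}) in closed form. -/

/-- From 1 - e^{iθ} = 2 sin(θ/2) e^{i(θ - π)/2}, where the sine is positive and the argument lies in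
(-π/2, π/2). -/
theorem log_one_sub_exp {θ : ℝ} (h0 : 0 < θ) (h1 : θ < 2 * Real.pi) :
    Complex.log (1 - Complex.exp (Complex.I * θ))
      = Real.log (2 * Real.sin (θ / 2)) + Complex.I * ((θ - Real.pi) / 2) := by
  have hs : 0 < 2 * Real.sin (θ / 2) :=
    mul_pos two_pos (Real.sin_pos_of_pos_of_lt_pi (by linarith) (by linarith))
  have e : 1 - Complex.exp (Complex.I * θ)
      = ((2 * Real.sin (θ / 2) : ℝ) : ℂ) * Complex.exp (((θ - Real.pi) / 2 : ℝ) * Complex.I) := by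
    have a1 : Complex.exp (Complex.I * θ)
        = Complex.exp ((θ / 2 : ℝ) * Complex.I) * Complex.exp ((θ / 2 : ℝ) * Complex.I) := by
      rw [← Complex.exp_add]; congr 1; push_cast; ring
    have a2 : Complex.exp (((θ - Real.pi) / 2 : ℝ) * Complex.I)
        = Complex.exp ((θ / 2 : ℝ) * Complex.I) * -Complex.I := by
      rw [← Complex.exp_neg_pi_div_two_mul_I, ← Complex.exp_add]; congr 1; push_cast; ring
    rw [a1, a2, Complex.exp_mul_I, ← Complex.ofReal_cos, ← Complex.ofReal_sin]
    have hcs : (Real.cos (θ / 2) : ℂ) ^ 2 + (Real.sin (θ / 2) : ℂ) ^ 2 = 1 := by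
      exact_mod_cast Real.cos_sq_add_sin_sq (θ / 2)
    push_cast
    push_cast at hcs
    linear_combination (-1 : ℂ) * hcs + (2 * Complex.sin (θ / 2) ^ 2
      - Complex.sin (θ / 2) ^ 2) * Complex.I_sq
  rw [e, Complex.log_ofReal_mul hs (Complex.exp_ne_zero _), Complex.log_exp]
  · push_cast; ring
  · simp; linarith [Real.pi_pos]
  · simp; linarith [Real.pi_pos]

/-- This is the mismatch of the two antiderivatives at the crossing point; it is the origin of the
summand π in the index formula. -/
theorem log_one_sub_exp_neg_sub {θ : ℝ} (h0 : 0 < θ) (h1 : θ < 2 * Real.pi) :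
    Complex.log (1 - Complex.exp (-(Complex.I * θ))) - Complex.log (1 - Complex.exp (Complex.I * θ))
      = -(Complex.I * (θ - Real.pi)) := by
  have h2 : Complex.exp (-(Complex.I * θ))
      = Complex.exp (Complex.I * ((2 * Real.pi - θ : ℝ) : ℂ)) := by
    rw [Complex.exp_eq_exp_iff_exists_int]
    exact ⟨-1, by push_cast; ring⟩
  rw [h2, log_one_sub_exp h0 h1, log_one_sub_exp (by linarith) (by linarith)]
  rw [show (2 * Real.pi - θ) / 2 = Real.pi - θ / 2 by ring, Real.sin_pi_sub]
  push_cast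
  ring

theorem one_sub_mem_slitPlane {u : ℂ} (h : ‖u‖ ≤ 1) (h1 : u ≠ 1) : 1 - u ∈ Complex.slitPlane := by
  left
  have h2 := (Complex.re_le_norm u).trans h
  rcases h2.lt_or_eq with h3 | h3
  · simpa using h3
  · exfalso
    apply h1
    have h4 := Complex.sq_norm u
    rw [Complex.normSq_apply, h3] at h4
    have h5 : u.im * u.im = 0 := by nlinarith [norm_nonneg u, mul_self_nonneg u.im]
    exact Complex.ext h3 (by simpa using h5)

/-- The integral of `d log (e^{iz} - e^{iω})` along a contour, in terms of the number of
lattice points to the left of the contour. -/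
theorem Contour.integral_dlog {n : ℕ} (G : Contour n) {ω : ℂ} {P ψ : ℝ} (hψ : ψ ∈ Set.Ioo (-P) P)
    (hY : (G.pt ψ).im = ω.im) (hl : ∀ φ ∈ Set.Ico (-P) ψ, (G.pt φ).im < ω.im)
    (hu : ∀ φ ∈ Set.Ioc ψ P, ω.im < (G.pt φ).im)
    (hne : ∀ φ ∈ Set.Icc (-P) P, Complex.exp (Complex.I * G.pt φ) ≠ Complex.exp (Complex.I * ω)) :
    ∫ φ in (-P)..P, Complex.I * Complex.exp (Complex.I * G.pt φ) /
        (Complex.exp (Complex.I * G.pt φ) - Complex.exp (Complex.I * ω)) * deriv G.pt φ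
      = Complex.I * (ω + 2 * Real.pi * ⌊((G.pt ψ).re - ω.re) / (2 * Real.pi)⌋ + Real.pi)
        - Complex.I * G.pt (-P)
        + (Complex.log (1 - Complex.exp (Complex.I * (G.pt P - ω)))
          - Complex.log (1 - Complex.exp (-(Complex.I * (G.pt (-P) - ω))))) := by
  -- Above the level Im ω one has |u| < 1 and log(1 - u) is an antiderivative. Below it v = 1/u is
  -- small and iz + log(1 - v) is one. Splitting at the crossing point ψ keeps both logarithms on
  -- their principal branch.
  set u : ℝ → ℂ := fun φ => Complex.exp (Complex.I * (G.pt φ - ω)) with hu_def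
  set v : ℝ → ℂ := fun φ => Complex.exp (-(Complex.I * (G.pt φ - ω))) with hv_def
  set g : ℝ → ℂ := fun φ => Complex.I * Complex.exp (Complex.I * G.pt φ) /
        (Complex.exp (Complex.I * G.pt φ) - Complex.exp (Complex.I * ω)) * deriv G.pt φ with hg
  have huv : ∀ φ, u φ * v φ = 1 := fun φ => by
    simp only [hu_def, hv_def]; rw [← Complex.exp_add]; simp
  have hu1 : ∀ φ ∈ Set.Icc (-P) P, u φ ≠ 1 := by
    intro φ hφ h1
    apply hne φ hφ
    have h2 : Complex.exp (Complex.I * G.pt φ) = u φ * Complex.exp (Complex.I * ω) := by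
      simp only [hu_def]; rw [← Complex.exp_add]; congr 1; ring
    rw [h2, h1, one_mul]
  have hv1 : ∀ φ ∈ Set.Icc (-P) P, v φ ≠ 1 := by
    intro φ hφ h1
    apply hu1 φ hφ
    have := huv φ
    rwa [h1, mul_one] at this
  have hgu : ∀ φ, g φ = Complex.I * u φ / (u φ - 1) * deriv G.pt φ := by
    intro φ
    have h2 : Complex.exp (Complex.I * G.pt φ) = u φ * Complex.exp (Complex.I * ω) := by
      simp only [hu_def]; rw [← Complex.exp_add]; congr 1; ring
    simp only [hg]
    rw [h2, ← sub_one_mul, ← mul_assoc, mul_div_mul_right _ _ (Complex.exp_ne_zero _)]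
  have hnu : ∀ φ, ‖u φ‖ = Real.exp (-((G.pt φ).im - ω.im)) := fun φ => by
    simp only [hu_def]; rw [Complex.norm_exp]; simp
  have hnv : ∀ φ, ‖v φ‖ = Real.exp ((G.pt φ).im - ω.im) := fun φ => by
    simp only [hv_def]; rw [Complex.norm_exp]; simp
  have hpt : ∀ φ, HasDerivAt G.pt (deriv G.pt φ) φ := fun φ =>
    (G.hasDerivAt_pt φ).differentiableAt.hasDerivAt
  have hdu : ∀ φ, HasDerivAt u (u φ * (Complex.I * deriv G.pt φ)) φ := fun φ =>
    (((hpt φ).sub_const ω).const_mul Complex.I).cexp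
  have hdv : ∀ φ, HasDerivAt v (v φ * -(Complex.I * deriv G.pt φ)) φ := fun φ =>
    (((hpt φ).sub_const ω).const_mul Complex.I).fun_neg.cexp
  have hcont : ContinuousOn g (Set.Icc (-P) P) := by
    refine ContinuousOn.mul (ContinuousOn.div ?_ ?_ fun φ hφ => sub_ne_zero.2 (hne φ hφ))
      G.continuous_deriv_pt.continuousOn
    all_goals
      have := G.continuous_pt
      fun_prop
  have hi1 : IntervalIntegrable g MeasureTheory.volume (-P) ψ := by
    refine (hcont.mono ?_).intervalIntegrable
    rw [Set.uIcc_of_le hψ.1.le]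
    exact Set.Icc_subset_Icc_right hψ.2.le
  have hi2 : IntervalIntegrable g MeasureTheory.volume ψ P := by
    refine (hcont.mono ?_).intervalIntegrable
    rw [Set.uIcc_of_le hψ.2.le]
    exact Set.Icc_subset_Icc_left hψ.1.le
  have I2 : ∫ φ in ψ..P, g φ = Complex.log (1 - u P) - Complex.log (1 - u ψ) := by
    refine intervalIntegral.integral_eq_sub_of_hasDerivAt (f := fun φ => Complex.log (1 - u φ))
      (fun φ hφ => ?_) hi2
    rw [Set.uIcc_of_le hψ.2.le] at hφ
    have hφ' : φ ∈ Set.Icc (-P) P := ⟨hψ.1.le.trans hφ.1, hφ.2⟩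
    have hle : ‖u φ‖ ≤ 1 := by
      rw [hnu, Real.exp_le_one_iff]
      rcases hφ.1.eq_or_lt with h | h
      · rw [← h, hY]; simp
      · linarith [hu φ ⟨h, hφ.2⟩]
    have h2 := ((hdu φ).const_sub 1).clog_real (one_sub_mem_slitPlane hle (hu1 φ hφ'))
    have h3 : u φ - 1 ≠ 0 := sub_ne_zero.2 (hu1 φ hφ')
    have h4 : 1 - u φ ≠ 0 := sub_ne_zero.2 (hu1 φ hφ').symm
    have e : Complex.I * u φ / (u φ - 1) * deriv G.pt φ
        = -(u φ * (Complex.I * deriv G.pt φ)) / (1 - u φ) := by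
      rw [div_mul_eq_mul_div, div_eq_div_iff h3 h4]
      ring
    rw [hgu, e]
    exact h2
  have I1 : ∫ φ in (-P)..ψ, g φ = (Complex.I * G.pt ψ + Complex.log (1 - v ψ))
      - (Complex.I * G.pt (-P) + Complex.log (1 - v (-P))) := by
    refine intervalIntegral.integral_eq_sub_of_hasDerivAt
      (f := fun φ => Complex.I * G.pt φ + Complex.log (1 - v φ)) (fun φ hφ => ?_) hi1
    rw [Set.uIcc_of_le hψ.1.le] at hφ
    have hφ' : φ ∈ Set.Icc (-P) P := ⟨hφ.1, hφ.2.trans hψ.2.le⟩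
    have hle : ‖v φ‖ ≤ 1 := by
      rw [hnv, Real.exp_le_one_iff]
      rcases hφ.2.eq_or_lt with h | h
      · rw [h, hY]; simp
      · linarith [hl φ ⟨hφ.1, h⟩]
    have h2 := ((hpt φ).const_mul Complex.I).fun_add
      (((hdv φ).const_sub 1).clog_real (one_sub_mem_slitPlane hle (hv1 φ hφ')))
    have h3 : u φ - 1 ≠ 0 := sub_ne_zero.2 (hu1 φ hφ')
    have h4 : 1 - v φ ≠ 0 := sub_ne_zero.2 (hv1 φ hφ').symm
    have h5 := huv φ
    have e : Complex.I * u φ / (u φ - 1) * deriv G.pt φ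
        = Complex.I * deriv G.pt φ + -(v φ * -(Complex.I * deriv G.pt φ)) / (1 - v φ) := by
      rw [div_mul_eq_mul_div, div_eq_iff h3, add_mul, div_mul_eq_mul_div, ← sub_eq_iff_eq_add',
        eq_div_iff h4]
      linear_combination (-(Complex.I * deriv G.pt φ)) * h5
    rw [hgu, e]
    exact h2
  set J := ⌊((G.pt ψ).re - ω.re) / (2 * Real.pi)⌋ with hJ
  -- The part of the crossing abscissa left after J full periods. It is nonzero because the contour
  -- avoids the lattice, so θ ∈ (0, 2π).
  set θ : ℝ := (G.pt ψ).re - ω.re - 2 * Real.pi * J with hθ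
  have hpi2 : 0 < 2 * Real.pi := by positivity
  have hptψ : Complex.I * (G.pt ψ - ω) = Complex.I * θ + J * (2 * Real.pi * Complex.I) := by
    have : G.pt ψ - ω = ((G.pt ψ).re - ω.re : ℝ) := by
      apply Complex.ext <;> simp [hY]
    rw [this, hθ]
    push_cast
    ring
  have huψ : u ψ = Complex.exp (Complex.I * θ) := by
    simp only [hu_def]
    rw [Complex.exp_eq_exp_iff_exists_int]
    exact ⟨J, hptψ⟩
  have hvψ : v ψ = Complex.exp (-(Complex.I * θ)) := by
    simp only [hv_def]
    rw [Complex.exp_eq_exp_iff_exists_int]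
    exact ⟨-J, by rw [hptψ]; push_cast; ring⟩
  have hθ0 : 0 ≤ θ := by
    have := Int.floor_le (((G.pt ψ).re - ω.re) / (2 * Real.pi))
    rw [← hJ, le_div_iff₀ hpi2] at this
    linarith
  have hθ1 : θ < 2 * Real.pi := by
    have := Int.lt_floor_add_one (((G.pt ψ).re - ω.re) / (2 * Real.pi))
    rw [← hJ, div_lt_iff₀ hpi2] at this
    linarith
  have hθ2 : 0 < θ := by
    refine lt_of_le_of_ne hθ0 fun h => hu1 ψ ⟨hψ.1.le, hψ.2.le⟩ ?_
    rw [huψ, ← h]; simp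
  rw [← intervalIntegral.integral_add_adjacent_intervals hi1 hi2, I1, I2, huψ, hvψ]
  have hlog := log_one_sub_exp_neg_sub hθ2 hθ1
  change _ = _ + (Complex.log (1 - u P) - Complex.log (1 - v (-P)))
  linear_combination hlog + hptψ

/-! ### Lattice points inside a contour and their index. -/

section Inside

variable {n : ℕ} {G : Contour n}

/-- A connected set that does not meet the contour lies on one side of it. -/
theorem Contour.norm_lt_r_iff_of_isPreconnected {S : Set ℂ} (hS : IsPreconnected S)
    (hre : ∀ z ∈ S, 0 < z.re) (hdisj : ∀ z ∈ S, G.pt z.arg ≠ z) {z z' : ℂ} (hz : z ∈ S)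
    (hz' : z' ∈ S) : ‖z‖ < G.r z.arg ↔ ‖z'‖ < G.r z'.arg := by
  have hc : ContinuousOn (fun z : ℂ => ‖z‖ - G.r z.arg) S := fun z hz =>
    (continuous_norm.continuousAt.sub (G.contDiff.continuous.continuousAt.comp
      (Complex.continuousAt_arg (Or.inl (hre z hz))))).continuousWithinAt
  have hne : ∀ z ∈ S, ‖z‖ - G.r z.arg ≠ 0 := by
    intro z hz h
    apply hdisj z hz
    unfold Contour.pt
    rw [← sub_eq_zero.1 h, norm_mul_exp_arg]
  have key : ∀ z ∈ S, ∀ z' ∈ S, ‖z‖ < G.r z.arg → ‖z'‖ < G.r z'.arg := by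
    intro z hz z' hz' h
    by_contra! h'
    obtain ⟨x, hx, hx0⟩ := hS.intermediate_value hz hz' hc
      (show (0 : ℝ) ∈ Set.Icc _ _ from ⟨(sub_neg.2 h).le, sub_nonneg.2 h'⟩)
    exact hne x hx hx0
  exact ⟨key z hz z' hz', key z' hz' z hz⟩

theorem re_mem_isPreconnected (Y : ℝ) {s : Set ℝ} (hs : Convex ℝ s) :
    IsPreconnected {z : ℂ | z.im = Y ∧ z.re ∈ s} := by
  have h : {z : ℂ | z.im = Y ∧ z.re ∈ s} = (fun x : ℝ => (⟨x, Y⟩ : ℂ)) '' s := by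
    ext z
    constructor
    · rintro ⟨h1, h2⟩
      exact ⟨z.re, h2, Complex.ext rfl h1.symm⟩
    · rintro ⟨x, hx, rfl⟩
      exact ⟨rfl, hx⟩
  rw [h]
  refine hs.isPreconnected.image _ (Continuous.continuousOn ?_)
  have : (fun x : ℝ => (⟨x, Y⟩ : ℂ)) = fun x : ℝ => (x : ℂ) + Y * Complex.I := by
    funext x; apply Complex.ext <;> simp
  rw [this]
  fun_prop

/-- On a horizontal line, the interior of the contour is to the left of the crossing point. -/
theorem Contour.Tame.norm_lt_r_iff {c₁ c₂ : ℝ} (h : G.Tame c₁ c₂) {Y X ψ : ℝ}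
    (hX0 : 0 < X) (hX : ∀ z : ℂ, X ≤ z.re → |z.im| ≤ |Y| → |z.arg| < Real.pi / n)
    (hR : c₁ + (X + |Y|) < G.r 0)
    (hl : ∀ φ ∈ Set.Ico (-(Real.pi / n)) ψ, (G.pt φ).im < Y)
    (hu : ∀ φ ∈ Set.Ioc ψ (Real.pi / n), Y < (G.pt φ).im) {z : ℂ} (hz : X ≤ z.re)
    (hzY : z.im = Y) (hne : z.re ≠ (G.pt ψ).re) :
    ‖z‖ < G.r z.arg ↔ z.re < (G.pt ψ).re := by
  have hdisj : ∀ x : ℂ, x.im = Y → X ≤ x.re → x.re ≠ (G.pt ψ).re → G.pt x.arg ≠ x := by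
    intro x h1 h2 h3 h4
    have h5 := abs_lt.1 (hX x h2 (by rw [h1]))
    have h6 : (G.pt x.arg).im = Y := by rw [h4, h1]
    have h7 : x.arg = ψ := by
      rcases lt_trichotomy x.arg ψ with h | h | h
      · exact absurd h6 (hl _ ⟨h5.1.le, h⟩).ne
      · exact h
      · exact absurd h6 (hu _ ⟨h, h5.2.le⟩).ne'
    rw [← h7, h4] at h3
    exact h3 rfl
  rcases hne.lt_or_gt with hlt | hgt
  · refine iff_of_true ?_ hlt
    have hconn := re_mem_isPreconnected Y (convex_Ico X (G.pt ψ).re)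
    -- The horizontal line is cut at the crossing point. Its left part contains the point X + iY,
    -- which lies inside the contour because r(0) is large; its right part contains a point beyond
    -- the largest radius.
    refine (Contour.norm_lt_r_iff_of_isPreconnected hconn (fun x hx => hX0.trans_le hx.2.1)
      (fun x hx => hdisj x hx.1 hx.2.1 hx.2.2.ne) (z := ⟨X, Y⟩)
      ⟨rfl, le_rfl, hz.trans_lt hlt⟩ ⟨hzY, hz, hlt⟩).1 ?_
    refine (Complex.norm_le_abs_re_add_abs_im _).trans_lt ?_
    have := h.le_r (⟨X, Y⟩ : ℂ).arg
    simp only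
    rw [abs_of_pos hX0]
    linarith
  · refine iff_of_false ?_ hgt.not_gt
    have hconn := re_mem_isPreconnected Y (s := Set.Ioi (G.pt ψ).re ∩ Set.Ici X)
      ((convex_Ioi _).inter (convex_Ici _))
    set M := z.re + (G.r 0 + c₁) with hM
    have hb : 0 < G.r 0 + c₁ := by
      have := h.osc 0
      rw [sub_self, abs_zero] at this
      linarith [G.pos 0]
    rw [Contour.norm_lt_r_iff_of_isPreconnected hconn (fun x hx => hX0.trans_le hx.2.2)
      (fun x hx => hdisj x hx.1 hx.2.2 hx.2.1.ne') (z' := ⟨M, Y⟩) ⟨hzY, hgt, hz⟩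
      ⟨rfl, by simp only [Set.mem_Ioi]; linarith, by simp only [Set.mem_Ici]; linarith⟩, not_lt]
    refine (h.r_le _).trans (le_trans ?_ (Complex.re_le_norm _))
    simp only
    linarith

end Inside

section Endpoints

variable {n : ℕ} {Γ : ℕ → Contour n} {c₁ c₂ : ℝ}

theorem tendsto_im_pt_end (hn : 2 ≤ n) (hT : ∀ ℓ, (Γ ℓ).Tame c₁ c₂)
    (hr : Tendsto (fun ℓ => (Γ ℓ).r 0) atTop atTop) :
    Tendsto (fun ℓ => ((Γ ℓ).pt (Real.pi / n)).im) atTop atTop ∧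
    Tendsto (fun ℓ => -((Γ ℓ).pt (-(Real.pi / n))).im) atTop atTop := by
  have hs := sin_pi_div_pos hn
  have h1 : Tendsto (fun ℓ => ((Γ ℓ).r 0 - c₁) * Real.sin (Real.pi / n)) atTop atTop :=
    (tendsto_atTop_add_const_right _ (-c₁) hr).atTop_mul_const hs
  constructor
  · refine tendsto_atTop_mono (fun ℓ => ?_) h1
    rw [Contour.pt_im]
    have := (hT ℓ).le_r (Real.pi / n)
    gcongr
  · refine tendsto_atTop_mono (fun ℓ => ?_) h1
    rw [Contour.pt_im, Real.sin_neg, mul_neg, neg_neg]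
    have := (hT ℓ).le_r (-(Real.pi / n))
    gcongr

/-- The upper end of the contour rises and the lower end sinks without bound, so e^{iz} tends to 0
at the former and to ∞ at the latter. -/
theorem tendsto_exp_end (hn : 2 ≤ n) (hT : ∀ ℓ, (Γ ℓ).Tame c₁ c₂)
    (hr : Tendsto (fun ℓ => (Γ ℓ).r 0) atTop atTop) (ω : ℂ) :
    Tendsto (fun ℓ => Complex.exp (Complex.I * ((Γ ℓ).pt (Real.pi / n) - ω))) atTop (𝓝 0) ∧
    Tendsto (fun ℓ => Complex.exp (-(Complex.I * ((Γ ℓ).pt (-(Real.pi / n)) - ω))))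
      atTop (𝓝 0) := by
  obtain ⟨h1, h2⟩ := tendsto_im_pt_end hn hT hr
  constructor
  · rw [tendsto_zero_iff_norm_tendsto_zero]
    refine (Real.tendsto_exp_neg_atTop_nhds_zero.comp
      (tendsto_atTop_add_const_right _ (-ω.im) h1)).congr fun ℓ => ?_
    rw [Complex.norm_exp]
    simp [sub_eq_add_neg]
  · rw [tendsto_zero_iff_norm_tendsto_zero]
    refine (Real.tendsto_exp_neg_atTop_nhds_zero.comp
      (tendsto_atTop_add_const_right _ ω.im h2)).congr fun ℓ => ?_
    rw [Complex.norm_exp]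
    simp [sub_eq_add_neg, add_comm]

end Endpoints

/-- The numbers `J ℓ` index the lattice `ω + 2 π ℤ` relative to the contours: exactly the (remote)
lattice points with `j ≤ J ℓ` lie inside the `ℓ`-th contour, and the integral of
`d log (e^{iz} - e^{iω})` is expressed through `J ℓ`. -/
structure IsIndex {n : ℕ} (Γ : ℕ → Contour n) (ω : ℂ) (δ : ℝ) (J : ℕ → ℤ) : Prop where
  tendsto : Tendsto J atTop atTop
  integral : Tendsto (fun ℓ => (∫ φ in (-(Real.pi / n))..(Real.pi / n),
        Complex.I * Complex.exp (Complex.I * (Γ ℓ).pt φ) /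
          (Complex.exp (Complex.I * (Γ ℓ).pt φ) - Complex.exp (Complex.I * ω)) * deriv (Γ ℓ).pt φ)
        - (Complex.I * (ω + 2 * Real.pi * J ℓ + Real.pi)
          - Complex.I * (Γ ℓ).pt (-(Real.pi / n)))) atTop (𝓝 0)
  encloses : ∃ j₀ : ℤ, ∀ᶠ ℓ in atTop, ∀ j ≥ j₀, ∀ z, ‖z - latticePt ω j‖ < δ →
    |z.arg| < Real.pi / n ∧ 0 < z.re ∧ ((Γ ℓ).Encloses (z ^ n) ↔ j ≤ J ℓ)

/-- The index is the number of full periods from Re ω to the point where the contour crosses the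
level Im ω. The logarithms left over at the two ends tend to zero, which leaves the stated integral.
-/
theorem exists_isIndex {n : ℕ} (h4 : 4 ≤ n) {Γ : ℕ → Contour n} {c₁ c₂ : ℝ}
    (hc₂ : 0 < c₂) (hT : ∀ ℓ, (Γ ℓ).Tame c₁ c₂)
    (hr : Tendsto (fun ℓ => (Γ ℓ).r 0) atTop atTop) {ω : ℂ} {δ : ℝ} (hδ : 0 < δ)
    (haway : ∀ᶠ ℓ in atTop, ∀ φ, |φ| ≤ Real.pi / n → Away ω δ ((Γ ℓ).pt φ)) :
    ∃ J : ℕ → ℤ, IsIndex Γ ω δ J := by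
  have hpi := Real.pi_pos
  have hn4 : (4 : ℝ) ≤ n := by exact_mod_cast h4
  have hpn0 : 0 < Real.pi / n := by positivity
  have hpn : Real.pi / n ≤ Real.pi / 4 := by gcongr
  obtain ⟨R, hR⟩ := Contour.exists_crossing (n := n) (c₁ := c₁) (by omega) hc₂ ω.im
  have hcross : ∀ᶠ ℓ in atTop, ∃ ψ, ψ ∈ Set.Ioo (-(Real.pi / n)) (Real.pi / n) ∧
      ((Γ ℓ).pt ψ).im = ω.im ∧ (∀ φ ∈ Set.Ico (-(Real.pi / n)) ψ, ((Γ ℓ).pt φ).im < ω.im) ∧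
        ∀ φ ∈ Set.Ioc ψ (Real.pi / n), ω.im < ((Γ ℓ).pt φ).im := by
    filter_upwards [hr.eventually_ge_atTop R] with ℓ hℓ
    exact hR (Γ ℓ) (hT ℓ) hℓ
  obtain ⟨ψ, hψ⟩ := hcross.choice
  set J : ℕ → ℤ := fun ℓ => ⌊(((Γ ℓ).pt (ψ ℓ)).re - ω.re) / (2 * Real.pi)⌋ with hJ
  refine ⟨J, ?_, ?_, ?_⟩
  · refine tendsto_floor_atTop.comp ?_
    have h1 : Tendsto (fun ℓ => (((Γ ℓ).r 0 - c₁) * (1 / 2) - ω.re) / (2 * Real.pi))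
        atTop atTop :=
      (tendsto_atTop_add_const_right _ (-ω.re)
        ((tendsto_atTop_add_const_right _ (-c₁) hr).atTop_mul_const
          (by norm_num))).atTop_div_const (by positivity)
    refine tendsto_atTop_mono' _ ?_ h1
    filter_upwards [hψ, hr.eventually_ge_atTop c₁] with ℓ hℓ hℓ2
    have hcos : 1 / 2 ≤ Real.cos (ψ ℓ) := by
      rw [← Real.cos_abs, ← Real.cos_pi_div_three]
      have : |ψ ℓ| ≤ Real.pi / n := abs_le.2 ⟨hℓ.1.1.le, hℓ.1.2.le⟩
      exact Real.cos_le_cos_of_nonneg_of_le_pi (abs_nonneg _) (by linarith) (by linarith)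
    rw [Contour.pt_re]
    have := (hT ℓ).le_r (ψ ℓ)
    have h5 : ((Γ ℓ).r 0 - c₁) * (1 / 2) ≤ (Γ ℓ).r (ψ ℓ) * Real.cos (ψ ℓ) :=
      mul_le_mul this hcos (by norm_num) ((Γ ℓ).pos _).le
    gcongr
  · obtain ⟨e1, e2⟩ := tendsto_exp_end (by omega) hT hr ω
    have hlog : ∀ {f : ℕ → ℂ}, Tendsto f atTop (𝓝 0) →
        Tendsto (fun ℓ => Complex.log (1 - f ℓ)) atTop (𝓝 0) := by
      intro f hf
      have h1 : Tendsto (fun ℓ => 1 - f ℓ) atTop (𝓝 (1 - 0)) := hf.const_sub 1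
      rw [sub_zero] at h1
      have := (continuousAt_clog (x := 1) Complex.one_mem_slitPlane).tendsto.comp h1
      rwa [Complex.log_one] at this
    have h1 := (hlog e1).sub (hlog e2)
    rw [sub_zero] at h1
    refine h1.congr' ?_
    filter_upwards [hψ, haway] with ℓ hℓ ha
    rw [(Γ ℓ).integral_dlog hℓ.1 hℓ.2.1 hℓ.2.2.1 hℓ.2.2.2 fun φ hφ =>
      exp_ne_of_away hδ (ha φ (abs_le.2 hφ))]
    ring
  · obtain ⟨X, hX0, hX⟩ := exists_forall_abs_arg_lt (by omega : 2 ≤ n) (|ω.im| + δ)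
    have hre : Tendsto (fun j : ℤ => ω.re + 2 * Real.pi * (j : ℝ)) atTop atTop :=
      tendsto_atTop_add_const_left _ _
        (tendsto_intCast_atTop_atTop.const_mul_atTop (by positivity))
    obtain ⟨j₀, hj₀⟩ := eventually_atTop.1 (hre.eventually_ge_atTop (X + δ))
    refine ⟨j₀, ?_⟩
    filter_upwards [hψ, haway, hr.eventually_gt_atTop (c₁ + (X + |ω.im|))]
      with ℓ hℓ ha hbig j hj z hz
    have hball : ∀ x ∈ Metric.ball (latticePt ω j) δ, X ≤ x.re ∧ |x.arg| < Real.pi / n := by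
      intro x hx
      rw [mem_ball_iff_norm] at hx
      have h1 := (Complex.abs_re_le_norm (x - latticePt ω j)).trans hx.le
      have h2 := (Complex.abs_im_le_norm (x - latticePt ω j)).trans hx.le
      rw [Complex.sub_re, latticePt_re] at h1
      rw [Complex.sub_im, latticePt_im] at h2
      have h3 : X ≤ x.re := by linarith [(abs_le.1 h1).1, hj₀ j hj]
      exact ⟨h3, hX x h3 (by linarith [abs_sub_abs_le_abs_sub x.im ω.im])⟩
    have hcen : latticePt ω j ∈ Metric.ball (latticePt ω j) δ := Metric.mem_ball_self hδ
    have hzball := hball z (mem_ball_iff_norm.2 hz)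
    refine ⟨hzball.2, hX0.trans_le hzball.1, ?_⟩
    rw [(Γ ℓ).encloses_pow_iff (by omega) (by
      rintro rfl
      have := hzball.1
      simp only [Complex.zero_re] at this
      linarith) hzball.2]
    -- The contour misses the disc of radius δ about the lattice point, so z and the centre are on
    -- the same side. For the centre, which has height Im ω, being inside means being to the left of
    -- the crossing.
    rw [Contour.norm_lt_r_iff_of_isPreconnected (convex_ball (latticePt ω j) δ).isPreconnected
      (fun x hx => hX0.trans_le (hball x hx).1) (fun x hx h => by
        have h1 := ha x.arg (hball x hx).2.le j
        rw [h] at h1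
        exact absurd (mem_ball_iff_norm.1 hx) (not_lt.2 h1)) (mem_ball_iff_norm.2 hz) hcen]
    have hψle : |ψ ℓ| ≤ Real.pi / n := abs_le.2 ⟨hℓ.1.1.le, hℓ.1.2.le⟩
    have hne : (latticePt ω j).re ≠ ((Γ ℓ).pt (ψ ℓ)).re := by
      intro h
      have h1 := ha (ψ ℓ) hψle j
      have h2 : (Γ ℓ).pt (ψ ℓ) = latticePt ω j :=
        Complex.ext h.symm (by rw [hℓ.2.1, latticePt_im])
      rw [h2, sub_self, norm_zero] at h1
      linarith
    rw [(hT ℓ).norm_lt_r_iff hX0 (fun x h1 h2 => hX x h1 (by linarith)) hbig hℓ.2.2.1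
      hℓ.2.2.2 (hball _ hcen).1 (latticePt_im ω j) hne, hJ, Int.le_floor,
      le_div_iff₀ (by positivity)]
    rw [latticePt_re] at hne ⊢
    constructor
    · intro h; linarith
    · intro h; exact lt_of_le_of_ne (by linarith) hne

/-! ### Arithmetic means. -/

section Cesaro

theorem cesaroLim_of_tendsto {x : ℕ → ℂ} {V : ℂ} (h : Tendsto x atTop (𝓝 V)) : CesaroLim x V := by
  unfold CesaroLim
  refine h.cesaro_smul.congr fun m => ?_
  rw [Complex.real_smul]
  simp

/-- A bounded sequence whose consecutive sums converge to `2 V` is mean-value convergent to `V`. -/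
theorem cesaroLim_of_tendsto_add_succ {x : ℕ → ℂ} {V : ℂ} {C : ℝ}
    (hb : ∀ᶠ ℓ in atTop, ‖x ℓ‖ ≤ C) (h : Tendsto (fun ℓ => x ℓ + x (ℓ + 1)) atTop (𝓝 (2 * V))) :
    CesaroLim x V := by
  have h1 := cesaroLim_of_tendsto h
  unfold CesaroLim at h1 ⊢
  have h2 : Tendsto (fun m : ℕ => (1 / (m : ℂ)) * (x m - x 0)) atTop (𝓝 0) := by
    have h3 : Tendsto (fun m : ℕ => (1 / (m : ℝ)) * (C + ‖x 0‖)) atTop (𝓝 0) := by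
      have := (tendsto_one_div_atTop_nhds_zero_nat (𝕜 := ℝ)).mul_const (C + ‖x 0‖)
      simpa using this
    refine squeeze_zero_norm' ?_ h3
    filter_upwards [hb] with m hm
    rw [norm_mul, norm_div, norm_one, Complex.norm_natCast]
    refine mul_le_mul_of_nonneg_left ((norm_sub_le _ _).trans ?_) (by positivity)
    linarith
  have h4 := (h1.sub h2).const_mul (1 / 2 : ℂ)
  have e : (1 / 2 : ℂ) * (2 * V - 0) = V := by ring
  rw [e] at h4
  refine h4.congr fun m => ?_
  have h5 : ∑ ℓ ∈ Finset.range m, (x ℓ + x (ℓ + 1))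
      = 2 * ∑ ℓ ∈ Finset.range m, x ℓ + (x m - x 0) := by
    rw [← Finset.sum_range_sub, Finset.mul_sum, ← Finset.sum_add_distrib]
    exact Finset.sum_congr rfl fun _ _ => by ring
  rw [h5]
  ring

end Cesaro

/-! ### Roots of eigenvalues, multiplicities and separation of the lattices. -/

section Powers

variable {n : ℕ}

theorem exists_pow_eq (hn : 0 < n) (l : ℂ) (hl : l ≠ 0) :
    ∃ z : ℂ, z ^ n = l ∧ |z.arg| ≤ Real.pi / n := by
  have hn' : (0 : ℝ) < n := by exact_mod_cast hn
  have hl' := norm_pos_iff.2 hl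
  set t : ℝ := ‖l‖ ^ (n : ℝ)⁻¹ with ht
  have ht0 : 0 < t := by positivity
  have h1 := Complex.neg_pi_lt_arg l
  have h2 := Complex.arg_le_pi l
  have hn1 : (1 : ℝ) ≤ n := by exact_mod_cast hn
  have hpi := Real.pi_pos
  have h3 : |l.arg / n| ≤ Real.pi / n := by
    rw [abs_div, abs_of_pos hn']
    gcongr
    exact abs_le.2 ⟨h1.le, h2⟩
  have h4 : Real.pi / n ≤ Real.pi := div_le_self hpi.le hn1
  refine ⟨t * Complex.exp (Complex.I * ((l.arg / n : ℝ) : ℂ)), ?_, ?_⟩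
  · rw [mul_pow, ← Complex.exp_nat_mul]
    conv_rhs => rw [← norm_mul_exp_arg l]
    congr 1
    · rw [ht, ← Complex.ofReal_pow, Real.rpow_inv_natCast_pow hl'.le hn.ne']
    · congr 1
      have : (n : ℂ) ≠ 0 := by exact_mod_cast hn.ne'
      push_cast
      field_simp
  · have h5 := abs_le.1 h3
    have h6 : -Real.pi < l.arg / n := by
      rw [lt_div_iff₀ hn']; nlinarith
    rw [arg_mul_exp ht0 h6 (by linarith)]
    exact h3

theorem norm_pow_rpow (hn : 0 < n) (z : ℂ) : ‖z ^ n‖ ^ (1 / n : ℝ) = ‖z‖ := by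
  rw [norm_pow, one_div, Real.pow_rpow_inv_natCast (norm_nonneg z) hn.ne']

theorem eq_of_pow_eq (hn : 0 < n) {z z' : ℂ} (hz : 0 < z.re) (hz' : 0 < z'.re)
    (ha : |z.arg| < Real.pi / n) (ha' : |z'.arg| < Real.pi / n) (h : z ^ n = z' ^ n) : z = z' := by
  have h0 : z ≠ 0 := by rintro rfl; simp at hz
  have h0' : z' ≠ 0 := by rintro rfl; simp at hz'
  have hn' : (n : ℝ) ≠ 0 := by exact_mod_cast hn.ne'
  have h1 : ‖z‖ = ‖z'‖ := by rw [← norm_pow_rpow hn z, h, norm_pow_rpow hn]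
  have h2 : z.arg = z'.arg := by
    have h3 := arg_pow_of_abs_lt hn h0 ha
    rw [h, arg_pow_of_abs_lt hn h0' ha'] at h3
    exact (mul_left_cancel₀ hn' h3).symm
  rw [← norm_mul_exp_arg z, ← norm_mul_exp_arg z', h1, h2]

theorem im_pow_eq (z : ℂ) : (z ^ n).im = ‖z‖ ^ n * Real.sin (n * z.arg) := by
  conv_lhs => rw [← norm_mul_exp_arg z]
  rw [mul_pow, ← Complex.exp_nat_mul, ← Complex.ofReal_pow, Complex.im_ofReal_mul,
    ← Complex.exp_ofReal_mul_I_im]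
  congr 3
  push_cast
  ring

theorem im_pow_pos (hn : 0 < n) {z : ℂ} (ha : |z.arg| < Real.pi / n) (h : 0 < z.im) :
    0 < (z ^ n).im := by
  have hn' : (0 : ℝ) < n := by exact_mod_cast hn
  have hz : z ≠ 0 := by rintro rfl; simp at h
  have h1 : 0 < z.arg := by
    by_contra! h2
    have h3 := Real.sin_nonpos_of_nonpos_of_neg_pi_le h2 (Complex.neg_pi_lt_arg z).le
    rw [← Complex.norm_mul_sin_arg z] at h
    nlinarith [norm_nonneg z]
  have h2 := (abs_lt.1 ha).2
  rw [lt_div_iff₀ hn'] at h2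
  rw [im_pow_eq]
  exact mul_pos (pow_pos (norm_pos_iff.2 hz) n)
    (Real.sin_pos_of_pos_of_lt_pi (by positivity) (by linarith))

theorem im_pow_neg (hn : 0 < n) {z : ℂ} (ha : |z.arg| < Real.pi / n) (h : z.im < 0) :
    (z ^ n).im < 0 := by
  have hn' : (0 : ℝ) < n := by exact_mod_cast hn
  have hz : z ≠ 0 := by rintro rfl; simp at h
  have h1 : z.arg < 0 := by
    rwa [Complex.arg_neg_iff]
  have h2 := (abs_lt.1 ha).1
  rw [neg_lt, lt_div_iff₀ hn'] at h2
  rw [im_pow_eq]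
  exact mul_neg_of_pos_of_neg (pow_pos (norm_pos_iff.2 hz) n)
    (Real.sin_neg_of_neg_of_neg_pi_lt (by nlinarith) (by linarith))

end Powers

section Multiplicity

variable {n : ℕ} (B : BoundaryConditions n)

/-- An eigenfunction lies in the kernel of the first power. For counting, this lower bound is all
that is needed about multiplicities. -/
theorem BoundaryConditions.IsEigenvalue.one_le_multiplicity {B : BoundaryConditions n} {l : ℂ}
    (h : B.IsEigenvalue l) : 1 ≤ B.multiplicity l := by
  obtain ⟨u, hu, hmaps⟩ := h
  rw [Order.one_le_iff_ne_zero]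
  unfold BoundaryConditions.multiplicity
  rw [Ne, Cardinal.toENat_eq_zero, rank_zero_iff_forall_zero]
  intro h0
  apply hu
  have hmem : u ∈ Submodule.span ℂ {u | ∃ m, B.IsRootFun l m u} :=
    Submodule.subset_span ⟨1, l • u, hmaps, sub_self _⟩
  exact congrArg Subtype.val (h0 ⟨u, hmem⟩)

theorem exists_eq_singleton_of_finsum_eq_one {α : Type*} {f : α → ℕ∞} {S : Set α}
    (hf : ∀ x ∈ S, 1 ≤ f x) (h : ∑ᶠ x ∈ S, f x = 1) : ∃ x, S = {x} := by
  have hsupp : S ∩ Function.support f = S := by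
    refine Set.inter_eq_left.2 fun x hx => ?_
    exact (zero_lt_one.trans_le (hf x hx)).ne'
  -- With infinite support the sum would take its default value 0, not 1.
  have hfin : (S ∩ Function.support f).Finite := by
    by_contra hinf
    rw [finsum_mem_eq_zero_of_infinite hinf] at h
    exact zero_ne_one h
  rw [finsum_mem_eq_sum f hfin] at h
  have hmem : ∀ x, x ∈ hfin.toFinset ↔ x ∈ S := fun x => by rw [Set.Finite.mem_toFinset, hsupp]
  have hcard : (hfin.toFinset.card : ℕ∞) ≤ 1 := by
    rw [← h]
    calc (hfin.toFinset.card : ℕ∞) = ∑ x ∈ hfin.toFinset, 1 := by simp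
      _ ≤ _ := Finset.sum_le_sum fun x hx => hf x ((hmem x).1 hx)
  have hne : hfin.toFinset.Nonempty := by
    by_contra hne
    rw [Finset.not_nonempty_iff_eq_empty.1 hne, Finset.sum_empty] at h
    exact zero_ne_one h
  obtain ⟨x, hx⟩ := hne
  refine ⟨x, Set.ext fun y => ⟨fun hy => ?_, fun hy => ?_⟩⟩
  · exact Finset.card_le_one.1 (by exact_mod_cast hcard) y ((hmem y).2 hy) x hx
  · rw [Set.mem_singleton_iff.1 hy]; exact (hmem x).1 hx

end Multiplicity

/-- By periodicity only the difference of the two points matters. If it were small, continuity of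
the exponential at ω' would separate the value from e^{iω}, although periodicity makes them equal.
-/
theorem exists_le_norm_latticePt_sub {ω ω' : ℂ}
    (h : Complex.exp (Complex.I * ω) ≠ Complex.exp (Complex.I * ω')) :
    ∃ σ > 0, ∀ j j' : ℤ, σ ≤ ‖latticePt ω j - latticePt ω' j'‖ := by
  have hc : ContinuousAt (fun u => Complex.exp (Complex.I * (ω' + u))) 0 := by fun_prop
  have h0 : ∀ᶠ u in 𝓝 (0 : ℂ), Complex.exp (Complex.I * (ω' + u)) ≠ Complex.exp (Complex.I * ω) := by
    refine hc.eventually_ne ?_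
    simpa using h.symm
  obtain ⟨σ, hσ, hb⟩ := Metric.eventually_nhds_iff.1 h0
  refine ⟨σ, hσ, fun j j' => ?_⟩
  by_contra! hlt
  refine hb (y := latticePt ω j - latticePt ω' j') (by rwa [dist_zero_right]) ?_
  rw [← exp_latticePt ω j]
  have e : Complex.I * (ω' + (latticePt ω j - latticePt ω' j'))
      = Complex.I * latticePt ω (j - j') + 0 := by
    unfold latticePt; push_cast; ring
  rw [e, add_zero, exp_latticePt, exp_latticePt]

theorem le_norm_latticePt_sub_of_ne (ω : ℂ) {j j' : ℤ} (h : j ≠ j') :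
    2 * Real.pi ≤ ‖latticePt ω j - latticePt ω j'‖ := by
  have e : latticePt ω j - latticePt ω j' = ((2 * Real.pi * (j - j' : ℤ) : ℝ) : ℂ) := by
    unfold latticePt; push_cast; ring
  have h1 : (1 : ℝ) ≤ |((j - j' : ℤ) : ℝ)| := by
    have := Int.one_le_abs (sub_ne_zero.2 h)
    exact_mod_cast this
  rw [e, Complex.norm_real, Real.norm_eq_abs, abs_mul, abs_of_pos Real.two_pi_pos]
  nlinarith [Real.two_pi_pos]

/-- Because |z|² ≤ (Re z)² + Y² ≤ (Re z)² + κ Re z for large Re z. In a strip, absolute values can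
thus be compared through real parts. -/
theorem exists_norm_le_re_add (Y : ℝ) {κ : ℝ} (hκ : 0 < κ) :
    ∃ X > 0, ∀ z : ℂ, X ≤ z.re → |z.im| ≤ Y → ‖z‖ ≤ z.re + κ := by
  refine ⟨Y ^ 2 / κ + 1, by positivity, fun z hz hy => ?_⟩
  have h0 : 0 ≤ Y ^ 2 / κ := by positivity
  have h1 : Y ^ 2 ≤ κ * z.re := by
    have : Y ^ 2 / κ ≤ z.re := by linarith
    rw [div_le_iff₀ hκ] at this
    linarith
  have h2 : z.im ^ 2 ≤ Y ^ 2 := sq_le_sq' (abs_le.1 hy).1 (abs_le.1 hy).2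
  refine abs_le_of_sq_le_sq' ?_ (by nlinarith) |>.2
  rw [Complex.sq_norm, Complex.normSq_apply]
  nlinarith

theorem exists_of_eventually_sectorFilter {n : ℕ} {Q : ℂ → Prop}
    (h : ∀ᶠ z in sectorFilter n, Q z) : ∃ R, ∀ z : ℂ, R ≤ ‖z‖ → |z.arg| ≤ Real.pi / n → Q z := by
  unfold sectorFilter at h
  rw [eventually_inf_principal] at h
  obtain ⟨R, -, hR⟩ := Filter.hasBasis_cobounded_norm.eventually_iff.1 h
  exact ⟨R, fun z hz ha => hR hz ha⟩

theorem tendsto_re_sectorFilter {n : ℕ} (h4 : 4 ≤ n) :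
    Tendsto Complex.re (sectorFilter n) atTop := by
  have hc : 0 < Real.cos (Real.pi / 4) := by
    rw [Real.cos_pi_div_four]; positivity
  refine tendsto_atTop_mono' _ ?_
    ((tendsto_norm_cobounded_atTop.mono_left inf_le_left).const_mul_atTop hc)
  filter_upwards [mem_inf_of_right (mem_principal_self _)] with z hz
  have hn4 : (4 : ℝ) ≤ n := by exact_mod_cast h4
  have hz' : |z.arg| ≤ Real.pi / n := hz
  have hpi := Real.pi_pos
  have h1 : Real.pi / n ≤ Real.pi / 4 := by gcongr
  rw [← Complex.norm_mul_cos_arg z, mul_comm]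
  refine mul_le_mul_of_nonneg_left ?_ (norm_nonneg z)
  rw [← Real.cos_abs z.arg]
  exact Real.cos_le_cos_of_nonneg_of_le_pi (abs_nonneg _) (by linarith) (by linarith)

/-! ### Enclosure of eigenvalues in terms of the indices. -/

namespace BoundaryConditions

variable {n : ℕ} {B : BoundaryConditions n} {ω : Fin 2 → ℂ} {Γ : ℕ → Contour n} {c₁ c₂ δ : ℝ}

theorem HasRootLogs.exists_norm_sub_lt_of_le (hω : B.HasRootLogs ω) (hn : Even n) (h4 : 4 ≤ n)
    {η : ℝ} (hη : 0 < η) (jm : ℤ) : ∃ R, ∀ z : ℂ, R ≤ ‖z‖ → |z.arg| ≤ Real.pi / n →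
      B.IsEigenvalue (z ^ n) → ∃ a, ∃ j ≥ jm, ‖z - latticePt (ω a) j‖ < η := by
  refine exists_of_eventually_sectorFilter ?_
  have hre : ∀ a, ∀ᶠ z in sectorFilter n, (ω a).re + 2 * Real.pi * jm + η ≤ z.re := fun a =>
    (tendsto_re_sectorFilter h4).eventually_ge_atTop _
  filter_upwards [hω.eventually_exists_norm_sub_lt hn h4 hη, eventually_all.2 hre] with z hz hz1 he
  obtain ⟨a, j, hj⟩ := hz he
  refine ⟨a, j, ?_, hj⟩
  by_contra! hlt
  have h1 := (Complex.abs_re_le_norm _).trans_lt hj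
  rw [Complex.sub_re, latticePt_re] at h1
  have h2 := (abs_lt.1 h1).2
  have h3 : (j : ℝ) < jm := by exact_mod_cast hlt
  nlinarith [hz1 a, Real.two_pi_pos]

/-- For large `j` there is an eigenvalue whose root is close to the lattice point number `j`. -/
theorem HasRootLogs.exists_near (hω : B.HasRootLogs ω) (hn : Even n) (h4 : 4 ≤ n) {a : Fin 2}
    (hδ : 0 < δ) {J : ℕ → ℤ} (hJ : IsIndex Γ (ω a) δ J) {η : ℝ} (hη : 0 < η) :
    ∃ j₁ : ℤ, ∀ᶠ ℓ in atTop, ∀ j ≥ j₁, ∃ z : ℂ, B.IsEigenvalue (z ^ n) ∧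
      ‖z - latticePt (ω a) j‖ < η ∧ |z.arg| < Real.pi / n ∧ 0 < z.re ∧
      |‖z‖ - ((ω a).re + 2 * Real.pi * j)| < 2 * η ∧ ((Γ ℓ).Encloses (z ^ n) ↔ j ≤ J ℓ) := by
  obtain ⟨j₀, h0⟩ := hJ.encloses
  obtain ⟨j₂, h2⟩ := eventually_atTop.1
    (hω.eventually_exists_isEigenvalue hn h4 a (lt_min hδ hη))
  obtain ⟨X, hX, hre⟩ := exists_norm_le_re_add (|(ω a).im| + η) hη
  obtain ⟨j₃, h3⟩ := exists_int_gt ((X + η - (ω a).re) / (2 * Real.pi))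
  refine ⟨max j₀ (max j₂ j₃), ?_⟩
  filter_upwards [h0] with ℓ hℓ j hj
  obtain ⟨hj0, hj1, hj2⟩ : j₀ ≤ j ∧ j₂ ≤ j ∧ j₃ ≤ j := by simpa using hj
  obtain ⟨z, hz, he⟩ := h2 j hj1
  obtain ⟨hzδ, hzη⟩ := lt_min_iff.1 hz
  obtain ⟨ha, hr, henc⟩ := hℓ j hj0 z hzδ
  refine ⟨z, he, hzη, ha, hr, ?_, henc⟩
  have e1 := abs_lt.1 ((Complex.abs_re_le_norm _).trans_lt hzη)
  have e2 := ((Complex.abs_im_le_norm _).trans_lt hzη)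
  rw [Complex.sub_re, latticePt_re] at e1
  rw [Complex.sub_im, latticePt_im] at e2
  rw [div_lt_iff₀ Real.two_pi_pos] at h3
  have h4 : (j₃ : ℝ) ≤ j := by exact_mod_cast hj2
  have h5 := hre z (by nlinarith [Real.two_pi_pos]) (by
    have := abs_add_le (z.im - (ω a).im) (ω a).im
    rw [sub_add_cancel] at this
    linarith)
  have h6 := Complex.re_le_norm z
  rw [abs_lt]
  constructor <;> linarith

/-- Each contour encloses one more lattice point than its predecessor. -/
theorem HasRootLogs.eventually_index_succ (hω : B.HasRootLogs ω) (hn : Even n) (h4 : 4 ≤ n)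
    (hne : Complex.exp (Complex.I * ω 0) ≠ Complex.exp (Complex.I * ω 1))
    (hT : ∀ ℓ, (Γ ℓ).Tame c₁ c₂) (hr : Tendsto (fun ℓ => (Γ ℓ).r 0) atTop atTop)
    (hδ : 0 < δ) {J : Fin 2 → ℕ → ℤ} (hJ : ∀ a, IsIndex Γ (ω a) δ (J a))
    (hsep : Separates B Γ 1) :
    ∀ᶠ ℓ in atTop, J 0 (ℓ + 1) + J 1 (ℓ + 1) = J 0 ℓ + J 1 ℓ + 1 := by
  have hn0 : 0 < n := by omega
  obtain ⟨σ, hσ, hlat⟩ := exists_le_norm_latticePt_sub hne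
  have hpi := Real.pi_pos
  -- Discs of radius η about different lattice points, of the same or of different lattices, are
  -- disjoint and lie in the discs of radius δ for which the index decides enclosure.
  obtain ⟨η, hη, hησ, hηpi, hηδ⟩ : ∃ η > 0, 2 * η ≤ σ ∧ 2 * η ≤ 2 * Real.pi ∧ η ≤ δ :=
    ⟨min (σ / 2) (min Real.pi δ), by positivity,
      by linarith [min_le_left (σ / 2) (min Real.pi δ)],
      by linarith [(min_le_right (σ / 2) (min Real.pi δ)).trans (min_le_left _ _)],
      (min_le_right (σ / 2) (min Real.pi δ)).trans (min_le_right _ _)⟩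
  have huniq : ∀ a a' j j' z, ‖z - latticePt (ω a) j‖ < η → ‖z - latticePt (ω a') j'‖ < η →
      a = a' ∧ j = j' := by
    intro a a' j j' z h h'
    have hd : ‖latticePt (ω a) j - latticePt (ω a') j'‖ < 2 * η := by
      rw [← sub_sub_sub_cancel_left _ _ z]
      exact (norm_sub_le _ _).trans_lt (by linarith)
    have key : a = a' := by
      fin_cases a <;> fin_cases a'
      · rfl
      · exact absurd hd (not_lt.2 (hησ.trans (hlat _ _)))
      · rw [norm_sub_rev] at hd
        exact absurd hd (not_lt.2 (hησ.trans (hlat _ _)))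
      · rfl
    subst key
    refine ⟨rfl, ?_⟩
    by_contra hjj
    exact absurd hd (not_lt.2 (hηpi.trans (le_norm_latticePt_sub_of_ne _ hjj)))
  choose j₁ hnear using fun a => hω.exists_near hn h4 hδ (hJ a) hη
  choose j₀ henc using fun a => (hJ a).encloses
  obtain ⟨R, hR⟩ := hω.exists_norm_sub_lt_of_le hn h4 hη (max (j₀ 0) (j₀ 1))
  have hj0 : ∀ a, j₀ a ≤ max (j₀ 0) (j₀ 1) := by
    intro a; fin_cases a
    · exact le_max_left _ _
    · exact le_max_right _ _
  have hnear' := eventually_all.2 hnear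
  have henc' := eventually_all.2 henc
  have hlarge := eventually_all.2 fun a =>
    (hJ a).tendsto.eventually_ge_atTop (max (j₁ a) (j₀ a))
  filter_upwards [hsep, hnear', henc', (tendsto_add_atTop_nat 1).eventually henc', hlarge,
    hr.eventually_ge_atTop (R + c₁), hr.eventually_ge_atTop c₁] with
    ℓ ⟨hle, hsum⟩ hn1 he1 he2 hJl hr1 hr2
  obtain ⟨l₀, hl₀⟩ := exists_eq_singleton_of_finsum_eq_one
    (fun l hl => IsEigenvalue.one_le_multiplicity hl.1) hsum
  have hmono : ∀ l, (Γ ℓ).Encloses l → (Γ (ℓ + 1)).Encloses l := fun l hl =>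
    lt_of_lt_of_le hl (pow_le_pow_left₀ ((Γ ℓ).pos _).le (hle _) n)
  -- A lattice point passed between the two contours brings an eigenvalue of the gap with it, which
  -- must be l₀. As the discs are disjoint, at most one lattice point is passed.
  have hpoint : ∀ a j, J a ℓ < j → j ≤ J a (ℓ + 1) →
      ∃ z, ‖z - latticePt (ω a) j‖ < η ∧ |z.arg| < Real.pi / n ∧ 0 < z.re ∧ z ^ n = l₀ := by
    intro a j h1 h2
    have hj := max_le_iff.1 ((hJl a).trans h1.le)
    obtain ⟨z, hz, hzη, ha, hre, -, hE⟩ := hn1 a j hj.1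
    refine ⟨z, hzη, ha, hre, ?_⟩
    have hE2 := (he2 a j hj.2 z (hzη.trans_le hηδ)).2.2.2 h2
    exact hl₀.subset ⟨hz, fun h => absurd (hE.1 h) (not_le.2 h1), hE2⟩
  have hunique : ∀ a a' j j', J a ℓ < j → j ≤ J a (ℓ + 1) → J a' ℓ < j' → j' ≤ J a' (ℓ + 1) →
      a = a' ∧ j = j' := by
    intro a a' j j' h1 h2 h1' h2'
    obtain ⟨z, hz, ha, hre, he⟩ := hpoint a j h1 h2
    obtain ⟨z', hz', ha', hre', he'⟩ := hpoint a' j' h1' h2'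
    rw [← eq_of_pow_eq hn0 hre hre' ha ha' (he.trans he'.symm)] at hz'
    exact huniq _ _ _ _ z hz hz'
  have hJmono : ∀ a, J a ℓ ≤ J a (ℓ + 1) := by
    intro a
    have hj := max_le_iff.1 (hJl a)
    obtain ⟨z, hz, hzη, -, -, -, hE⟩ := hn1 a (J a ℓ) hj.1
    exact (he2 a _ hj.2 z (hzη.trans_le hηδ)).2.2.1 (hmono _ (hE.2 le_rfl))
  -- Conversely, the root of l₀ is close to a lattice point, which is therefore passed. Here l₀ ≠ 0,
  -- since 0 is enclosed by every contour.
  obtain ⟨a, j, ha1, ha2⟩ : ∃ a j, J a ℓ < j ∧ j ≤ J a (ℓ + 1) := by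
    obtain ⟨hl1, hl2, hl3⟩ := hl₀.symm.subset (Set.mem_singleton l₀)
    have hl0 : l₀ ≠ 0 := by
      rintro rfl
      exact hl2 (by rw [Contour.Encloses, norm_zero]; exact pow_pos ((Γ ℓ).pos _) n)
    obtain ⟨z, rfl, hza⟩ := exists_pow_eq hn0 l₀ hl0
    have hzR : R ≤ ‖z‖ := by
      unfold Contour.Encloses at hl2
      rw [not_lt, norm_pow] at hl2
      have h1 := le_of_pow_le_pow_left₀ hn0.ne' (norm_nonneg z) hl2
      linarith [(hT ℓ).le_r ((z ^ n).arg / n)]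
    obtain ⟨a, j, hj, hzj⟩ := hR z hzR hza hl1
    have hja := (hj0 a).trans hj
    refine ⟨a, j, ?_, ?_⟩
    · rw [← not_le]
      exact fun h => hl2 ((he1 a j hja z (hzj.trans_le hηδ)).2.2.2 h)
    · exact (he2 a j hja z (hzj.trans_le hηδ)).2.2.1 hl3
  have h1 : J a (ℓ + 1) = J a ℓ + 1 := by
    have := (hunique a a j (J a ℓ + 1) ha1 ha2 (by omega) (by omega)).2
    have := (hunique a a j (J a (ℓ + 1)) ha1 ha2 (by omega) le_rfl).2
    omega
  have h2 : ∀ b, b ≠ a → J b (ℓ + 1) = J b ℓ := by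
    intro b hb
    by_contra hne'
    have := hJmono b
    exact hb (hunique b a (J b (ℓ + 1)) j (by omega) le_rfl ha1 ha2).1
  fin_cases a
  · have := h2 1 (by simp)
    simp only [Fin.zero_eta] at h1
    omega
  · have := h2 0 (by simp)
    simp only [Fin.mk_one] at h1
    omega

/-- The eigenvalues are enclosed in ascending order. -/
theorem HasRootLogs.eventually_index_le_of_ascending (hω : B.HasRootLogs ω) (hn : Even n)
    (h4 : 4 ≤ n) (hδ : 0 < δ) {J : Fin 2 → ℕ → ℤ} (hJ : ∀ a, IsIndex Γ (ω a) δ (J a))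
    (hasc : Ascending B Γ) {a b : Fin 2} {s : ℤ}
    (hs : (ω a).re + 2 * Real.pi * s < (ω b).re) : ∀ᶠ ℓ in atTop, J b ℓ + s ≤ J a ℓ := by
  have hn0 : 0 < n := by omega
  set g := (ω b).re - ((ω a).re + 2 * Real.pi * s) with hg
  have hg0 : 0 < g := sub_pos.2 hs
  -- With η = g/8 each absolute value differs from the real part of its lattice point by less than
  -- g/4, which leaves the margin g/2 required by the ordering.
  obtain ⟨ja, ha⟩ := hω.exists_near hn h4 hδ (hJ a) (by positivity : 0 < g / 8)
  obtain ⟨jb, hb⟩ := hω.exists_near hn h4 hδ (hJ b) (by positivity : 0 < g / 8)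
  filter_upwards [ha, hb, hasc (g / 2) (by positivity), (hJ b).tendsto.eventually_ge_atTop jb,
    (hJ b).tendsto.eventually_ge_atTop (ja - s)] with ℓ ha hb hasc h1 h2
  obtain ⟨z, hz, -, -, -, hzn, hE⟩ := ha (J b ℓ + s) (by omega)
  obtain ⟨z', hz', -, -, -, hzn', hE'⟩ := hb (J b ℓ) h1
  refine hE.1 (hasc _ _ hz hz' ?_ (hE'.2 le_rfl))
  rw [norm_pow_rpow hn0, norm_pow_rpow hn0]
  rw [abs_lt] at hzn hzn'
  push_cast at hzn
  linarith

/-- The points number K + s and K of the two lattices have the same real part, so the ascending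
order cannot compare them. The nearby eigenvalues inherit the half-planes of the lattice points, so
a rule on half-planes applies. -/
theorem HasRootLogs.eventually_exists_pair (hω : B.HasRootLogs ω) (hn : Even n)
    (h4 : 4 ≤ n) (hδ : 0 < δ) {J : Fin 2 → ℕ → ℤ} (hJ : ∀ a, IsIndex Γ (ω a) δ (J a))
    {a b : Fin 2} {s : ℤ} (hs : (ω a).re + 2 * Real.pi * s = (ω b).re) (ha : 0 < (ω a).im)
    (hb : (ω b).im < 0) {K : ℕ → ℤ} (hK : Tendsto K atTop atTop) :
    ∀ᶠ ℓ in atTop, ∃ l l', B.IsEigenvalue l ∧ B.IsEigenvalue l' ∧ 0 < l.im ∧ l'.im < 0 ∧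
      |‖l‖ ^ (1 / n : ℝ) - ‖l'‖ ^ (1 / n : ℝ)| < Real.pi ∧
      ((Γ ℓ).Encloses l ↔ K ℓ + s ≤ J a ℓ) ∧ ((Γ ℓ).Encloses l' ↔ K ℓ ≤ J b ℓ) := by
  have hn0 : 0 < n := by omega
  have hpi := Real.pi_pos
  -- The radius is below |Im ω|, which preserves the half-plane, and at most π/4, which keeps the
  -- two absolute values within π of each other.
  obtain ⟨ja, hja⟩ := hω.exists_near hn h4 hδ (hJ a)
    (lt_min ha (by positivity : 0 < Real.pi / 4))
  obtain ⟨jb, hjb⟩ := hω.exists_near hn h4 hδ (hJ b)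
    (lt_min (neg_pos.2 hb) (by positivity : 0 < Real.pi / 4))
  filter_upwards [hja, hjb, hK.eventually_ge_atTop jb, hK.eventually_ge_atTop (ja - s)] with
    ℓ hja hjb h1 h2
  obtain ⟨z, hz, hzη, hza, -, hzn, hE⟩ := hja (K ℓ + s) (by omega)
  obtain ⟨z', hz', hzη', hza', -, hzn', hE'⟩ := hjb (K ℓ) h1
  refine ⟨_, _, hz, hz', im_pow_pos hn0 hza ?_, im_pow_neg hn0 hza' ?_, ?_, hE, hE'⟩
  · have := abs_lt.1 ((Complex.abs_im_le_norm _).trans_lt (hzη.trans_le (min_le_left _ _)))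
    rw [Complex.sub_im, latticePt_im] at this
    linarith
  · have := abs_lt.1 ((Complex.abs_im_le_norm _).trans_lt (hzη'.trans_le (min_le_left _ _)))
    rw [Complex.sub_im, latticePt_im] at this
    linarith
  · rw [norm_pow_rpow hn0, norm_pow_rpow hn0]
    have m1 := min_le_right (ω a).im (Real.pi / 4)
    have m2 := min_le_right (-(ω b).im) (Real.pi / 4)
    rw [abs_lt] at hzn hzn' ⊢
    push_cast at hzn
    constructor <;> linarith

theorem HasRootLogs.eventually_index_le_of_upperFirst (hω : B.HasRootLogs ω) (hn : Even n)
    (h4 : 4 ≤ n) (hδ : 0 < δ) {J : Fin 2 → ℕ → ℤ} (hJ : ∀ a, IsIndex Γ (ω a) δ (J a))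
    (hup : UpperFirst B Γ) {a b : Fin 2} {s : ℤ} (hs : (ω a).re + 2 * Real.pi * s = (ω b).re)
    (ha : 0 < (ω a).im) (hb : (ω b).im < 0) : ∀ᶠ ℓ in atTop, J b ℓ + s ≤ J a ℓ := by
  filter_upwards [hup, hω.eventually_exists_pair hn h4 hδ hJ hs ha hb (hJ b).tendsto] with
    ℓ hup ⟨l, l', hl, hl', him, him', hd, hE, hE'⟩
  exact hE.1 (hup l l' hl hl' him him' hd (hE'.2 le_rfl))

theorem HasRootLogs.eventually_index_le_of_lowerFirst (hω : B.HasRootLogs ω) (hn : Even n)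
    (h4 : 4 ≤ n) (hδ : 0 < δ) {J : Fin 2 → ℕ → ℤ} (hJ : ∀ a, IsIndex Γ (ω a) δ (J a))
    (hlow : LowerFirst B Γ) {a b : Fin 2} {s : ℤ} (hs : (ω a).re + 2 * Real.pi * s = (ω b).re)
    (ha : 0 < (ω a).im) (hb : (ω b).im < 0) : ∀ᶠ ℓ in atTop, J a ℓ - s ≤ J b ℓ := by
  have hK : Tendsto (fun ℓ => J a ℓ - s) atTop atTop :=
    tendsto_atTop_add_const_right _ (-s) (hJ a).tendsto
  filter_upwards [hlow, hω.eventually_exists_pair hn h4 hδ hJ hs ha hb hK] with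
    ℓ hlow ⟨l, l', hl, hl', him, him', hd, hE, hE'⟩
  exact hE'.1 (hlow l l' hl hl' him him' hd (hE.2 (by omega)))

end BoundaryConditions

/-! ### The coefficient in terms of the logarithms of the roots. -/

namespace BoundaryConditions

variable {n : ℕ} {B : BoundaryConditions n} {ω : Fin 2 → ℂ} {Γ : ℕ → Contour n} {c₁ c₂ δ : ℝ}

variable (B) in
-- The cyclic symmetry 𝔪₂ = -ρ^ϰ 𝔪 replaces the constant coefficient by the leading one, which is
-- what the factorization of the polynomial supplies.
theorem frakC₀_eq (hn : Even n) (h4 : 4 ≤ n) : frakC₀ B.d B.a B.b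
    = -(frakM1k B.d B.a B.b - frakMk1 B.d B.a B.b) / (Complex.I * B.birkhoff.coeff 2) := by
  unfold frakC₀ frakM birkhoff
  rw [birkhoffPoly_coeff_two_eq B.d B.a B.b hn h4, neg_mul, mul_neg, neg_div_neg_eq, mul_assoc]

variable (n) in
theorem pi_div_nonneg : -(Real.pi / n) ≤ Real.pi / n := by
  have : 0 ≤ Real.pi / n := by positivity
  linarith

theorem intervalIntegrable_dlog {G : Contour n} {ω : ℂ} (hδ : 0 < δ)
    (h : ∀ φ, |φ| ≤ Real.pi / n → Away ω δ (G.pt φ)) :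
    IntervalIntegrable (fun φ => Complex.I * Complex.exp (Complex.I * G.pt φ) /
      (Complex.exp (Complex.I * G.pt φ) - Complex.exp (Complex.I * ω)) * deriv G.pt φ)
      MeasureTheory.volume (-(Real.pi / n)) (Real.pi / n) := by
  have hc := G.continuous_pt
  refine ContinuousOn.intervalIntegrable ?_
  rw [Set.uIcc_of_le (pi_div_nonneg n)]
  refine ContinuousOn.mul (ContinuousOn.div (by fun_prop) (by fun_prop) fun φ hφ => ?_)
    G.continuous_deriv_pt.continuousOn
  exact sub_ne_zero.2 (exp_ne_of_away hδ (h φ (abs_le.2 hφ)))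

/-- Partial fractions: w/(w - ξ₁) - w/(w - ξ₂) = (ξ₁ - ξ₂) w/((w - ξ₁)(w - ξ₂)). -/
theorem HasRootLogs.integral_limitTerm_eq (hω : B.HasRootLogs ω) (hn : Even n) (h4 : 4 ≤ n)
    (hne : Complex.exp (Complex.I * ω 0) ≠ Complex.exp (Complex.I * ω 1)) {G : Contour n}
    (hδ : 0 < δ) (h : ∀ φ, |φ| ≤ Real.pi / n → ∀ a, Away (ω a) δ (G.pt φ)) :
    ∫ φ in (-(Real.pi / n))..(Real.pi / n), B.limitTerm (G.pt φ) * deriv G.pt φ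
      = -frakC₀ B.d B.a B.b / (Complex.exp (Complex.I * ω 0) - Complex.exp (Complex.I * ω 1)) *
        ((∫ φ in (-(Real.pi / n))..(Real.pi / n), Complex.I * Complex.exp (Complex.I * G.pt φ) /
          (Complex.exp (Complex.I * G.pt φ) - Complex.exp (Complex.I * ω 0)) * deriv G.pt φ)
        - ∫ φ in (-(Real.pi / n))..(Real.pi / n), Complex.I * Complex.exp (Complex.I * G.pt φ) /
          (Complex.exp (Complex.I * G.pt φ) - Complex.exp (Complex.I * ω 1)) * deriv G.pt φ) := by
  rw [← intervalIntegral.integral_sub (intervalIntegrable_dlog hδ fun φ hφ => h φ hφ 0)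
    (intervalIntegrable_dlog hδ fun φ hφ => h φ hφ 1), ← intervalIntegral.integral_const_mul]
  refine intervalIntegral.integral_congr fun φ hφ => ?_
  rw [Set.uIcc_of_le (pi_div_nonneg n)] at hφ
  have h0 := sub_ne_zero.2 (exp_ne_of_away hδ (h φ (abs_le.2 hφ) 0))
  have h1 := sub_ne_zero.2 (exp_ne_of_away hδ (h φ (abs_le.2 hφ) 1))
  have h2 := sub_ne_zero.2 hne
  have h3 := hω.1
  simp only [limitTerm]
  rw [hω.2, B.frakC₀_eq hn h4]
  have hI := Complex.I_ne_zero
  field_simp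
  ring

/-- The coefficient in the strongly regular case, when the contours alternately enclose equally
many points of both lattices and one more point of the lattice number `0`. -/
theorem HasRootLogs.coefficientEq_of_index (hω : B.HasRootLogs ω) (hn : Even n) (h4 : 4 ≤ n)
    (hne : Complex.exp (Complex.I * ω 0) ≠ Complex.exp (Complex.I * ω 1))
    (hΓ : Acceptable B Γ) (hsep : Separates B Γ 1)
    (hidx : ∀ δ > 0, ∀ J : Fin 2 → ℕ → ℤ, (∀ a, IsIndex Γ (ω a) δ (J a)) →
      ∀ᶠ ℓ in atTop, J 1 ℓ ≤ J 0 ℓ ∧ J 0 ℓ ≤ J 1 ℓ + 1) :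
    CoefficientEq B Γ (frakC₀ B.d B.a B.b * (Complex.I * (ω 1 - ω 0 - Real.pi) /
      (Complex.exp (Complex.I * ω 0) - Complex.exp (Complex.I * ω 1)))) := by
  obtain ⟨δ, hδ, haway⟩ := hω.exists_away hn h4 hΓ
  obtain ⟨c₁, hc₁, c₂, hc₂, hT⟩ := hΓ.exists_tame
  have hr := hΓ.1
  choose J hJ using fun a => exists_isIndex h4 hc₂ hT hr hδ
    (haway.mono fun ℓ h φ hφ => h φ hφ a)
  set c : ℂ := frakC₀ B.d B.a B.b /
    (Complex.exp (Complex.I * ω 0) - Complex.exp (Complex.I * ω 1)) with hc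
  -- In the difference of the two index formulas the summand π and the lower endpoint of the contour
  -- cancel.
  set x : ℕ → ℂ := fun ℓ =>
    c * (Complex.I * (ω 1 - ω 0 - 2 * Real.pi * ((J 0 ℓ - J 1 ℓ : ℤ) : ℂ))) with hx
  have hlim : Tendsto (fun ℓ => (Γ ℓ).integral B - x ℓ) atTop (𝓝 0) := by
    have h1 := (hω.tendsto_integral_sub hn h4 hΓ).add
      (((hJ 0).integral.sub (hJ 1).integral).const_mul (-c))
    simp only [sub_zero, mul_zero, add_zero] at h1
    refine h1.congr' ?_
    filter_upwards [haway] with ℓ hℓ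
    rw [hω.integral_limitTerm_eq hn h4 hne hδ hℓ, hx, hc]
    push_cast
    ring
  have hD := hidx δ hδ J hJ
  have hstep := hω.eventually_index_succ hn h4 hne hT hr hδ hJ hsep
  have hbound : ∀ᶠ ℓ in atTop, ‖(Γ ℓ).integral B‖
      ≤ 1 + ‖c‖ * (‖ω 1 - ω 0‖ + 2 * Real.pi) := by
    filter_upwards [hD, (hlim.norm.eventually_le_const (by norm_num : ‖(0 : ℂ)‖ < 1))] with
      ℓ ⟨h1, h2⟩ h3
    have h4 : ‖x ℓ‖ ≤ ‖c‖ * (‖ω 1 - ω 0‖ + 2 * Real.pi) := by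
      rw [hx, norm_mul, norm_mul, Complex.norm_I, one_mul]
      refine mul_le_mul_of_nonneg_left ((norm_sub_le _ _).trans ?_) (norm_nonneg c)
      gcongr
      rw [norm_mul, Complex.norm_intCast]
      have h5 : |((J 0 ℓ - J 1 ℓ : ℤ) : ℝ)| ≤ 1 := by
        have : |J 0 ℓ - J 1 ℓ| ≤ 1 := abs_le.2 ⟨by omega, by omega⟩
        exact_mod_cast this
      have h6 : ‖(2 * Real.pi : ℂ)‖ = 2 * Real.pi := by
        simp [abs_of_pos Real.pi_pos]
      rw [h6]
      nlinarith [Real.two_pi_pos]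
    calc ‖(Γ ℓ).integral B‖ = ‖((Γ ℓ).integral B - x ℓ) + x ℓ‖ := by rw [sub_add_cancel]
      _ ≤ _ := (norm_add_le _ _).trans (add_le_add h3 h4)
  refine cesaroLim_of_tendsto_add_succ hbound ?_
  have h1 := (hlim.add ((tendsto_add_atTop_iff_nat 1).2 hlim)).add_const
    (2 * (c * (Complex.I * (ω 1 - ω 0 - Real.pi))))
  have e : 2 * (frakC₀ B.d B.a B.b * (Complex.I * (ω 1 - ω 0 - Real.pi) /
      (Complex.exp (Complex.I * ω 0) - Complex.exp (Complex.I * ω 1))))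
      = 0 + 0 + 2 * (c * (Complex.I * (ω 1 - ω 0 - Real.pi))) := by rw [hc]; ring
  rw [e]
  refine h1.congr' ?_
  filter_upwards [hD, (tendsto_add_atTop_nat 1).eventually hD, hstep] with ℓ ha hb hs
  -- The difference is always 0 or 1, while the sum of the indices grows by one and so changes
  -- parity; hence 0 and 1 alternate and consecutive values of x add up to twice the mean.
  have h5 : J 0 (ℓ + 1) - J 1 (ℓ + 1) = 1 - (J 0 ℓ - J 1 ℓ) := by omega
  simp only [hx]
  rw [h5]
  push_cast
  ring

/-- The coefficient in the case of a double root. -/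
theorem HasRootLogs.coefficientEq_of_eq (hω : B.HasRootLogs ω) (hn : Even n) (h4 : 4 ≤ n)
    (heq : ω 0 = ω 1) (hΓ : Acceptable B Γ) :
    CoefficientEq B Γ (-frakC₀ B.d B.a B.b / Complex.exp (Complex.I * ω 0)) := by
  obtain ⟨δ, hδ, haway⟩ := hω.exists_away hn h4 hΓ
  obtain ⟨c₁, hc₁, c₂, hc₂, hT⟩ := hΓ.exists_tame
  have hr := hΓ.1
  refine cesaroLim_of_tendsto ?_
  set c : ℂ := -frakC₀ B.d B.a B.b with hc
  set ξ := Complex.exp (Complex.I * ω 0) with hξ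
  have hξ0 : ξ ≠ 0 := Complex.exp_ne_zero _
  have hFTC : ∀ᶠ ℓ in atTop,
      ∫ φ in (-(Real.pi / n))..(Real.pi / n), B.limitTerm ((Γ ℓ).pt φ) * deriv (Γ ℓ).pt φ
        = -c / (Complex.exp (Complex.I * (Γ ℓ).pt (Real.pi / n)) - ξ)
          - -c / (Complex.exp (Complex.I * (Γ ℓ).pt (-(Real.pi / n))) - ξ) := by
    filter_upwards [haway] with ℓ hℓ
    have hne : ∀ φ ∈ Set.uIcc (-(Real.pi / n)) (Real.pi / n),
        Complex.exp (Complex.I * (Γ ℓ).pt φ) - ξ ≠ 0 := by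
      intro φ hφ
      rw [Set.uIcc_of_le (pi_div_nonneg n)] at hφ
      exact sub_ne_zero.2 (exp_ne_of_away hδ (hℓ φ (abs_le.2 hφ) 0))
    have heval : ∀ φ, B.birkhoff.eval (Complex.exp (Complex.I * (Γ ℓ).pt φ))
        = B.birkhoff.coeff 2 * (Complex.exp (Complex.I * (Γ ℓ).pt φ) - ξ) ^ 2 := by
      intro φ
      rw [hω.2, ← heq, sq]
    -- For a double root the integrand has a single-valued antiderivative, so no lattice index
    -- enters.
    refine intervalIntegral.integral_eq_sub_of_hasDerivAt
      (f := fun φ => -c / (Complex.exp (Complex.I * (Γ ℓ).pt φ) - ξ)) (fun φ hφ => ?_) ?_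
    · have hd : HasDerivAt (Γ ℓ).pt (deriv (Γ ℓ).pt φ) φ :=
        ((Γ ℓ).hasDerivAt_pt φ).differentiableAt.hasDerivAt
      have h1 := (((hd.const_mul Complex.I).cexp.sub_const ξ).fun_inv (hne φ hφ)).const_mul (-c)
      simp only [← div_eq_mul_inv] at h1
      refine h1.congr_deriv ?_
      have h2 := hω.1
      have h3 := hne φ hφ
      rw [limitTerm, heval, hc, B.frakC₀_eq hn h4]
      have hI := Complex.I_ne_zero
      field_simp
    · refine ContinuousOn.intervalIntegrable fun φ hφ => ContinuousAt.continuousWithinAt ?_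
      refine ContinuousAt.mul ?_ (Γ ℓ).continuous_deriv_pt.continuousAt
      refine ContinuousAt.comp (f := (Γ ℓ).pt) (B.continuousAt_limitTerm ?_)
        (Γ ℓ).continuous_pt.continuousAt
      rw [heval]
      exact mul_ne_zero hω.1 (pow_ne_zero 2 (hne φ hφ))
  obtain ⟨he1, he2⟩ := tendsto_exp_end (by omega) hT hr (0 : ℂ)
  simp only [sub_zero] at he1 he2
  have h1 : Tendsto (fun ℓ => -c / (Complex.exp (Complex.I * (Γ ℓ).pt (Real.pi / n)) - ξ)) atTop
      (𝓝 (-c / (0 - ξ))) :=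
    tendsto_const_nhds.div (he1.sub_const ξ) (by simpa using hξ0)
  have h2 : Tendsto (fun ℓ => -c / (Complex.exp (Complex.I * (Γ ℓ).pt (-(Real.pi / n))) - ξ)) atTop
      (𝓝 (-c * 0 / (1 - ξ * 0))) := by
    -- At the lower end e^{iz} is unbounded, so the fraction is rewritten in terms of e^{-iz} → 0.
    refine ((he2.const_mul (-c)).div (tendsto_const_nhds.sub (he2.const_mul ξ)) (by simp)).congr
      fun ℓ => ?_
    have := Complex.exp_ne_zero (Complex.I * (Γ ℓ).pt (-(Real.pi / n)))
    simp only [Pi.div_apply, Complex.exp_neg]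
    rw [← mul_div_mul_right (-c * _) _ this]
    congr 1 <;> field_simp
  have h3 := ((hω.tendsto_integral_sub hn h4 hΓ).add (h1.sub h2))
  have e : 0 + (-c / (0 - ξ) - -c * 0 / (1 - ξ * 0)) = c / ξ := by
    simp
  rw [e] at h3
  refine h3.congr' ?_
  filter_upwards [hFTC] with ℓ hℓ
  rw [hℓ]
  ring

end BoundaryConditions

/-! ### Choice of the logarithms and the values of the coefficient. -/

namespace BoundaryConditions

variable {n : ℕ} {B : BoundaryConditions n} {ξ₁ ξ₂ : ℂ}

theorem birkhoff_eval_eq (hn : 2 ≤ n) (hξ : B.birkhoff.roots = {ξ₁, ξ₂}) (w : ℂ) :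
    B.birkhoff.eval w = B.birkhoff.coeff 2 * ((w - ξ₁) * (w - ξ₂)) := by
  have hcard : B.birkhoff.roots.card = 2 := by rw [hξ]; rfl
  have hdeg : B.birkhoff.natDegree = 2 :=
    le_antisymm (birkhoffPoly_natDegree_le _ _ _ hn) (hcard ▸ B.birkhoff.card_roots')
  have h := C_leadingCoeff_mul_prod_multiset_X_sub_C (hcard.trans hdeg.symm)
  rw [hξ, leadingCoeff, hdeg] at h
  rw [← congrArg (eval w) h]
  simp

/-- By Vieta ξ₁ξ₂ = 𝔪/𝔪₂, and the cyclic symmetry makes the two extreme coefficients equal in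
modulus. If |ξ₁| ≠ |ξ₂|, the two lattices therefore lie on opposite sides of the real axis. -/
theorem norm_root_mul_root (hn : Even n) (h4 : 4 ≤ n) (hreg : B.Regular)
    (hξ : B.birkhoff.roots = {ξ₁, ξ₂}) : ‖ξ₁‖ * ‖ξ₂‖ = 1 := by
  have h0 := birkhoff_eval_eq (by omega) hξ 0
  rw [← coeff_zero_eq_eval_zero] at h0
  have h2 : B.birkhoff.coeff 2 = -rho n ^ (∑ j, B.d j) * B.birkhoff.coeff 0 :=
    birkhoffPoly_coeff_two_eq B.d B.a B.b hn h4
  have hrho : ‖rho n‖ = 1 := (isPrimitiveRoot_rho (by omega : n ≠ 0)).norm'_eq_one (by omega)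
  have h3 := congrArg norm h2
  have h4 := congrArg norm h0
  rw [norm_mul, norm_neg, norm_pow, hrho, one_pow, one_mul] at h3
  rw [norm_mul, norm_mul, zero_sub, zero_sub, norm_neg, norm_neg, h3] at h4
  have h5 : ‖B.birkhoff.coeff 0‖ ≠ 0 := norm_ne_zero_iff.2 hreg.1
  exact mul_left_cancel₀ h5 (by rw [← h4, mul_one])

theorem hasRootLogs_of_roots (hn : 2 ≤ n) (hreg : B.Regular) (hξ : B.birkhoff.roots = {ξ₁, ξ₂})
    {ω : Fin 2 → ℂ} (h0 : Complex.exp (Complex.I * ω 0) = ξ₁)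
    (h1 : Complex.exp (Complex.I * ω 1) = ξ₂) : B.HasRootLogs ω :=
  ⟨hreg.2, fun w => by rw [h0, h1]; exact birkhoff_eval_eq hn hξ w⟩

end BoundaryConditions

theorem exp_I_mul_neg_I_mul_log {ξ : ℂ} (hξ : ξ ≠ 0) :
    Complex.exp (Complex.I * (-Complex.I * Complex.log ξ)) = ξ := by
  rw [← mul_assoc, mul_neg, Complex.I_mul_I, neg_neg, one_mul, Complex.exp_log hξ]

theorem re_neg_I_mul_log (ξ : ℂ) : (-Complex.I * Complex.log ξ).re = ξ.arg := by
  simp [Complex.log_im]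

theorem im_neg_I_mul_log (ξ : ℂ) : (-Complex.I * Complex.log ξ).im = -Real.log ‖ξ‖ := by
  simp [Complex.log_re]

/-- Equal arguments would make -ξ₂/ξ₁ a nonpositive real number. -/
theorem arg_ne_arg_of_mem_slitPlane {ξ₁ ξ₂ : ℂ} (h1 : ξ₁ ≠ 0) (h : -ξ₂ / ξ₁ ∈ Complex.slitPlane) :
    ξ₂.arg ≠ ξ₁.arg := by
  intro ha
  have e : -ξ₂ / ξ₁ = ((-(‖ξ₂‖ / ‖ξ₁‖) : ℝ) : ℂ) := by
    have h1' : (‖ξ₁‖ : ℂ) ≠ 0 := by simpa using h1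
    have := Complex.exp_ne_zero (Complex.I * ξ₁.arg)
    conv_lhs => rw [← norm_mul_exp_arg ξ₁, ← norm_mul_exp_arg ξ₂, ha]
    push_cast
    field_simp
  rw [e, Complex.ofReal_mem_slitPlane] at h
  have : 0 ≤ ‖ξ₂‖ / ‖ξ₁‖ := by positivity
  linarith

namespace BoundaryConditions

variable {n : ℕ} {B : BoundaryConditions n} {ξ₁ ξ₂ : ℂ} {Γ : ℕ → Contour n}

theorem coefficientEq_of_mem_slitPlane (hn : Even n) (h4 : 4 ≤ n) (hreg : B.Regular)
    (hξ : B.birkhoff.roots = {ξ₁, ξ₂}) (hne : ξ₁ ≠ ξ₂) (hΓ : Acceptable B Γ)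
    (hsep : Separates B Γ 1) (hasc : Ascending B Γ) (hslit : -ξ₂ / ξ₁ ∈ Complex.slitPlane) :
    CoefficientEq B Γ (frakC₀ B.d B.a B.b * (Complex.log (-ξ₂ / ξ₁) / (ξ₁ - ξ₂))) := by
  have hprod := norm_root_mul_root hn h4 hreg hξ
  have h1 : ξ₁ ≠ 0 := by rintro rfl; simp at hprod
  have h2 : ξ₂ ≠ 0 := by rintro rfl; simp at hprod
  have hpi := Real.pi_pos
  -- Shifting the second logarithm by k periods places Re(ω₁ - ω₀) in (0, 2π). Then the points of
  -- the two lattices alternate from left to right, which gives J₁ ≤ J₀ ≤ J₁ + 1, and Re(ω₁ - ω₀) -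
  -- π lies in (-π, π), so the logarithm is principal.
  obtain ⟨k, hk0, hk1⟩ : ∃ k : ℤ, 0 < ξ₂.arg + 2 * Real.pi * k - ξ₁.arg ∧
      ξ₂.arg + 2 * Real.pi * k - ξ₁.arg < 2 * Real.pi := by
    have a1 := Complex.neg_pi_lt_arg ξ₁
    have a2 := Complex.arg_le_pi ξ₁
    have a3 := Complex.neg_pi_lt_arg ξ₂
    have a4 := Complex.arg_le_pi ξ₂
    rcases (arg_ne_arg_of_mem_slitPlane h1 hslit).lt_or_gt with h | h
    · exact ⟨1, by push_cast; linarith, by push_cast; linarith⟩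
    · exact ⟨0, by push_cast; linarith, by push_cast; linarith⟩
  set ω : Fin 2 → ℂ :=
    ![-Complex.I * Complex.log ξ₁, latticePt (-Complex.I * Complex.log ξ₂) k] with hω
  have e0 : Complex.exp (Complex.I * ω 0) = ξ₁ := exp_I_mul_neg_I_mul_log h1
  have e1 : Complex.exp (Complex.I * ω 1) = ξ₂ :=
    (exp_latticePt _ _).trans (exp_I_mul_neg_I_mul_log h2)
  have hL := hasRootLogs_of_roots (by omega) hreg hξ e0 e1
  have r0 : (ω 0).re = ξ₁.arg := re_neg_I_mul_log ξ₁
  have r1 : (ω 1).re = ξ₂.arg + 2 * Real.pi * k := by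
    rw [← re_neg_I_mul_log ξ₂]; exact latticePt_re _ _
  have hlog : Complex.log (-ξ₂ / ξ₁) = Complex.I * (ω 1 - ω 0 - Real.pi) := by
    have e : -ξ₂ / ξ₁ = Complex.exp (Complex.I * (ω 1 - ω 0 - Real.pi)) := by
      rw [mul_sub, mul_sub, Complex.exp_sub, Complex.exp_sub, e0, e1, mul_comm _ (Real.pi : ℂ),
        Complex.exp_pi_mul_I, div_neg, div_one, neg_div]
    have him : (Complex.I * (ω 1 - ω 0 - Real.pi)).im
        = ξ₂.arg + 2 * Real.pi * k - ξ₁.arg - Real.pi := by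
      rw [Complex.I_mul_im, Complex.sub_re, Complex.sub_re, r0, r1, Complex.ofReal_re]
    rw [e, Complex.log_exp] <;> rw [him] <;> linarith
  have key := hL.coefficientEq_of_index hn h4 (by rwa [e0, e1]) hΓ hsep fun δ hδ J hJ => by
    filter_upwards [hL.eventually_index_le_of_ascending hn h4 hδ hJ hasc (a := 0) (b := 1) (s := 0)
        (by rw [r0, r1]; push_cast; linarith),
      hL.eventually_index_le_of_ascending hn h4 hδ hJ hasc (a := 1) (b := 0) (s := -1)
        (by rw [r0, r1]; push_cast; linarith)] with ℓ h h'
    exact ⟨by omega, by omega⟩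
  rwa [e0, e1, ← hlog] at key

theorem log_norm_root {t : ℝ} (ht : 1 < t) (hn : Even n) (h4 : 4 ≤ n) (hreg : B.Regular)
    (hξ : B.birkhoff.roots = {ξ₁, ξ₂}) (h : ξ₂ = t * ξ₁) :
    2 * Real.log ‖ξ₁‖ = -Real.log t := by
  have hprod := norm_root_mul_root hn h4 hreg hξ
  have h1 : ‖ξ₁‖ ≠ 0 := by intro h0; simp [h0] at hprod
  have ht0 : t ≠ 0 := by positivity
  rw [h, norm_mul, Complex.norm_real, Real.norm_of_nonneg (by linarith)] at hprod
  have := congrArg Real.log hprod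
  rw [Real.log_mul h1 (mul_ne_zero ht0 h1), Real.log_mul ht0 h1, Real.log_one] at this
  linarith

/-- The two lattices when `ξ₂ = t ξ₁`: the second one lies below the first one, shifted by `k`
periods. -/
theorem exists_rootLogs_of_eq_mul {t : ℝ} (ht : 1 < t) (hn : Even n) (h4 : 4 ≤ n)
    (hreg : B.Regular) (hξ : B.birkhoff.roots = {ξ₁, ξ₂}) (h : ξ₂ = t * ξ₁) (k : ℤ) :
    ∃ ω : Fin 2 → ℂ, B.HasRootLogs ω ∧ Complex.exp (Complex.I * ω 0) = ξ₁ ∧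
      Complex.exp (Complex.I * ω 1) = ξ₂ ∧ 0 < (ω 0).im ∧ (ω 1).im < 0 ∧
      (ω 1).re = (ω 0).re + 2 * Real.pi * k ∧
      Complex.I * (ω 1 - ω 0 - Real.pi)
        = Real.log t + (2 * k - 1) * (Real.pi * Complex.I) := by
  have hprod := norm_root_mul_root hn h4 hreg hξ
  have h1 : ξ₁ ≠ 0 := by rintro rfl; simp at hprod
  have hlog := log_norm_root ht hn h4 hreg hξ h
  have hlt := Real.log_pos ht
  set ω₀ := -Complex.I * Complex.log ξ₁ with hω₀
  set ω₁ := latticePt (ω₀ - Complex.I * Real.log t) k with hω₁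
  have i0 : ω₀.im = -Real.log ‖ξ₁‖ := im_neg_I_mul_log ξ₁
  have i1 : ω₁.im = ω₀.im - Real.log t := by
    rw [hω₁, latticePt_im, Complex.sub_im, Complex.I_mul_im, Complex.ofReal_re]
  have r1 : ω₁.re = ω₀.re + 2 * Real.pi * k := by
    rw [hω₁, latticePt_re, Complex.sub_re, Complex.I_mul_re, Complex.ofReal_im, neg_zero, sub_zero]
  have e0 : Complex.exp (Complex.I * ω₀) = ξ₁ := exp_I_mul_neg_I_mul_log h1
  have e1 : Complex.exp (Complex.I * ω₁) = ξ₂ := by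
    rw [hω₁, exp_latticePt, mul_sub, Complex.exp_sub, e0, ← mul_assoc, Complex.I_mul_I, neg_one_mul,
      Complex.exp_neg, ← Complex.ofReal_exp, Real.exp_log (by linarith), div_inv_eq_mul, h, mul_comm]
  refine ⟨![ω₀, ω₁], hasRootLogs_of_roots (by omega) hreg hξ e0 e1, e0, e1, ?_, ?_, r1, ?_⟩
  · change 0 < ω₀.im
    linarith
  · change ω₁.im < 0
    linarith
  · change Complex.I * (ω₁ - ω₀ - Real.pi) = _
    rw [hω₁, latticePt]
    linear_combination (-(Real.log t : ℂ)) * Complex.I_mul_I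

/-- The shift k = 0 pairs points of the same number and equal real part. The first lattice lies in
the upper half-plane and goes first, so J₁ ≤ J₀; the other inequality compares points a full period
apart. -/
theorem coefficientEq_of_upperFirst {t : ℝ} (ht : 1 < t) (hn : Even n) (h4 : 4 ≤ n)
    (hreg : B.Regular) (hξ : B.birkhoff.roots = {ξ₁, ξ₂}) (hne : ξ₁ ≠ ξ₂) (h : ξ₂ = t * ξ₁)
    (hΓ : Acceptable B Γ) (hsep : Separates B Γ 1) (hasc : Ascending B Γ)
    (hup : UpperFirst B Γ) :
    CoefficientEq B Γ (frakC₀ B.d B.a B.b *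
      ((Real.log t - Real.pi * Complex.I) / (ξ₁ - ξ₂))) := by
  obtain ⟨ω, hL, e0, e1, him0, him1, hre, hval⟩ := exists_rootLogs_of_eq_mul ht hn h4 hreg hξ h 0
  have key := hL.coefficientEq_of_index hn h4 (by rwa [e0, e1]) hΓ hsep fun δ hδ J hJ => by
    filter_upwards [hL.eventually_index_le_of_upperFirst hn h4 hδ hJ hup hre.symm him0 him1,
      hL.eventually_index_le_of_ascending hn h4 hδ hJ hasc (a := 1) (b := 0) (s := -1)
        (by rw [hre]; push_cast; linarith [Real.pi_pos])] with ℓ h h'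
    exact ⟨by omega, by omega⟩
  rw [hval, e0, e1] at key
  convert key using 3
  push_cast
  ring

/-- The shift k = 1 pairs point j of the second lattice with point j + 1 of the first. The lower one
goes first, so J₀ - 1 ≤ J₁; the factor 2k - 1 then changes the sign of iπ. -/
theorem coefficientEq_of_lowerFirst {t : ℝ} (ht : 1 < t) (hn : Even n) (h4 : 4 ≤ n)
    (hreg : B.Regular) (hξ : B.birkhoff.roots = {ξ₁, ξ₂}) (hne : ξ₁ ≠ ξ₂) (h : ξ₂ = t * ξ₁)
    (hΓ : Acceptable B Γ) (hsep : Separates B Γ 1) (hasc : Ascending B Γ)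
    (hlow : LowerFirst B Γ) :
    CoefficientEq B Γ (frakC₀ B.d B.a B.b *
      ((Real.log t + Real.pi * Complex.I) / (ξ₁ - ξ₂))) := by
  obtain ⟨ω, hL, e0, e1, him0, him1, hre, hval⟩ := exists_rootLogs_of_eq_mul ht hn h4 hreg hξ h 1
  have key := hL.coefficientEq_of_index hn h4 (by rwa [e0, e1]) hΓ hsep fun δ hδ J hJ => by
    filter_upwards [hL.eventually_index_le_of_lowerFirst hn h4 hδ hJ hlow hre.symm him0 him1,
      hL.eventually_index_le_of_ascending hn h4 hδ hJ hasc (a := 0) (b := 1) (s := 0)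
        (by rw [hre]; push_cast; linarith [Real.pi_pos])] with ℓ h h'
    exact ⟨by omega, by omega⟩
  rw [hval, e0, e1] at key
  convert key using 3
  push_cast
  ring

theorem coefficientEq_of_double_root {ξ : ℂ} (hn : Even n) (h4 : 4 ≤ n) (hreg : B.Regular)
    (hξ : B.birkhoff.roots = {ξ, ξ}) (hΓ : Acceptable B Γ) :
    CoefficientEq B Γ (-frakC₀ B.d B.a B.b / ξ) := by
  have hprod := norm_root_mul_root hn h4 hreg hξ
  have h1 : ξ ≠ 0 := by rintro rfl; simp at hprod
  have e := exp_I_mul_neg_I_mul_log h1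
  have key := (hasRootLogs_of_roots (ω := fun _ => -Complex.I * Complex.log ξ) (by omega) hreg hξ
    e e).coefficientEq_of_eq hn h4 rfl hΓ
  rwa [e] at key

end BoundaryConditions

end BirkhoffTrace

theorem theorem1p3 {n : ℕ} (hn : Even n) (hn4 : 4 ≤ n)
    (B : BirkhoffTrace.BoundaryConditions n) (hnorm : B.Normalized) (hreg : B.Regular)
    (ξ₁ ξ₂ : ℂ) (hξ : B.birkhoff.roots = {ξ₁, ξ₂})
    (Γ : ℕ → BirkhoffTrace.Contour n) (hΓ : BirkhoffTrace.Acceptable B Γ) :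
    -- strongly regular boundary conditions
    (ξ₁ ≠ ξ₂ → BirkhoffTrace.Separates B Γ 1 → BirkhoffTrace.Ascending B Γ →
      (-ξ₂ / ξ₁ ∈ Complex.slitPlane →
        BirkhoffTrace.CoefficientEq B Γ
          (BirkhoffTrace.frakC₀ B.d B.a B.b * (Complex.log (-ξ₂ / ξ₁) / (ξ₁ - ξ₂)))) ∧
      (∀ t : ℝ, 1 < t → ξ₂ = t * ξ₁ →
        (BirkhoffTrace.UpperFirst B Γ →
          BirkhoffTrace.CoefficientEq B Γ (BirkhoffTrace.frakC₀ B.d B.a B.b *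
            ((Real.log t - Real.pi * Complex.I) / (ξ₁ - ξ₂)))) ∧
        (BirkhoffTrace.LowerFirst B Γ →
          BirkhoffTrace.CoefficientEq B Γ (BirkhoffTrace.frakC₀ B.d B.a B.b *
            ((Real.log t + Real.pi * Complex.I) / (ξ₁ - ξ₂)))))) ∧
    -- regular, but not strongly regular boundary conditions
    (ξ₁ = ξ₂ → BirkhoffTrace.Separates B Γ 2 →
      BirkhoffTrace.CoefficientEq B Γ (-BirkhoffTrace.frakC₀ B.d B.a B.b / ξ₁) ∧
      BirkhoffTrace.CoefficientEq B Γ (-BirkhoffTrace.frakC₀ B.d B.a B.b / ξ₂)) := by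
  refine ⟨fun hne hsep hasc => ⟨fun hslit => ?_, fun t ht h => ⟨fun hup => ?_, fun hlow => ?_⟩⟩,
    fun heq _ => ?_⟩
  · exact BirkhoffTrace.BoundaryConditions.coefficientEq_of_mem_slitPlane hn hn4 hreg hξ hne hΓ hsep
      hasc hslit
  · exact BirkhoffTrace.BoundaryConditions.coefficientEq_of_upperFirst ht hn hn4 hreg hξ hne h hΓ
      hsep hasc hup
  · exact BirkhoffTrace.BoundaryConditions.coefficientEq_of_lowerFirst ht hn hn4 hreg hξ hne h hΓ
      hsep hasc hlow
  · subst heq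
    exact ⟨BirkhoffTrace.BoundaryConditions.coefficientEq_of_double_root hn hn4 hreg hξ hΓ,
      BirkhoffTrace.BoundaryConditions.coefficientEq_of_double_root hn hn4 hreg hξ hΓ⟩
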